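/- **Notation.** Let $V=\mathbb C((z))$ and $V_0=z\mathbb C[[z]]$, and let $\pi:V\to V/V_0\simeq\mathbb C[z^{-1}]$ be the projection. The Sato Grassmannian UGM is the set of subspaces $U\subset V$ for which $\operatorname{Ker}(\pi|_U)$ and $\operatorname{Coker}(\pi|_U)$ are finite-dimensional of the same dimension. A *frame* of $U\in$ UGM is a basis $(u_j)_{j\ge1}$ of $U$, written $u_j=\sum_{i\in\mathbb Z}X_{i,j}z^{i+1}$, such that for some $l\ge0$: $X_{-j,j}=1$ and $X_{i,j}=0$ for $i<-j$ whenever $j>l$; and $X_{i,j}=0$ for $i<-l$ whenever $j\le l$. Let $\xi(x,\lambda)=\sum_{j\ge1}x_j\lambda^j$ and $e^{\xi(x,\lambda)}=\sum_{l\ge 0} p_l(x)\lambda^l$, with $p_l=0$ for $l<0$. For a partition $\mu$ put $s_\mu=\det(p_{\mu_i-i+j})$ and $X_\mu=\det(X_{\mu_i-i,\,j})_{i,j\ge1}$ (the eventually constant value of the truncated determinants). The tau function of $X$ is the formal power series $\tau(x;X)=\sum_\mu X_\mu s_\mu(x)$ in $x=(x_1,x_2,\dots)$. *Generalized solitons.*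 Let $n>k>0$, let $r_0,\dots,r_N\ge0$ have sum $n$, let $\lambda_{s,i}$ ($0\le s\le N$, $1\le i\le r_s$) be nonzero complex numbers that are distinct for each fixed $s$, and let $A=(a_{(s,i),j})$ be an $n\times k$ matrix of rank $k$. The $(n,k)$ generalized soliton with these parameters is the Wronskian $\mathrm{Wr}(f_1,\dots,f_k)=\det(\partial_{x_1}^{i-1}f_j)$, where $f_j=\sum_{s}\sum_i a_{(s,i),j}\,\frac{d^s}{d\lambda^s}e^{\xi(x,\lambda)}\big|_{\lambda=\lambda_{s,i}}$. *Curves.* Let $m\ge1$. For $\rho\in\mathbb C^{3m}$ let $U_a(\rho)=\mathbb C[x,y]/(y^3-x\prod_{i=1}^{3m}(x-\rho_i^3))$. Expand elements $F$ of $U_a(\rho)$ at infinity by $x=z^{-3}$, $y=z^{-3m-1}\hat f(z)$, with $\hat f(z)=\prod_i(1-\rho_i^3z^3)^{1/3}$, and put $\iota(F)=z^{3m}F(z)$. Let $Y(\rho)$ be the sequence consisting of $z^{3m-3i}$ $(0\le i<2m)$, $z^{-1-3i}\hat f$ $(0\le i<m)$, and then, for $c=3m,3m+1,\dots$, $z^{-c}\hat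 f^{\,(c\bmod 3)}$; these are the functions $z^{3m-3i}$, $z^{-1-3i}\hat f$, $z^{-3m-2-3i}\hat f^2$, $i\ge0$. **Theorem.** Let $\lambda_1,\dots,\lambda_m$ be nonzero complex numbers with $\lambda_1^3,\dots,\lambda_m^3$ distinct, let $f(z)=\prod_{j=1}^m(1-\lambda_j^3z^3)$, let $\rho^0=(\lambda_1,\dots,\lambda_m,\lambda_1,\dots,\lambda_m,\lambda_1,\dots,\lambda_m)$, and let $U_a(X^{\rm aff}_{\rm sing})=U_a(\rho^0)$ be the affine ring of the curve $y^3=x\prod_{j=1}^m(x-\lambda_j^3)^3$. 1. The singular points of this affine curve are exactly the points $(\lambda_j^3,0)$, and these are ordinary triple points. 2. For every $\rho$, $Y(\rho)$ is a frame of the point $\iota(U_a(\rho))$ of UGM. As $\rho\to\rho^0$, every coefficient of every element of $Y(\rho)$ tends to the corresponding coefficient for $Y(\rho^0)$, and every coefficient of $\tau(x;Y(\rho))$ tends to that of $\tau(x;Y(\rho^0))$. 3. Let $\omega=e^{2\pi i/3}$, and for $1\le j\le m$ put $\lambda_{j+m}=\omega\lambda_j$ and $\lambda_{j+2m}=\omega^2\lambda_j$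 (so that $\lambda_i$ is now defined for $1\le i\le 3m$). Then $f(z)^{-2}\iota(U_a(X^{\rm aff}_{\rm sing}))$ is a point of UGM, and the functions $$z^{-3m+1}\sum_{i=1}^{3m}\Big(\frac{a^{(0)}_{ij}}{1-\lambda_iz}+\frac{b^{(0)}_{ij}}{(1-\lambda_iz)^2}\Big)\ (1\le j\le m),\qquad z^{-3m+1}\sum_{i=1}^{3m}\frac{a^{(r)}_{ij}}{1-\lambda_iz}\ (r=1,2,\ 1\le j\le m),\qquad z^{-j}\ (j\ge3m)$$ form a frame of it; the first $3m$ functions, ordered by $r=0,1,2$ and then by $j$, are the columns $3m,3m-1,\dots,1$, and $z^{-j}$ is the column $j+1$. Here, for $1\le i\le m$, $$a^{(0)}_{ij}=-\Big(2m-j+2\sum_{l\ne i}\frac{\lambda_l^3}{\lambda_i^3-\lambda_l^3}\Big)\frac{\lambda_i^{3j-8}}{3\prod_{l\neq i}(\lambda_i^3-\lambda_l^3)^2},\quad b^{(0)}_{ij}=\frac{\lambda_i^{3j-8}}{9\prod_{l\ne i}(\lambda_i^3-\lambda_l^3)^2},\quad a^{(r)}_{ij}=\frac{\lambda_i^{3j-3-r}}{3\prod_{l\ne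 i}(\lambda_i^3-\lambda_l^3)}\ (r=1,2),$$ with $l$ running over $1,\dots,m$, and, for $k=1,2$, $a^{(0)}_{i+km,j}=\omega^ka^{(0)}_{ij}$, $b^{(0)}_{i+km,j}=\omega^kb^{(0)}_{ij}$, $a^{(r)}_{i+km,j}=\omega^{-rk}a^{(r)}_{ij}$. 4. This frame $X$ is the frame of a $(6m,3m)$ generalized soliton: $\tau(x;X)=\mathrm{Wr}(f_1,\dots,f_{3m})$ is the $(6m,3m)$ generalized soliton with $N=1$, $r_0=r_1=3m$, $\lambda_{0,i}=\lambda_{1,i}=\lambda_i$, and the $6m\times3m$ matrix (of rank $3m$) $$A=\begin{pmatrix}A^{(0)}&A^{(1)}&A^{(2)}\\B^{(0)}&0&0\end{pmatrix},\qquad A^{(0)}=(a^{(0)}_{ij}+b^{(0)}_{ij}),\quad A^{(r)}=(a^{(r)}_{ij})\ (r=1,2),\quad B^{(0)}=(\lambda_ib^{(0)}_{ij}).$$ 5. For every frame $Y$ of $\iota(U_a(X^{\rm aff}_{\rm sing}))$ there is a constant $c\neq0$ such that $$\tau(x;Y)=c\,e^{\sum_{n\ge1}g_nx_n}\,\mathrm{Wr}(f_1,\dots,f_{3m}),\qquad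 g_n=-2\sum_{i=1}^{3m}\lambda_i^n,$$ where $\sum_{n\ge1}g_nz^n/n=\log f(z)^2$. -/

import Mathlib

open scoped Topology

noncomputable section

namespace TrigonalKP

/-! ## The Sato Grassmannian -/

/-- `V = ℂ((z))`. -/
abbrev V : Type := LaurentSeries ℂ

/-- The monomial `z ^ n`, `n ∈ ℤ`. -/
def zPow (n : ℤ) : V := HahnSeries.single n 1

/-- The constant Laurent series. -/
def const (c : ℂ) : V := HahnSeries.C c

/-- The subspace `V₀ = z ℂ[[z]]` of `V`. -/
def V0 : Submodule ℂ V where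
  carrier := {F | ∀ n : ℤ, n ≤ 0 → F.coeff n = 0}
  add_mem' := by
    intro a b ha hb n hn
    simp [ha n hn, hb n hn]
  zero_mem' := by
    intro n _
    simp
  smul_mem' := by
    intro c a ha n hn
    simp [ha n hn]

/-- `U` belongs to the Sato Grassmannian: with `π : V → V ⧸ V₀ ≃ ℂ[z⁻¹]` the projection, the kernel
`U ∩ V₀` and the cokernel `(V ⧸ V₀) ⧸ π(U)` of `π|_U` are finite-dimensional, of equal dimension. -/
def MemUGM (U : Submodule ℂ V) : Prop :=
  FiniteDimensional ℂ ↥(U ⊓ V0) ∧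
  FiniteDimensional ℂ ((V ⧸ V0) ⧸ U.map V0.mkQ) ∧
  Module.finrank ℂ ↥(U ⊓ V0) = Module.finrank ℂ ((V ⧸ V0) ⧸ U.map V0.mkQ)

/-- Multiplication by a Laurent series, as a linear map. -/
def mulBy (G : V) : V →ₗ[ℂ] V where
  toFun F := G * F
  map_add' a b := mul_add G a b
  map_smul' c a := by
    simp only [RingHom.id_apply, ← HahnSeries.C_mul_eq_smul]
    ring

/-- The entry in row `i ∈ ℤ` of column `j` of the matrix attached to a sequence of Laurent series:
the coefficient of `z ^ (i + 1)`. Columns are numbered from `0`, so that column `j` here is the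
column with label `j + 1` when labels start at `1`. -/
def entry (X : ℕ → V) (i : ℤ) (j : ℕ) : ℂ := (X j).coeff (i + 1)

/-- The normalization of the matrix of a frame. With labels `j' = j + 1`: there is `l` such that the
entry `(i, j')` is `1` if `j' > l` and `i = -j'`, and is `0` if `j' > l` and `i < -j'`, or if
`j' ≤ l` and `i < -l`. -/
def FrameCond (X : ℕ → V) : Prop :=
  ∃ l : ℕ,
    (∀ j : ℕ, l < j + 1 → entry X (-((j : ℤ) + 1)) j = 1) ∧
    (∀ j : ℕ, l < j + 1 → ∀ i : ℤ, i < -((j : ℤ) + 1) → entry X i j = 0) ∧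
    (∀ j : ℕ, j + 1 ≤ l → ∀ i : ℤ, i < -(l : ℤ) → entry X i j = 0)

/-- `X` is a frame of the point `U` of the Sato Grassmannian: a normalized ordered basis. -/
def IsFrame (U : Submodule ℂ V) (X : ℕ → V) : Prop :=
  MemUGM U ∧ LinearIndependent ℂ X ∧ Submodule.span ℂ (Set.range X) = U ∧ FrameCond X

/-! ## Functions of the times `x = (x₁, x₂, …)`, as formal power series -/

/-- Formal power series in `x₁, x₂, …`; the variable `x_j` has index `j : ℕ+`. -/
abbrev TimeSeries : Type := MvPowerSeries ℕ+ ℂ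

/-- The weight `∑ j α_j` of a monomial `x ^ α` (`x_j` has weight `j`). -/
def wt (α : ℕ+ →₀ ℕ) : ℕ := Finsupp.weight (fun j : ℕ+ => (j : ℕ)) α

/-- The exponential `exp (∑_j c_j x_j) = ∏_j ∑_a (c_j x_j) ^ a / a!`; its coefficient at `x ^ α` is
`∏_j c_j ^ α_j / α_j !`. -/
def expLinear (c : ℕ+ → ℂ) : TimeSeries :=
  fun α => α.prod (fun j a => c j ^ a / (Nat.factorial a : ℂ))

/-- `exp ξ(x, μ)` with `ξ(x, μ) = ∑_j x_j μ ^ j`. -/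
def expXi (μ : ℂ) : TimeSeries := expLinear (fun j => μ ^ (j : ℕ))

/-- The `s`-th derivative in the spectral parameter, `(d ^ s / dμ ^ s) exp ξ(x, μ)`, computed
coefficient by coefficient. -/
def expXiDeriv (s : ℕ) (μ : ℂ) : TimeSeries :=
  fun α => iteratedDeriv s (fun ν : ℂ => MvPowerSeries.coeff α (expXi ν)) μ

/-- The polynomials `p_l(x)` with `exp ξ(x, μ) = ∑_{l ≥ 0} p_l(x) μ ^ l`, and `p_l = 0` for
`l < 0`. -/
def pPoly (l : ℤ) : TimeSeries :=
  fun α => if (wt α : ℤ) = l then α.prod (fun _ a => (1 : ℂ) / (Nat.factorial a : ℂ)) else 0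

/-- The coefficient of `x ^ α` in `exp ξ(x, μ) = ∑ p_l(x) μ ^ l` (the term `l = wt α` is the only one
that contributes). -/
theorem coeff_expXi (μ : ℂ) (α : ℕ+ →₀ ℕ) :
    MvPowerSeries.coeff α (expXi μ) =
      ∑ l ∈ Finset.range (wt α + 1), MvPowerSeries.coeff α (pPoly l) * μ ^ l := by
  have h : ∀ l : ℕ, MvPowerSeries.coeff α (pPoly l) =
      if wt α = l then α.prod (fun _ a => (1 : ℂ) / (Nat.factorial a : ℂ)) else 0 := by
    intro l
    change (if (wt α : ℤ) = (l : ℤ) then _ else _) = _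
    simp
  simp only [h, ite_mul, zero_mul, Finset.sum_ite_eq, Finset.mem_range, Nat.lt_succ_self, if_true]
  change α.prod (fun j a => (μ ^ (j : ℕ)) ^ a / (Nat.factorial a : ℂ)) = _
  have hw : μ ^ wt α = α.prod (fun j a => (μ ^ (j : ℕ)) ^ a) := by
    simp only [wt, Finsupp.weight_apply, Finsupp.sum, Finsupp.prod, smul_eq_mul,
      ← Finset.prod_pow_eq_pow_sum]
    exact Finset.prod_congr rfl fun j _ => by rw [← pow_mul, mul_comm]
  rw [hw, ← Finsupp.prod_mul]
  exact Finsupp.prod_congr fun j _ => by ring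

/-- The Wronskian `det (∂^{i-1} f_j / ∂x₁^{i-1})` of `k` functions. -/
def wronskian {k : ℕ} (F : Fin k → TimeSeries) : TimeSeries :=
  Matrix.det (Matrix.of fun i j : Fin k => (MvPowerSeries.pderiv ℂ (1 : ℕ+))^[(i : ℕ)] (F j))

/-! ## Partitions, Plücker coordinates and the tau function -/

/-- Partitions `μ₁ ≥ μ₂ ≥ …` with finitely many nonzero parts (`μ i` is the part `μ_{i+1}`). -/
abbrev Part : Type := {μ : ℕ →₀ ℕ // Antitone μ}

/-- The number of nonzero parts. -/
def Part.length (μ : Part) : ℕ := μ.1.support.card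

/-- The Maya diagram of charge `0` of a partition: `m_{i+1} = μ_{i+1} - (i + 1)`. -/
def Part.maya (μ : Part) (i : ℕ) : ℤ := (μ.1 i : ℤ) - ((i : ℤ) + 1)

/-- The Schur function `s_μ(x) = det (p_{μ_i - i + j}(x))`. -/
def schur (μ : Part) : TimeSeries :=
  Matrix.det (Matrix.of fun i j : Fin μ.length => pPoly ((μ.1 i : ℤ) - (i : ℤ) + (j : ℤ)))

/-- The Plücker coordinate `det (X_{m_i, j})_{i, j ≥ 1}`: the value at which the finite minors
`det (X_{m_i, j})_{1 ≤ i, j ≤ L}` of a frame become constant as `L` grows. -/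
def plucker (X : ℕ → V) (μ : Part) : ℂ :=
  Filter.limUnder Filter.atTop fun L : ℕ =>
    Matrix.det (Matrix.of fun i j : Fin L => entry X (μ.maya i) j)

/-- The tau function `τ(x; X) = ∑_μ X_μ s_μ(x)`. Since `s_μ` is homogeneous of weight `|μ|`, only
finitely many partitions contribute to each coefficient. -/
def tau (X : ℕ → V) : TimeSeries :=
  fun α => ∑ᶠ μ : Part, plucker X μ * MvPowerSeries.coeff α (schur μ)

/-! ## Generalized solitons -/

/-- The parameters of an `(n, k)` generalized soliton: `n > k > 0`; non-negative integers
`r₀, …, r_N` of sum `n`; nonzero complex numbers `λ_{s,i}`, `0 ≤ s ≤ N`, `1 ≤ i ≤ r_s`, that are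
distinct for each fixed `s`; and an `n × k` matrix of rank `k`, whose rows are labelled by the
pairs `(s, i)`. -/
structure IsGSParam (n k : ℕ) {N : ℕ} (r : Fin (N + 1) → ℕ) (lam : (s : Fin (N + 1)) → Fin (r s) → ℂ)
    (A : Matrix ((s : Fin (N + 1)) × Fin (r s)) (Fin k) ℂ) : Prop where
  k_pos : 0 < k
  k_lt : k < n
  sum_r : ∑ s, r s = n
  lam_ne : ∀ s i, lam s i ≠ 0
  lam_inj : ∀ s, Function.Injective (lam s)
  rank_eq : A.rank = k

/-- `f_j = ∑_s ∑_i a_{(s,i),j} (d^s/dλ^s) e^{ξ(x,λ)} |_{λ = λ_{s,i}}`. -/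
def gsFun {k N : ℕ} (r : Fin (N + 1) → ℕ) (lam : (s : Fin (N + 1)) → Fin (r s) → ℂ)
    (A : Matrix ((s : Fin (N + 1)) × Fin (r s)) (Fin k) ℂ) (j : Fin k) : TimeSeries :=
  ∑ s, ∑ i, MvPowerSeries.C (A ⟨s, i⟩ j) * expXiDeriv (s : ℕ) (lam s i)

/-- The function `Wr(f₁, …, f_k)`; it is an `(n, k)` generalized soliton when `IsGSParam` holds. -/
def gsTau {k N : ℕ} (r : Fin (N + 1) → ℕ) (lam : (s : Fin (N + 1)) → Fin (r s) → ℂ)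
    (A : Matrix ((s : Fin (N + 1)) × Fin (r s)) (Fin k) ℂ) : TimeSeries :=
  wronskian (gsFun r lam A)

/-! ## The curves `y³ = x ∏_{i=1}^{3m} (x - ρ_i³)` and their affine rings

The `3m` parameters are labelled by pairs `(k, j)`, which stand for the index `j + k m`. -/

/-- The polynomial `y³ - x ∏ (x - ρ_i³)`; `x` and `y` are the variables `0` and `1`. -/
def curvePoly {m : ℕ} (ρ : Fin 3 × Fin m → ℂ) : MvPolynomial (Fin 2) ℂ :=
  MvPolynomial.X 1 ^ 3 -
    MvPolynomial.X 0 * ∏ i, (MvPolynomial.X 0 - MvPolynomial.C (ρ i ^ 3))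

/-- The ideal generated by the equation of the curve. -/
def curveIdeal {m : ℕ} (ρ : Fin 3 × Fin m → ℂ) : Ideal (MvPolynomial (Fin 2) ℂ) :=
  Ideal.span {curvePoly ρ}

/-- The affine ring `ℂ[x, y] / (y³ - x ∏ (x - ρ_i³))`. -/
abbrev AffineRing {m : ℕ} (ρ : Fin 3 × Fin m → ℂ) : Type :=
  MvPolynomial (Fin 2) ℂ ⧸ curveIdeal ρ

/-- The degenerate parameters, `ρ_j = ρ_{j+m} = ρ_{j+2m} = λ_j`. -/
def degenerate {m : ℕ} (lam : Fin m → ℂ) : Fin 3 × Fin m → ℂ := fun i => lam i.2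

/-- At the degenerate parameters the curve is `y³ = x ∏_{j=1}^m (x - λ_j³)³`. -/
theorem curvePoly_degenerate {m : ℕ} (lam : Fin m → ℂ) :
    curvePoly (degenerate lam) = MvPolynomial.X 1 ^ 3 -
      MvPolynomial.X 0 * ∏ j, (MvPolynomial.X 0 - MvPolynomial.C (lam j ^ 3)) ^ 3 := by
  simp only [curvePoly, degenerate, Fintype.prod_prod_type_right, Finset.prod_const,
    Finset.card_univ, Fintype.card_fin]

/-- The expansion `F(a + x, b + y)` of a polynomial at the point `(a, b)`. -/
def translate (F : MvPolynomial (Fin 2) ℂ) (a b : ℂ) : MvPolynomial (Fin 2) ℂ :=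
  MvPolynomial.aeval
    ![MvPolynomial.X 0 + MvPolynomial.C a, MvPolynomial.X 1 + MvPolynomial.C b] F

/-- `(a, b)` is a singular point of the affine plane curve `F = 0`. -/
def IsSingularPoint (F : MvPolynomial (Fin 2) ℂ) (a b : ℂ) : Prop :=
  ∀ d < 2, MvPolynomial.homogeneousComponent d (translate F a b) = 0

/-- `(a, b)` is an ordinary triple point of `F = 0`: its multiplicity is `3` and the tangent cone
consists of three distinct lines. -/
def IsOrdinaryTriplePoint (F : MvPolynomial (Fin 2) ℂ) (a b : ℂ) : Prop :=
  (∀ d < 3, MvPolynomial.homogeneousComponent d (translate F a b) = 0) ∧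
  ∃ p q : Fin 3 → ℂ, (∀ s t, s ≠ t → p s * q t ≠ p t * q s) ∧
    MvPolynomial.homogeneousComponent 3 (translate F a b) =
      ∏ t, (MvPolynomial.C (p t) * MvPolynomial.X 0 + MvPolynomial.C (q t) * MvPolynomial.X 1)

/-- The power series `(1 - c z³) ^ (1/3) = ∑_n binom(1/3, n) (-c z³) ^ n`. -/
def cbrtFactor (c : ℂ) : PowerSeries ℂ :=
  PowerSeries.expand 3 (by norm_num)
    (PowerSeries.rescale (-c) (PowerSeries.binomialSeries ℂ (1 / 3 : ℚ)))

theorem cbrtFactor_pow (c : ℂ) :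
    cbrtFactor c ^ 3 = 1 - PowerSeries.C c * PowerSeries.X ^ 3 := by
  have h : PowerSeries.binomialSeries ℂ (1 / 3 : ℚ) ^ 3 = 1 + PowerSeries.X := by
    have h1 := PowerSeries.binomialSeries_nat (R := ℚ) (A := ℂ) 1
    rw [pow_one] at h1
    rw [← h1, pow_three, ← PowerSeries.binomialSeries_add, ← PowerSeries.binomialSeries_add]
    congr 1
    norm_num
  rw [cbrtFactor, ← map_pow, ← map_pow, h]
  have h2 : PowerSeries.rescale (-c) (1 + PowerSeries.X : PowerSeries ℂ) =
      1 - PowerSeries.C c * PowerSeries.X := by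
    ext n
    rw [PowerSeries.coeff_rescale]
    rcases n with _ | _ | n <;>
      simp [PowerSeries.coeff_X, PowerSeries.coeff_one]
  rw [h2, map_sub, map_mul, map_one, PowerSeries.expand_C, PowerSeries.expand_X]

/-- `f̂(z) = ∏ (1 - ρ_i³ z³) ^ (1/3)`, expanded at `z = 0`. -/
def fHat {m : ℕ} (ρ : Fin 3 × Fin m → ℂ) : V :=
  HahnSeries.ofPowerSeries ℤ ℂ (∏ i, cbrtFactor (ρ i ^ 3))

/-- Expansion at infinity of polynomials in `x, y`: `x = z⁻³`, `y = z^{-3m-1} f̂(z)`. -/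
def expandPoly {m : ℕ} (ρ : Fin 3 × Fin m → ℂ) : MvPolynomial (Fin 2) ℂ →+* V :=
  MvPolynomial.eval₂Hom HahnSeries.C ![zPow (-3), zPow (-(3 * (m : ℤ)) - 1) * fHat ρ]

theorem expandPoly_curvePoly {m : ℕ} (ρ : Fin 3 × Fin m → ℂ) :
    expandPoly ρ (curvePoly ρ) = 0 := by
  have hz : ∀ a b : ℤ, zPow a * zPow b = zPow (a + b) := fun a b => by
    simp [zPow, HahnSeries.single_mul_single]
  have hzp : ∀ (a : ℤ) (n : ℕ), zPow a ^ n = zPow (n * a) := fun a n => by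
    simp [zPow, HahnSeries.single_pow]
  have hf : fHat ρ ^ 3 = ∏ i, (1 - HahnSeries.C (ρ i ^ 3) * zPow 3) := by
    rw [fHat, ← map_pow, ← Finset.prod_pow, map_prod]
    refine Finset.prod_congr rfl fun i _ => ?_
    rw [cbrtFactor_pow, map_sub, map_mul, map_one, HahnSeries.ofPowerSeries_C,
      HahnSeries.ofPowerSeries_X_pow]
    rfl
  have hfac : ∀ i, zPow (-3) - HahnSeries.C (ρ i ^ 3) =
      zPow (-3) * (1 - HahnSeries.C (ρ i ^ 3) * zPow 3) := fun i => by
    have h0 : zPow (-3) * zPow 3 = 1 := by rw [hz]; rfl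
    linear_combination (HahnSeries.C (ρ i ^ 3)) * h0
  have hprod : ∏ i, (zPow (-3) - HahnSeries.C (ρ i ^ 3)) =
      zPow (-(9 * (m : ℤ))) * fHat ρ ^ 3 := by
    rw [Finset.prod_congr rfl fun i _ => hfac i, Finset.prod_mul_distrib, Finset.prod_const, hf, hzp]
    congr 2
    simp only [Finset.card_univ, Fintype.card_prod, Fintype.card_fin]
    push_cast
    ring
  have hX0 : expandPoly ρ (MvPolynomial.X 0) = zPow (-3) := by simp [expandPoly]
  have hX1 : expandPoly ρ (MvPolynomial.X 1) = zPow (-(3 * (m : ℤ)) - 1) * fHat ρ := by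
    simp [expandPoly]
  have hC : ∀ c, expandPoly ρ (MvPolynomial.C c) = HahnSeries.C c := fun c =>
    MvPolynomial.eval₂Hom_C _ _ c
  rw [curvePoly, map_sub, map_mul, map_pow, map_prod, hX0, hX1]
  simp only [map_sub, hX0, hC]
  rw [hprod, mul_pow, hzp, ← mul_assoc, hz, sub_eq_zero]
  congr 2
  push_cast
  ring

/-- The Laurent expansion at infinity, `F ↦ F(z)`, on the affine ring. -/
def expansion {m : ℕ} (ρ : Fin 3 × Fin m → ℂ) : AffineRing ρ →+* V :=
  Ideal.Quotient.lift (curveIdeal ρ) (expandPoly ρ) (by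
    intro a ha
    have hle : curveIdeal ρ ≤ RingHom.ker (expandPoly ρ) := by
      rw [curveIdeal, Ideal.span_le, Set.singleton_subset_iff]
      exact expandPoly_curvePoly ρ
    exact hle ha)

/-- The linear map `ι(F) = z^g F(z)`, `g = 3m`. -/
def iota {m : ℕ} (ρ : Fin 3 × Fin m → ℂ) : AffineRing ρ →ₗ[ℂ] V where
  toFun F := zPow (3 * (m : ℤ)) * expansion ρ F
  map_add' a b := by rw [map_add, mul_add]
  map_smul' c a := by
    have h : expansion ρ (algebraMap ℂ (AffineRing ρ) c) = HahnSeries.C c :=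
      MvPolynomial.eval₂Hom_C _ _ c
    have h' : c • a = algebraMap ℂ (AffineRing ρ) c * a := Algebra.smul_def c a
    rw [RingHom.id_apply, h', map_mul, h, ← HahnSeries.C_mul_eq_smul]
    ring

/-- The subspace `ι(U_a)` of `V`. -/
def iotaRange {m : ℕ} (ρ : Fin 3 × Fin m → ℂ) : Submodule ℂ V := LinearMap.range (iota ρ)

/-- The basis of `ι(U_a)` given by the expansions of `x^i`, `x^i y`, `x^i y²`:
`z^{3m-3i}`, `z^{-1-3i} f̂`, `z^{-3m-2-3i} f̂²` (`i ≥ 0`), arranged as the columns of a frame. -/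
def curveFrame {m : ℕ} (ρ : Fin 3 × Fin m → ℂ) (c : ℕ) : V :=
  if c < 2 * m then zPow (3 * (m : ℤ) - 3 * (c : ℤ))
  else if c < 3 * m then zPow (-1 - 3 * ((c : ℤ) - 2 * (m : ℤ))) * fHat ρ
  else zPow (-(c : ℤ)) * fHat ρ ^ (c % 3)

/-! ## The explicit frame of the degenerate curve -/

/-- `ω = e^{2πi/3}`. -/
def omega : ℂ := Complex.exp (2 * Real.pi * Complex.I / 3)

/-- `f(z) = ∏_{j=1}^m (1 - λ_j³ z³)`. -/
def fSing {m : ℕ} (lam : Fin m → ℂ) : V := ∏ j, (1 - const (lam j ^ 3) * zPow 3)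

/-- The `3m` numbers `λ_{j + k m} = ω^k λ_j`. -/
def lamExt {m : ℕ} (lam : Fin m → ℂ) (i : Fin 3 × Fin m) : ℂ := omega ^ (i.1 : ℕ) * lam i.2

/-- `∏_{l ≠ i} (λ_i³ - λ_l³)`. -/
def diffProd {m : ℕ} (lam : Fin m → ℂ) (i : Fin m) : ℂ :=
  ∏ l ∈ Finset.univ.erase i, (lam i ^ 3 - lam l ^ 3)

/-- `a^{(r)}_{ij}`; the index `j : Fin m` stands for `j + 1`. -/
def aCoeff {m : ℕ} (lam : Fin m → ℂ) (r : Fin 3) (i : Fin 3 × Fin m) (j : Fin m) : ℂ :=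
  if r = 0 then
    omega ^ (i.1 : ℕ) *
      (-(2 * (m : ℂ) - ((j : ℂ) + 1) +
          2 * ∑ l ∈ Finset.univ.erase i.2, lam l ^ 3 / (lam i.2 ^ 3 - lam l ^ 3)) *
        (lam i.2 ^ (3 * ((j : ℤ) + 1) - 8) / (3 * diffProd lam i.2 ^ 2)))
  else
    omega ^ (-((r : ℤ) * (i.1 : ℤ))) *
      (lam i.2 ^ (3 * ((j : ℤ) + 1) - 3 - (r : ℤ)) / (3 * diffProd lam i.2))

/-- `b^{(r)}_{ij}`, which is `0` for `r = 1, 2`. -/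
def bCoeff {m : ℕ} (lam : Fin m → ℂ) (r : Fin 3) (i : Fin 3 × Fin m) (j : Fin m) : ℂ :=
  if r = 0 then
    omega ^ (i.1 : ℕ) * (lam i.2 ^ (3 * ((j : ℤ) + 1) - 8) / (9 * diffProd lam i.2 ^ 2))
  else 0

/-- `z^{-3m+1} ∑_i (a^{(r)}_{ij} / (1 - λ_i z) + b^{(r)}_{ij} / (1 - λ_i z)²)`. -/
def solFun {m : ℕ} (lam : Fin m → ℂ) (r : Fin 3) (j : Fin m) : V :=
  zPow (-(3 * (m : ℤ)) + 1) * ∑ i,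
    (const (aCoeff lam r i j) * (1 - const (lamExt lam i) * zPow 1)⁻¹ +
      const (bCoeff lam r i j) * ((1 - const (lamExt lam i) * zPow 1) ^ 2)⁻¹)

/-- The explicit frame. The `3m` functions `solFun lam r j`, in the order `r = 0, 1, 2` and then
`j = 1, …, m`, are the columns with labels `3m, …, 1` (columns are labelled from right to left), and
`z^{-j}`, `j ≥ 3m`, are the columns with labels `3m + 1, 3m + 2, …`. -/
def solFrame {m : ℕ} (lam : Fin m → ℂ) (c : ℕ) : V :=
  if h : c < 3 * m then
    let t : Fin 3 × Fin m := finProdFinEquiv.symm (Fin.rev ⟨c, h⟩)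
    solFun lam t.1 t.2
  else zPow (-(c : ℤ))

/-- The block sizes `N = 1`, `r₀ = r₁ = 3m`. -/
def solR (m : ℕ) : Fin (1 + 1) → ℕ := fun _ => 3 * m

/-- The parameters `λ_{0,i} = λ_{1,i} = λ_i`. -/
def solLam {m : ℕ} (lam : Fin m → ℂ) (s : Fin (1 + 1)) (i : Fin (solR m s)) : ℂ :=
  lamExt lam (finProdFinEquiv.symm (show Fin (3 * m) from i))

/-- The `6m × 3m` matrix with the blocks `(a^{(r)}_{ij} + b^{(r)}_{ij})` and
`(λ_i b^{(r)}_{ij})`, `r = 0, 1, 2`. -/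
def solMat {m : ℕ} (lam : Fin m → ℂ) :
    Matrix ((s : Fin (1 + 1)) × Fin (solR m s)) (Fin (3 * m)) ℂ :=
  fun p c =>
    let i : Fin 3 × Fin m := finProdFinEquiv.symm (show Fin (3 * m) from p.2)
    let t : Fin 3 × Fin m := finProdFinEquiv.symm c
    if p.1 = 0 then aCoeff lam t.1 i t.2 + bCoeff lam t.1 i t.2
    else lamExt lam i * bCoeff lam t.1 i t.2

/-- The numbers `g_n = -2 ∑_{i=1}^{3m} λ_i^n`, for which `log f(z)² = ∑_{n ≥ 1} g_n z^n / n`. -/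
def gaugeCoeff {m : ℕ} (lam : Fin m → ℂ) (n : ℕ+) : ℂ := -2 * ∑ i, lamExt lam i ^ (n : ℕ)

/-- The power series `∑_{n ≥ 1} g_n z^n / n`. -/
def gaugeLog {m : ℕ} (lam : Fin m → ℂ) : PowerSeries ℂ :=
  PowerSeries.mk fun n => if h : 0 < n then gaugeCoeff lam ⟨n, h⟩ / (n : ℂ) else 0

end TrigonalKP

end

open TrigonalKP

/-! Everything rests on replacing the sum over partitions by a finite determinant. For F = ∑ F_e z^e
put `dress F j` = ∑ F_e p_{e+j}(x). By Cauchy–Binet, det(`dress (X j) i`) over the first K columns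
is a sum over K-row minors, and each term is a Plücker coordinate times a Schur function; hence it
agrees with τ(x;X) in weights at most K once the frame is normalized from column K on
(`coeff_tau_eq_coeff_dressDet`). If the columns from K on are the monomials z^{-j}, the determinant
is exactly τ (`tau_eq_dressDet`).

Gauge factor: multiplication of a column by 1 - μz is the row operation "row i minus μ times row
i+1" on this determinant. Therefore division of a frame by 1 - μz multiplies τ by e^{ξ(x,μ)}
(`tau_geom_mul`). Since f = ∏(1 - λ_i z) over all 3m numbers, division by f² multiplies τ by ∏
e^{2ξ(x,λ_i)}, the inverse of e^{∑ g_n x_n}.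

Explicit frame: on the singular curve f̂ = f. Summing over the triples λ, ωλ, ω²λ turns the given
functions into sums of fractions in z³, and partial fractions identify them with z^{3m-3j}/f²,
z^{-1-3j}/f, z^{-3j}/f (j from 0). With Q = ∏(x - λ_l³), multiplication by f² gives the images under
ι of x^j, x^j y, x^j Q, while z^{-c} with c ≥ 3m gives x^i Q², x^i Q y, x^i y². So the span lies in
f^{-2}ι(U_a). Both spaces are points of UGM, and a point of UGM contains no other one
(`MemUGM.eq_of_le`), so they are equal.

Soliton: `dress` sends 1/(1 - μz) to e^ξ and 1/(1 - μz)² to e^ξ + μ ∂_μ e^ξ, up to the shift by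
z^{-3m+1}, which explains the blocks a + b and λb of the matrix. Since ∂_1 p_l = p_{l-1}, the finite
determinant is a Wronskian.

Degeneration: the normalization of the curve frames starts at column 3m for every ρ, so a
coefficient of τ is one fixed finite sum of minors whose entries are continuous in ρ. The singular
points are read off from Taylor expansions, since the equation has separated variables. -/

noncomputable section

namespace TrigonalKP

/-! ### Determinants with a trivial last row or column; Cauchy–Binet -/

section Determinants

variable {R : Type*} [CommRing R]

theorem det_of_last_row_eq {n : ℕ} (M : Matrix (Fin (n + 1)) (Fin (n + 1)) R)
    (h : ∀ j : Fin n, M (Fin.last n) j.castSucc = 0) :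
    M.det = M (Fin.last n) (Fin.last n) * (M.submatrix Fin.castSucc Fin.castSucc).det := by
  rw [Matrix.det_succ_row M (Fin.last n), Fin.sum_univ_castSucc]
  simp only [h, mul_zero, zero_mul, Finset.sum_const_zero, zero_add, Fin.succAbove_last,
    Fin.val_last]
  rw [← two_mul, pow_mul]
  simp

theorem det_of_last_col_eq {n : ℕ} (M : Matrix (Fin (n + 1)) (Fin (n + 1)) R)
    (h : ∀ i : Fin n, M i.castSucc (Fin.last n) = 0) :
    M.det = M (Fin.last n) (Fin.last n) * (M.submatrix Fin.castSucc Fin.castSucc).det := by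
  rw [← Matrix.det_transpose, det_of_last_row_eq _ h, ← Matrix.det_transpose]
  rfl

theorem det_mul_eq_sum_fun {K T : ℕ} (A : Matrix (Fin K) (Fin T) R) (B : Matrix (Fin T) (Fin K) R) :
    (A * B).det = ∑ p : Fin K → Fin T, (A.submatrix id p).det * ∏ i, B (p i) i := by
  simp only [Matrix.det_apply', Matrix.mul_apply, Matrix.submatrix_apply, id]
  have : ∀ σ : Equiv.Perm (Fin K), ∏ i, ∑ r, A (σ i) r * B r i =
      ∑ p : Fin K → Fin T, ∏ i, (A (σ i) (p i) * B (p i) i) := fun σ => by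
    rw [Finset.prod_univ_sum]
    simp
  simp only [this, Finset.mul_sum, Finset.sum_mul]
  rw [Finset.sum_comm]
  refine Finset.sum_congr rfl fun p _ => Finset.sum_congr rfl fun σ _ => ?_
  rw [Finset.prod_mul_distrib, mul_assoc]

theorem orderEmbedding_comp_perm_injective {K T : ℕ} :
    Function.Injective fun q : (Fin K ↪o Fin T) × Equiv.Perm (Fin K) => (q.1 ∘ q.2 : Fin K → Fin T) := by
  rintro ⟨f, σ⟩ ⟨g, τ⟩ h
  simp only at h
  have hr : Set.range f = Set.range g := by
    rw [← σ.surjective.range_comp f, ← τ.surjective.range_comp g, h]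
  have hfg : f = g := OrderEmbedding.range_inj.1 hr
  subst hfg
  refine Prod.ext rfl (Equiv.ext fun i => f.injective (congrFun h i))

/-- The Cauchy–Binet formula. -/
theorem det_mul_eq_sum_orderEmbedding {K T : ℕ} (A : Matrix (Fin K) (Fin T) R)
    (B : Matrix (Fin T) (Fin K) R) :
    (A * B).det = ∑ f : Fin K ↪o Fin T, (A.submatrix id f).det * (B.submatrix f id).det := by
  classical
  rw [det_mul_eq_sum_fun]
  -- A map that is not injective repeats a column of A and contributes 0. An injective one factors
  -- by sorting as an order embedding after a permutation, in only one way, so the sum regroups over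
  -- pairs.
  have h1 : ∀ p : Fin K → Fin T, p ∉ Set.range (fun q : (Fin K ↪o Fin T) × Equiv.Perm (Fin K) =>
      (q.1 ∘ q.2 : Fin K → Fin T)) → (A.submatrix id p).det * ∏ i, B (p i) i = 0 := by
    intro p hp
    have hni : ¬ Function.Injective p := by
      intro hinj
      apply hp
      have hm : StrictMono (p ∘ Tuple.sort p) :=
        (Tuple.monotone_sort p).strictMono_of_injective (hinj.comp (Equiv.injective _))
      refine ⟨(OrderEmbedding.ofStrictMono _ hm, (Tuple.sort p)⁻¹), ?_⟩
      funext i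
      simp
    simp only [Function.Injective, not_forall] at hni
    obtain ⟨a, b, hab, hne⟩ := hni
    rw [Matrix.det_zero_of_column_eq hne (fun i => by simp [hab]), zero_mul]
  rw [← Finset.sum_subset (Finset.subset_univ (Finset.univ.image
    fun q : (Fin K ↪o Fin T) × Equiv.Perm (Fin K) => (q.1 ∘ q.2 : Fin K → Fin T)))
    (fun p _ hp => h1 p (by simpa using hp)),
    Finset.sum_image (orderEmbedding_comp_perm_injective.injOn), Fintype.sum_prod_type]
  refine Finset.sum_congr rfl fun f _ => ?_
  rw [Matrix.det_apply' (B.submatrix f id), Finset.mul_sum]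
  refine Finset.sum_congr rfl fun σ _ => ?_
  have : (A.submatrix id (f ∘ σ)).det = (Equiv.Perm.sign σ : ℤ) * (A.submatrix id f).det := by
    rw [← Matrix.det_permute' σ, Matrix.submatrix_submatrix]
    rfl
  rw [this]
  simp
  ring

end Determinants

/-! ## Weights and dressed Laurent series -/

theorem wt_add (α β : ℕ+ →₀ ℕ) : wt (α + β) = wt α + wt β := by simp [wt]

@[simp] theorem wt_single (j : ℕ+) (a : ℕ) : wt (Finsupp.single j a) = a * j := by
  simp [wt, Finsupp.weight_single]

/-- The coefficient `∏ 1 / α_j !` of `x ^ α` in `p_{wt α}`. -/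
def invFactorial (α : ℕ+ →₀ ℕ) : ℂ := α.prod fun _ a => (1 : ℂ) / (Nat.factorial a : ℂ)

/-- The series `∑_e F_e p_{e + j}(x)` attached to `F = ∑ F_e z^e`. -/
def dress (F : V) (j : ℤ) : TimeSeries := fun α => F.coeff ((wt α : ℤ) - j) * invFactorial α

theorem coeff_dress (F : V) (j : ℤ) (α : ℕ+ →₀ ℕ) :
    MvPowerSeries.coeff α (dress F j) = F.coeff ((wt α : ℤ) - j) * invFactorial α := rfl

theorem coeff_pPoly (l : ℤ) (α : ℕ+ →₀ ℕ) :
    MvPowerSeries.coeff α (pPoly l) = if (wt α : ℤ) = l then invFactorial α else 0 := rfl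

theorem coeff_zPow (n k : ℤ) : (zPow n).coeff k = if k = n then 1 else 0 := by
  simp [zPow, HahnSeries.coeff_single]

theorem dress_zPow (e j : ℤ) : dress (zPow e) j = pPoly (e + j) := by
  ext α
  rw [coeff_dress, coeff_pPoly, coeff_zPow, ite_mul, one_mul, zero_mul]
  exact if_congr (by omega) rfl rfl

theorem wt_eq_zero_iff (α : ℕ+ →₀ ℕ) : wt α = 0 ↔ α = 0 := by
  constructor
  · intro h
    ext j
    simp only [wt, Finsupp.weight_apply, Finsupp.sum, smul_eq_mul, Finset.sum_eq_zero_iff] at h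
    by_contra hj
    have := h j (by simpa using hj)
    simp at this
    exact hj this
  · rintro rfl
    simp [wt]

theorem pPoly_zero : pPoly 0 = 1 := by
  classical
  ext α
  rw [coeff_pPoly, MvPowerSeries.coeff_one]
  by_cases h : α = 0
  · simp [h, wt, invFactorial]
  · have : wt α ≠ 0 := fun h' => h ((wt_eq_zero_iff α).1 h')
    simp [h, this]

theorem pPoly_of_neg {l : ℤ} (hl : l < 0) : pPoly l = 0 := by
  ext α
  rw [coeff_pPoly, if_neg (by omega), map_zero]

/-- The ideal of series without terms of weight at most `N`. -/
def highWeight (N : ℕ) : Ideal TimeSeries where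
  carrier := {F | ∀ β, wt β ≤ N → MvPowerSeries.coeff β F = 0}
  add_mem' := by
    intro a b ha hb β hβ
    rw [map_add, ha β hβ, hb β hβ, add_zero]
  zero_mem' := by
    intro β _
    rw [map_zero]
  smul_mem' := by
    classical
    intro c a ha β hβ
    rw [smul_eq_mul, MvPowerSeries.coeff_mul]
    refine Finset.sum_eq_zero fun p hp => ?_
    rw [Finset.HasAntidiagonal.mem_antidiagonal] at hp
    rw [ha p.2, mul_zero]
    have := wt_add p.1 p.2
    rw [hp] at this
    omega

/-- Determinants commute with passage to the quotient ring. Used with `highWeight`, it allows the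
entries to be truncated in weight before the determinant is taken. -/
theorem det_sub_det_mem {R : Type*} [CommRing R] (I : Ideal R) {K : ℕ}
    {A B : Matrix (Fin K) (Fin K) R} (h : ∀ i j, A i j - B i j ∈ I) : A.det - B.det ∈ I := by
  rw [← Ideal.Quotient.eq, RingHom.map_det, RingHom.map_det]
  congr 1
  ext i j
  exact Ideal.Quotient.eq.2 (h i j)

theorem coeff_eq_of_sub_mem_highWeight {N : ℕ} {F G : TimeSeries} (h : F - G ∈ highWeight N)
    {α : ℕ+ →₀ ℕ} (hα : wt α ≤ N) : MvPowerSeries.coeff α F = MvPowerSeries.coeff α G := by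
  have := h α hα
  rwa [map_sub, sub_eq_zero] at this

/-- `F` is homogeneous of weight `n`. -/
def IsHomog (F : TimeSeries) (n : ℤ) : Prop :=
  ∀ α, MvPowerSeries.coeff α F ≠ 0 → (wt α : ℤ) = n

theorem isHomog_pPoly (l : ℤ) : IsHomog (pPoly l) l := by
  intro α h
  rw [coeff_pPoly] at h
  by_contra h'
  exact h (if_neg h')

theorem IsHomog.mul {F G : TimeSeries} {a b : ℤ} (hF : IsHomog F a) (hG : IsHomog G b) :
    IsHomog (F * G) (a + b) := by
  classical
  intro α h
  rw [MvPowerSeries.coeff_mul] at h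
  obtain ⟨p, hp, hne⟩ := Finset.exists_ne_zero_of_sum_ne_zero h
  rw [Finset.HasAntidiagonal.mem_antidiagonal] at hp
  rw [← hp, wt_add, ← hF _ (left_ne_zero_of_mul hne), ← hG _ (right_ne_zero_of_mul hne)]
  push_cast
  rfl

theorem isHomog_one : IsHomog 1 0 := pPoly_zero ▸ isHomog_pPoly 0

theorem isHomog_prod {ι : Type*} (s : Finset ι) (F : ι → TimeSeries) (n : ι → ℤ)
    (h : ∀ i ∈ s, IsHomog (F i) (n i)) : IsHomog (∏ i ∈ s, F i) (∑ i ∈ s, n i) := by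
  classical
  induction s using Finset.induction_on with
  | empty => simpa using isHomog_one
  | insert a s ha ih =>
    rw [Finset.prod_insert ha, Finset.sum_insert ha]
    exact (h a (Finset.mem_insert_self _ _)).mul
      (ih fun i hi => h i (Finset.mem_insert_of_mem hi))

/-- In each term of the Leibniz expansion the shifts -σ(i) and +i cancel after summation over i. -/
theorem isHomog_det {K : ℕ} (M : Matrix (Fin K) (Fin K) TimeSeries) (a : Fin K → ℤ)
    (h : ∀ i j, IsHomog (M i j) (a i - (i : ℕ) + (j : ℕ))) : IsHomog M.det (∑ i, a i) := by
  intro α hα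
  rw [Matrix.det_apply', map_sum] at hα
  obtain ⟨σ, -, hσ⟩ := Finset.exists_ne_zero_of_sum_ne_zero hα
  have hne : MvPowerSeries.coeff α (∏ i, M (σ i) i) ≠ 0 := by
    intro h0
    apply hσ
    rw [← zsmul_eq_mul, map_zsmul, h0, smul_zero]
  rw [isHomog_prod _ _ _ (fun i _ => h (σ i) i) α hne]
  rw [Finset.sum_add_distrib, Finset.sum_sub_distrib, Equiv.sum_comp σ a,
    Equiv.sum_comp σ (fun i : Fin K => ((i : ℕ) : ℤ))]
  ring

/-! ## Partitions -/

namespace Part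

/-- The support of an antitone sequence is an initial segment, so its cardinality is the first index
with a zero part. -/
theorem lt_length_iff (μ : Part) (i : ℕ) : i < μ.length ↔ μ.1 i ≠ 0 := by
  have hex : ∃ n, μ.1 n = 0 := by
    obtain ⟨n, hn⟩ := Infinite.exists_notMem_finset μ.1.support
    exact ⟨n, by simpa using hn⟩
  classical
  have hs : μ.1.support = Finset.range (Nat.find hex) := by
    ext k
    rw [Finsupp.mem_support_iff, Finset.mem_range]
    constructor
    · intro hk
      by_contra hle
      exact hk (Nat.le_zero.1 ((μ.2 (not_lt.1 hle)).trans_eq (Nat.find_spec hex)))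
    · exact fun hk => Nat.find_min hex hk
  rw [length, hs, Finset.card_range, ← Finset.mem_range, ← hs, Finsupp.mem_support_iff]

theorem eq_zero_of_length_le (μ : Part) {i : ℕ} (h : μ.length ≤ i) : μ.1 i = 0 := by
  by_contra h'
  exact absurd ((μ.lt_length_iff i).2 h') (not_lt.2 h)

theorem length_le_iff (μ : Part) (K : ℕ) : μ.length ≤ K ↔ μ.1 K = 0 := by
  rw [← not_lt, lt_length_iff, not_not]

/-- The number of boxes of the Young diagram. -/
def size (μ : Part) : ℕ := ∑ i : Fin μ.length, μ.1 i

theorem length_le_size (μ : Part) : μ.length ≤ μ.size := by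
  have : ∑ _i : Fin μ.length, 1 ≤ μ.size := Finset.sum_le_sum fun i _ =>
    Nat.one_le_iff_ne_zero.2 ((μ.lt_length_iff i).1 i.2)
  simpa using this

theorem apply_le_size (μ : Part) (i : ℕ) : μ.1 i ≤ μ.size := by
  by_cases h : i < μ.length
  · exact Finset.single_le_sum (f := fun i : Fin μ.length => μ.1 i) (fun _ _ => Nat.zero_le _)
      (Finset.mem_univ ⟨i, h⟩)
  · rw [eq_zero_of_length_le μ (not_lt.1 h)]
    exact Nat.zero_le _

end Part

theorem isHomog_schur (μ : Part) : IsHomog (schur μ) μ.size := by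
  have := isHomog_det (Matrix.of fun i j : Fin μ.length =>
    pPoly ((μ.1 i : ℤ) - (i : ℤ) + (j : ℤ))) (fun i => (μ.1 i : ℤ)) fun i j => isHomog_pPoly _
  rw [Part.size, Nat.cast_sum]
  exact this

/-- The determinant of a Schur function may be taken of any size that is at least the number of
parts. -/
theorem schur_eq_det (μ : Part) {K : ℕ} (hK : μ.length ≤ K) :
    schur μ = Matrix.det (Matrix.of fun i j : Fin K => pPoly ((μ.1 i : ℤ) - (i : ℤ) + (j : ℤ))) := by
  induction K, hK using Nat.le_induction with
  | base => rfl
  | succ L hL ih =>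
    have h0 := μ.eq_zero_of_length_le hL
    rw [det_of_last_row_eq, ih]
    · simp only [Matrix.of_apply, Fin.val_last, h0]
      rw [show ((0 : ℕ) : ℤ) - (L : ℤ) + L = 0 by simp, pPoly_zero, one_mul]
      rfl
    · intro j
      simp only [Matrix.of_apply, Fin.val_last, h0, Fin.val_castSucc]
      exact pPoly_of_neg (by have := j.2; omega)

/-! ## Plücker coordinates -/

/-- The normalization of a frame from the column `l` on. -/
def FrameCondAt (X : ℕ → V) (l : ℕ) : Prop :=
  (∀ j : ℕ, l ≤ j → (X j).coeff (-(j : ℤ)) = 1) ∧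
  (∀ j : ℕ, l ≤ j → ∀ n : ℤ, n < -(j : ℤ) → (X j).coeff n = 0) ∧
  (∀ j : ℕ, j < l → ∀ n : ℤ, n ≤ -(l : ℤ) → (X j).coeff n = 0)

/-- Row i holds the exponent i + 1 and column j has the label j + 1. Hence "label > l" becomes l ≤
j, and i < -l becomes n ≤ -l. -/
theorem frameCond_iff (X : ℕ → V) : FrameCond X ↔ ∃ l, FrameCondAt X l := by
  unfold FrameCond FrameCondAt entry
  refine exists_congr fun l => and_congr ?_ (and_congr ?_ ?_)
  · refine forall_congr' fun j => imp_congr Nat.lt_succ_iff ?_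
    rw [show -((j : ℤ) + 1) + 1 = -(j : ℤ) by ring]
  · refine forall_congr' fun j => imp_congr Nat.lt_succ_iff ⟨fun h n hn => ?_, fun h n hn => ?_⟩
    · simpa using h (n - 1) (by omega)
    · exact h (n + 1) (by omega)
  · refine forall_congr' fun j => imp_congr Nat.succ_le_iff ⟨fun h n hn => ?_, fun h n hn => ?_⟩
    · simpa using h (n - 1) (by omega)
    · exact h (n + 1) (by omega)

theorem FrameCondAt.mono {X : ℕ → V} {l K : ℕ} (h : FrameCondAt X l) (hK : l ≤ K) :
    FrameCondAt X K := by
  refine ⟨fun j hj => h.1 j (hK.trans hj), fun j hj => h.2.1 j (hK.trans hj), fun j hj n hn => ?_⟩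
  by_cases hjl : j < l
  · exact h.2.2 j hjl n (by omega)
  · exact h.2.1 j (not_lt.1 hjl) n (by omega)

/-- Below the column `j` nothing to the left of it has a pole of order at least `j`. -/
theorem FrameCondAt.coeff_eq_zero {X : ℕ → V} {l i j : ℕ} (h : FrameCondAt X l) (hj : l ≤ j)
    (hij : i < j) {n : ℤ} (hn : n ≤ -(j : ℤ)) : (X i).coeff n = 0 :=
  (h.mono hj).2.2 i hij n hn

theorem entry_maya (X : ℕ → V) (μ : Part) (i j : ℕ) :
    entry X (μ.maya i) j = (X j).coeff ((μ.1 i : ℤ) - i) := by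
  unfold entry Part.maya
  congr 1
  ring

/-- Past the last part of μ, row L reads the exponent -L. Among the columns up to L only column L
has a nonzero coefficient there, and it is 1, so the determinant does not change. -/
theorem det_entry_eq {X : ℕ → V} {K L : ℕ} (h : FrameCondAt X K) (μ : Part) (hμ : μ.length ≤ K)
    (hL : K ≤ L) :
    Matrix.det (Matrix.of fun i j : Fin L => entry X (μ.maya i) j) =
      Matrix.det (Matrix.of fun i j : Fin K => entry X (μ.maya i) j) := by
  induction L, hL using Nat.le_induction with
  | base => rfl
  | succ L hL ih =>
    have h0 := μ.eq_zero_of_length_le (hμ.trans hL)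
    rw [det_of_last_row_eq]
    · rw [← ih]
      simp only [Matrix.of_apply, Fin.val_last, entry_maya, h0]
      rw [show ((0 : ℕ) : ℤ) - (L : ℤ) = -L by simp, h.1 L hL, one_mul]
      rfl
    · intro j
      simp only [Matrix.of_apply, Fin.val_last, Fin.val_castSucc, entry_maya, h0]
      exact h.coeff_eq_zero hL j.2 (by simp)

/-- Plücker coordinates are finite minors. -/
theorem plucker_eq_det {X : ℕ → V} {K : ℕ} (h : FrameCondAt X K) (μ : Part) (hμ : μ.length ≤ K) :
    plucker X μ = Matrix.det (Matrix.of fun i j : Fin K => entry X (μ.maya i) j) := by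
  refine Filter.Tendsto.limUnder_eq (tendsto_const_nhds.congr' ?_)
  filter_upwards [Filter.eventually_ge_atTop K] with L hL
  exact (det_entry_eq h μ hμ hL).symm

/-! ## Finite determinants that approximate the tau function -/

/-- The determinant `det (∑_e X_{e, j} p_{e + i})` over the first `K` columns. -/
def dressDet (K : ℕ) (X : ℕ → V) : TimeSeries :=
  Matrix.det (Matrix.of fun i j : Fin K => dress (X j) (i : ℕ))

/-- This makes f(a) - a monotone; read backwards, these differences are the parts of a partition. -/
theorem orderEmbedding_add_sub_le {K T : ℕ} (f : Fin K ↪o Fin T) {a b : Fin K} (h : a ≤ b) :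
    (f a : ℕ) + (b - a : ℕ) ≤ f b := by
  obtain ⟨a, ha⟩ := a
  obtain ⟨b, hb⟩ := b
  rw [Fin.mk_le_mk] at h
  induction b, h using Nat.le_induction with
  | base => simp
  | succ b hab ih =>
    have h1 := ih (by omega)
    have h2 : f ⟨b, by omega⟩ < f ⟨b + 1, hb⟩ := f.strictMono (by simp [Fin.lt_def])
    rw [Fin.lt_def] at h2
    simp only at h1 ⊢
    omega

theorem orderEmbedding_le_apply {K T : ℕ} (f : Fin K ↪o Fin T) (a : Fin K) : (a : ℕ) ≤ f a := by
  have h : 0 < K := a.pos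
  have := orderEmbedding_add_sub_le f (a := ⟨0, h⟩) (b := a) (by simp [Fin.le_def])
  simp only at this
  omega

/-- The partition whose Maya diagram is given by `K` increasing rows. -/
def partOfRows {K T : ℕ} (f : Fin K ↪o Fin T) : Part :=
  ⟨Finsupp.onFinset (Finset.range K)
    (fun i => if h : i < K then (f (Fin.rev ⟨i, h⟩) : ℕ) - (K - 1 - i) else 0)
    (fun i hi => by
      by_contra h
      exact hi (dif_neg (by simpa using h))), by
    intro a b hab
    simp only [Finsupp.onFinset_apply]
    split_ifs with hb ha
    · have h1 := orderEmbedding_add_sub_le f (a := Fin.rev ⟨b, hb⟩) (b := Fin.rev ⟨a, ha⟩)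
        (by simpa [Fin.rev_le_rev] using hab)
      simp only [Fin.val_rev] at h1
      have h2 := orderEmbedding_le_apply f (Fin.rev ⟨b, hb⟩)
      simp only [Fin.val_rev] at h2
      omega
    · omega
    · exact Nat.zero_le _
    · exact le_rfl⟩

theorem partOfRows_apply {K T : ℕ} (f : Fin K ↪o Fin T) (i : Fin K) :
    ((partOfRows f).1 i : ℤ) = (f (Fin.rev i) : ℤ) - (K - 1 - (i : ℕ)) := by
  have h2 := orderEmbedding_le_apply f (Fin.rev i)
  simp only [Fin.val_rev] at h2
  simp only [partOfRows, Finsupp.onFinset_apply, Fin.is_lt, dif_pos, Fin.eta]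
  have := i.2
  omega

theorem length_partOfRows_le {K T : ℕ} (f : Fin K ↪o Fin T) : (partOfRows f).length ≤ K := by
  rw [Part.length_le_iff]
  simp [partOfRows]

theorem partOfRows_injective {K T : ℕ} :
    Function.Injective (partOfRows : (Fin K ↪o Fin T) → Part) := by
  intro f g h
  ext i
  have h1 := partOfRows_apply f (Fin.rev i)
  have h2 := partOfRows_apply g (Fin.rev i)
  rw [h] at h1
  rw [Fin.rev_rev] at h1 h2
  omega

/-- The rows are f(i) = μ_{K-1-i} + i. Together with `partOfRows_injective` this matches the choices
of K rows out of T with the partitions in a K × (T - K) box. -/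
theorem exists_partOfRows_eq {K T : ℕ} (μ : Part) (h1 : μ.length ≤ K)
    (h2 : ∀ i, μ.1 i + K ≤ T) : ∃ f : Fin K ↪o Fin T, partOfRows f = μ := by
  have hlt : ∀ i : Fin K, μ.1 (K - 1 - i) + i < T := fun i => by
    have := h2 (K - 1 - i)
    have := i.2
    omega
  have hmono : StrictMono fun i : Fin K => (⟨μ.1 (K - 1 - i) + i, hlt i⟩ : Fin T) := by
    intro a b hab
    rw [Fin.lt_def] at hab ⊢
    have : μ.1 (K - 1 - a) ≤ μ.1 (K - 1 - b) := μ.2 (by omega)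
    simp only
    omega
  refine ⟨OrderEmbedding.ofStrictMono _ hmono, Subtype.ext (Finsupp.ext fun i => ?_)⟩
  by_cases hi : i < K
  · have := partOfRows_apply (OrderEmbedding.ofStrictMono _ hmono) ⟨i, hi⟩
    simp only [OrderEmbedding.coe_ofStrictMono, Fin.val_rev] at this
    rw [show K - 1 - (K - (i + 1)) = i by omega] at this
    omega
  · rw [Part.eq_zero_of_length_le _ ((length_partOfRows_le _).trans (not_lt.1 hi)),
      Part.eq_zero_of_length_le _ (h1.trans (not_lt.1 hi))]

/-- One term of the Cauchy–Binet sum. Maya diagrams list rows in decreasing order and f in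
increasing order; the reversal occurs in both determinants, so its sign squares to 1. -/
theorem plucker_mul_schur_partOfRows {X : ℕ → V} {K T : ℕ} (h : FrameCondAt X K)
    (f : Fin K ↪o Fin T) :
    MvPowerSeries.C (plucker X (partOfRows f)) * schur (partOfRows f) =
      (Matrix.of fun i r : Fin K => pPoly ((f r : ℤ) - K + 1 + (i : ℕ))).det *
      (Matrix.of fun r j : Fin K =>
        (MvPowerSeries.C ((X j).coeff ((f r : ℤ) - K + 1)) : TimeSeries)).det := by
  have hB : (Matrix.of fun r j : Fin K =>
        (MvPowerSeries.C ((X j).coeff ((f r : ℤ) - K + 1)) : TimeSeries)).submatrix Fin.revPerm id =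
      (MvPowerSeries.C : ℂ →+* TimeSeries).mapMatrix
        (Matrix.of fun i j : Fin K => entry X ((partOfRows f).maya i) j) := by
    ext1 i j
    simp only [Matrix.submatrix_apply, Matrix.of_apply, RingHom.mapMatrix_apply, Matrix.map_apply,
      entry_maya, partOfRows_apply, Fin.revPerm_apply, id]
    congr 2
    ring
  have hA : (Matrix.of fun i r : Fin K => pPoly ((f r : ℤ) - K + 1 + (i : ℕ))).submatrix
      id Fin.revPerm = (Matrix.of fun i j : Fin K =>
        pPoly (((partOfRows f).1 i : ℤ) - (i : ℤ) + (j : ℤ))).transpose := by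
    ext1 i j
    simp only [Matrix.submatrix_apply, Matrix.of_apply, Matrix.transpose_apply,
      partOfRows_apply, Fin.revPerm_apply, id]
    congr 1
    ring
  rw [schur_eq_det _ (length_partOfRows_le f), plucker_eq_det h _ (length_partOfRows_le f),
    RingHom.map_det, ← hB, ← Matrix.det_transpose (Matrix.of fun i j : Fin K =>
        pPoly (((partOfRows f).1 i : ℤ) - (i : ℤ) + (j : ℤ))), ← hA, Matrix.det_permute,
    Matrix.det_permute']
  have hs : ((Equiv.Perm.sign (Fin.revPerm : Equiv.Perm (Fin K)) : ℤ) : TimeSeries) *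
      ((Equiv.Perm.sign (Fin.revPerm : Equiv.Perm (Fin K)) : ℤ) : TimeSeries) = 1 := by
    rw [← Int.cast_mul, Int.units_coe_mul_self, Int.cast_one]
  rw [mul_mul_mul_comm, hs, one_mul, mul_comm]

/-- Only partitions of bounded length and width contribute to a coefficient of `τ`. -/
theorem coeff_schur_eq_zero {μ : Part} {α : ℕ+ →₀ ℕ} (h : wt α ≠ μ.size) :
    MvPowerSeries.coeff α (schur μ) = 0 := by
  by_contra h'
  have := isHomog_schur μ α h'
  omega

theorem coeff_tau (X : ℕ → V) (α : ℕ+ →₀ ℕ) : MvPowerSeries.coeff α (tau X) =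
    ∑ᶠ μ : Part, plucker X μ * MvPowerSeries.coeff α (schur μ) := rfl

/-- The coefficients of the tau function as finite sums. -/
theorem coeff_tau_eq_sum (X : ℕ → V) {K T : ℕ} {α : ℕ+ →₀ ℕ} (hK : wt α ≤ K)
    (hT : wt α + K ≤ T) : MvPowerSeries.coeff α (tau X) = ∑ f : Fin K ↪o Fin T,
      plucker X (partOfRows f) * MvPowerSeries.coeff α (schur (partOfRows f)) := by
  classical
  rw [coeff_tau, finsum_eq_sum_of_support_subset (s := Finset.univ.image partOfRows),
    Finset.sum_image partOfRows_injective.injOn]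
  intro μ hμ
  rw [Function.mem_support] at hμ
  have hsz : wt α = μ.size := by
    by_contra h
    exact hμ (by rw [coeff_schur_eq_zero h, mul_zero])
  obtain ⟨f, hf⟩ := exists_partOfRows_eq (K := K) (T := T) μ
    (μ.length_le_size.trans (hsz ▸ hK)) fun i => by
      have := μ.apply_le_size i
      omega
  simp only [Finset.coe_image, Finset.coe_univ, Set.image_univ, Set.mem_range]
  exact ⟨f, hf⟩

/-- The tau function agrees with the finite determinants in low weight. -/
theorem coeff_tau_eq_coeff_dressDet {X : ℕ → V} {K : ℕ} (h : FrameCondAt X K) {α : ℕ+ →₀ ℕ}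
    (hK : wt α ≤ K) :
    MvPowerSeries.coeff α (tau X) = MvPowerSeries.coeff α (dressDet K X) := by
  classical
  -- Row q stands for the exponent q - K + 1, so the window is -K + 1, …, wt α. A coefficient of
  -- weight w ≤ wt α in row i of the dressed matrix only involves the exponent w - i, which lies in
  -- this window.
  set T := wt α + K with hT
  set A : Matrix (Fin K) (Fin T) TimeSeries :=
    Matrix.of fun i q => pPoly ((q : ℤ) - K + 1 + (i : ℕ)) with hA
  set B : Matrix (Fin T) (Fin K) TimeSeries :=
    Matrix.of fun q j => MvPowerSeries.C ((X j).coeff ((q : ℤ) - K + 1)) with hB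
  have hmem : dressDet K X - (A * B).det ∈ highWeight (wt α) := by
    refine det_sub_det_mem _ fun i j => ?_
    intro β hβ
    rw [map_sub, sub_eq_zero, Matrix.mul_apply, map_sum]
    simp only [hA, hB, Matrix.of_apply, MvPowerSeries.coeff_mul_C, coeff_pPoly, coeff_dress]
    have hi := i.2
    rw [Finset.sum_eq_single (⟨wt β + K - 1 - i, by omega⟩ : Fin T)]
    · have e : ((wt β + K - 1 - i : ℕ) : ℤ) = wt β + K - 1 - (i : ℕ) := by omega
      simp only [e]
      rw [if_pos (by ring), mul_comm]
      congr 2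
      ring
    · intro q _ hq
      rw [if_neg, zero_mul]
      intro hq'
      apply hq
      ext
      simp only
      omega
    · simp
  rw [coeff_eq_of_sub_mem_highWeight hmem le_rfl, det_mul_eq_sum_orderEmbedding, map_sum,
    coeff_tau_eq_sum X hK le_rfl]
  refine Finset.sum_congr rfl fun f _ => ?_
  rw [← MvPowerSeries.coeff_C_mul, plucker_mul_schur_partOfRows h]
  rfl

/-! ## Laurent series -/

/-- The inclusion of power series into Laurent series. -/
abbrev ofPS : PowerSeries ℂ →+* V := HahnSeries.ofPowerSeries ℤ ℂ

theorem coeff_ofPS_natCast (φ : PowerSeries ℂ) (n : ℕ) :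
    (ofPS φ).coeff (n : ℤ) = PowerSeries.coeff n φ :=
  HahnSeries.ofPowerSeries_apply_coeff φ n

theorem coeff_ofPS_of_neg (φ : PowerSeries ℂ) {n : ℤ} (hn : n < 0) : (ofPS φ).coeff n = 0 := by
  rw [ofPS, HahnSeries.ofPowerSeries_apply]
  refine HahnSeries.embDomain_of_notMem_range ?_
  rintro ⟨k, hk⟩
  simp at hk
  omega

theorem coeff_zPow_mul (a : ℤ) (F : V) (n : ℤ) : (zPow a * F).coeff n = F.coeff (n - a) := by
  have := HahnSeries.coeff_single_mul_add (r := (1 : ℂ)) (x := F) (a := n - a) (b := a)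
  rw [sub_add_cancel, one_mul] at this
  exact this

theorem zPow_mul_zPow (a b : ℤ) : zPow a * zPow b = zPow (a + b) := by
  simp [zPow, HahnSeries.single_mul_single]

theorem zPow_pow (a : ℤ) (n : ℕ) : zPow a ^ n = zPow (n * a) := by
  simp [zPow, HahnSeries.single_pow]

theorem zPow_natCast (n : ℕ) : zPow n = ofPS (PowerSeries.X ^ n) := by
  rw [ofPS, HahnSeries.ofPowerSeries_X_pow]
  rfl

theorem const_eq_ofPS (c : ℂ) : const c = ofPS (PowerSeries.C c) :=
  (HahnSeries.ofPowerSeries_C c).symm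

theorem smul_eq_const_mul (c : ℂ) (F : V) : c • F = const c * F :=
  (HahnSeries.C_mul_eq_smul).symm

theorem coeff_const_mul (c : ℂ) (F : V) (n : ℤ) : (const c * F).coeff n = c * F.coeff n := by
  rw [← smul_eq_const_mul, HahnSeries.coeff_smul, smul_eq_mul]

theorem exists_eq_zPow_mul_ofPS {F : V} {a : ℤ} (h : ∀ n < a, F.coeff n = 0) :
    ∃ φ, F = zPow a * ofPS φ ∧ PowerSeries.constantCoeff φ = F.coeff a := by
  refine ⟨PowerSeries.mk fun n => F.coeff (a + n), ?_, by
    simp [← PowerSeries.coeff_zero_eq_constantCoeff_apply]⟩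
  ext n
  rw [coeff_zPow_mul]
  by_cases hn : n < a
  · rw [h n hn, coeff_ofPS_of_neg _ (by omega)]
  · obtain ⟨k, hk⟩ := Int.eq_ofNat_of_zero_le (show 0 ≤ n - a by omega)
    rw [hk, coeff_ofPS_natCast, PowerSeries.coeff_mk, ← hk]
    congr 1
    ring

theorem coeff_zPow_mul_ofPS_of_lt (a : ℤ) (φ : PowerSeries ℂ) {n : ℤ} (h : n < a) :
    (zPow a * ofPS φ).coeff n = 0 := by
  rw [coeff_zPow_mul, coeff_ofPS_of_neg _ (by omega)]

theorem coeff_zPow_mul_ofPS_self (a : ℤ) (φ : PowerSeries ℂ) :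
    (zPow a * ofPS φ).coeff a = PowerSeries.constantCoeff φ := by
  rw [coeff_zPow_mul, sub_self]
  exact (coeff_ofPS_natCast φ 0).trans (PowerSeries.coeff_zero_eq_constantCoeff_apply φ)

theorem coeff_ofPS_mul_of_lt (φ : PowerSeries ℂ) {F : V} {a : ℤ} (h : ∀ n < a, F.coeff n = 0)
    {n : ℤ} (hn : n < a) : (ofPS φ * F).coeff n = 0 := by
  obtain ⟨ψ, rfl, -⟩ := exists_eq_zPow_mul_ofPS h
  rw [mul_left_comm, ← map_mul, coeff_zPow_mul_ofPS_of_lt _ _ hn]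

theorem coeff_ofPS_mul_self (φ : PowerSeries ℂ) {F : V} {a : ℤ} (h : ∀ n < a, F.coeff n = 0) :
    (ofPS φ * F).coeff a = PowerSeries.constantCoeff φ * F.coeff a := by
  obtain ⟨ψ, hF, h0⟩ := exists_eq_zPow_mul_ofPS h
  rw [← h0, hF, mul_left_comm, ← map_mul, coeff_zPow_mul_ofPS_self, map_mul]

theorem FrameCondAt.ofPS_mul {X : ℕ → V} {l : ℕ} (h : FrameCondAt X l) {φ : PowerSeries ℂ}
    (hφ : PowerSeries.constantCoeff φ = 1) : FrameCondAt (fun j => ofPS φ * X j) l := by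
  refine ⟨fun j hj => ?_, fun j hj n hn => ?_, fun j hj n hn => ?_⟩
  · rw [coeff_ofPS_mul_self φ (h.2.1 j hj), hφ, h.1 j hj, one_mul]
  · exact coeff_ofPS_mul_of_lt φ (h.2.1 j hj) hn
  -- These columns vanish up to and including the exponent -l, so the strict bound is -l + 1.
  · exact coeff_ofPS_mul_of_lt φ (a := -(l : ℤ) + 1) (fun n hn => h.2.2 j hj n (by omega))
      (by omega)

/-- The geometric series `1 / (1 - μ z)`. -/
def geom (μ : ℂ) : PowerSeries ℂ := PowerSeries.mk fun n => μ ^ n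

theorem one_sub_mul_geom (μ : ℂ) : (1 - PowerSeries.C μ * PowerSeries.X) * geom μ = 1 := by
  ext n
  rw [sub_mul, one_mul, map_sub, mul_assoc, PowerSeries.coeff_C_mul, mul_comm PowerSeries.X]
  rcases n with _ | n
  · simp [geom]
  · simp [geom, PowerSeries.coeff_succ_mul_X, PowerSeries.coeff_one, pow_succ']

theorem one_sub_const_mul_zPow (μ : ℂ) :
    1 - const μ * zPow 1 = ofPS (1 - PowerSeries.C μ * PowerSeries.X) := by
  have := zPow_natCast 1
  rw [Nat.cast_one, pow_one] at this
  rw [const_eq_ofPS, this, map_sub, map_mul, map_one]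

theorem inv_one_sub_const_mul_zPow (μ : ℂ) : (1 - const μ * zPow 1)⁻¹ = ofPS (geom μ) := by
  refine inv_eq_of_mul_eq_one_right ?_
  rw [one_sub_const_mul_zPow, ← map_mul, one_sub_mul_geom, map_one]

theorem constantCoeff_geom (μ : ℂ) : PowerSeries.constantCoeff (geom μ) = 1 := by
  simp [geom, ← PowerSeries.coeff_zero_eq_constantCoeff_apply]

theorem one_sub_const_mul_zPow_ne_zero (μ : ℂ) : 1 - const μ * zPow 1 ≠ 0 := by
  intro h
  have := congrArg (· * ofPS (geom μ)) h
  simp only [one_sub_const_mul_zPow, ← map_mul, one_sub_mul_geom, map_one, zero_mul] at this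
  exact one_ne_zero this

/-! ## Division of a frame by `1 - μ z` -/

/-- Multiplication by z raises the index of `dress` by one. Multiplication by 1 - μz thus becomes a
row operation on the dressed matrix. -/
theorem dress_sub_C_mul_dress (μ : ℂ) (F : V) (i : ℤ) :
    dress F i - MvPowerSeries.C μ * dress F (i + 1) = dress ((1 - const μ * zPow 1) * F) i := by
  ext α
  rw [map_sub, MvPowerSeries.coeff_C_mul, coeff_dress, coeff_dress, coeff_dress, sub_mul, one_mul,
    HahnSeries.coeff_sub, mul_assoc, coeff_const_mul, coeff_zPow_mul,
    show (wt α : ℤ) - (i + 1) = wt α - i - 1 by ring]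
  ring

theorem coeff_expXi_eq (μ : ℂ) (α : ℕ+ →₀ ℕ) :
    MvPowerSeries.coeff α (expXi μ) = μ ^ wt α * invFactorial α := by
  rw [coeff_expXi, Finset.sum_eq_single (wt α)]
  · rw [coeff_pPoly, if_pos rfl, mul_comm]
  · intro l _ hl
    rw [coeff_pPoly, if_neg (by omega), zero_mul]
  · simp

theorem dress_ofPS_geom_mul_zPow (μ : ℂ) (M : ℕ) :
    dress (ofPS (geom μ) * zPow (-(M : ℤ))) M = expXi μ := by
  ext α
  rw [coeff_dress, mul_comm (ofPS _), coeff_zPow_mul, coeff_expXi_eq, sub_neg_eq_add,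
    sub_add_cancel, coeff_ofPS_natCast, geom, PowerSeries.coeff_mk]

/-- Subtracting μ times the next row removes the factor 1/(1 - μz) from every row but the last. The
last column then has entries p_{i-M} = 0 above the corner, and the corner is ∑ μ^e p_e = e^{ξ(x,μ)}.
-/
theorem dressDet_succ_geom_mul {X : ℕ → V} {M : ℕ} (hX : X M = zPow (-(M : ℤ))) (μ : ℂ) :
    dressDet (M + 1) (fun j => ofPS (geom μ) * X j) = expXi μ * dressDet M X := by
  set A : Matrix (Fin (M + 1)) (Fin (M + 1)) TimeSeries :=
    Matrix.of fun i j => dress (ofPS (geom μ) * X j) (i : ℕ) with hA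
  set B : Matrix (Fin (M + 1)) (Fin (M + 1)) TimeSeries :=
    Matrix.of fun i j => if i = Fin.last M then A (Fin.last M) j else dress (X j) (i : ℕ) with hB
  have hAB : A.det = B.det := by
    -- The row-operation lemma refers to the preceding row, whereas here each row is corrected by
    -- the following one; hence the reversal.
    rw [← Matrix.det_submatrix_equiv_self Fin.revPerm A,
      ← Matrix.det_submatrix_equiv_self Fin.revPerm B]
    refine Matrix.det_eq_of_forall_row_eq_smul_add_pred (fun _ => MvPowerSeries.C μ) ?_ ?_
    · intro j
      simp [hB]
    · intro i j
      simp only [Matrix.submatrix_apply, Fin.revPerm_apply, Fin.rev_succ, Fin.rev_castSucc]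
      simp only [hA, hB, Matrix.of_apply, (Fin.castSucc_lt_last _).ne, if_false, Fin.val_castSucc,
        Fin.val_succ]
      rw [← sub_eq_iff_eq_add, Nat.cast_succ, dress_sub_C_mul_dress, ← mul_assoc,
        one_sub_const_mul_zPow, ← map_mul, one_sub_mul_geom, map_one, one_mul]
  have hlast : B (Fin.last M) (Fin.last M) = expXi μ := by
    simp only [hB, hA, Matrix.of_apply, if_true, Fin.val_last, hX, dress_ofPS_geom_mul_zPow]
  rw [dressDet, ← hA, hAB, det_of_last_col_eq, hlast]
  · congr 2
    ext1 i j
    simp [hB, (Fin.castSucc_lt_last _).ne]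
  · intro i
    simp only [hB, Matrix.of_apply, (Fin.castSucc_lt_last _).ne, if_false, Fin.val_last, hX,
      Fin.val_castSucc, dress_zPow]
    exact pPoly_of_neg (by have := i.2; omega)

theorem dressDet_congr {X Y : ℕ → V} {M : ℕ} (h : ∀ j < M, X j = Y j) :
    dressDet M X = dressDet M Y := by
  unfold dressDet
  congr 1
  ext1 i j
  simp only [Matrix.of_apply, h j j.2]

theorem frameCondAt_truncate {X : ℕ → V} {M : ℕ} (h : FrameCondAt X M) :
    FrameCondAt (fun j => if j < M then X j else zPow (-(j : ℤ))) M := by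
  refine ⟨fun j hj => ?_, fun j hj n hn => ?_, fun j hj n hn => ?_⟩
  · simp [not_lt.2 hj, coeff_zPow]
  · simp [not_lt.2 hj, coeff_zPow, hn.ne]
  · simp only [hj, if_true]
    exact h.2.2 j hj n hn

/-- Division of a frame by `1 - μ z` multiplies its tau function by `exp ξ(x, μ)`. -/
theorem tau_geom_mul {X : ℕ → V} (h : FrameCond X) (μ : ℂ) :
    tau (fun j => ofPS (geom μ) * X j) = expXi μ * tau X := by
  obtain ⟨l, hl⟩ := (frameCond_iff X).1 h
  ext α
  set M := max l (wt α) with hM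
  have hX : FrameCondAt X M := hl.mono (le_max_left _ _)
  have hα : wt α ≤ M := le_max_right _ _
  -- In weight at most M only the first M columns matter, so the later ones may be replaced by
  -- z^{-j}. Then column M has the form that `dressDet_succ_geom_mul` needs.
  set X' : ℕ → V := fun j => if j < M then X j else zPow (-(j : ℤ)) with hX'
  have hc : ∀ j < M, X j = X' j := fun j hj => by simp [hX', hj]
  have hXt : FrameCondAt X' M := frameCondAt_truncate hX
  have hgeom := constantCoeff_geom μ
  rw [coeff_tau_eq_coeff_dressDet (hX.ofPS_mul hgeom) hα,
    dressDet_congr (Y := fun j => ofPS (geom μ) * X' j) (fun j hj => by rw [hc j hj]),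
    ← coeff_tau_eq_coeff_dressDet (hXt.ofPS_mul hgeom) hα,
    coeff_tau_eq_coeff_dressDet ((hXt.ofPS_mul hgeom).mono M.le_succ) (hα.trans M.le_succ),
    dressDet_succ_geom_mul (by simp [hX']), ← dressDet_congr hc]
  -- The coefficient of the product at α involves τ in all weights up to wt α, so the comparison is
  -- made modulo the ideal `highWeight`.
  refine coeff_eq_of_sub_mem_highWeight (N := wt α) ?_ le_rfl
  rw [← mul_sub]
  refine Ideal.mul_mem_left _ _ fun β hβ => ?_
  rw [map_sub, ← coeff_tau_eq_coeff_dressDet hX (hβ.trans hα), sub_self]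

theorem tau_prod_geom_mul {X : ℕ → V} (h : FrameCond X) {ι : Type*} (s : Finset ι) (μ : ι → ℂ) :
    tau (fun j => ofPS (∏ i ∈ s, geom (μ i)) * X j) = (∏ i ∈ s, expXi (μ i)) * tau X := by
  classical
  induction s using Finset.induction_on with
  | empty => simp
  | insert a s ha ih =>
    have hF : FrameCond fun j => ofPS (∏ i ∈ s, geom (μ i)) * X j := by
      obtain ⟨l, hl⟩ := (frameCond_iff X).1 h
      refine (frameCond_iff _).2 ⟨l, hl.ofPS_mul ?_⟩
      rw [map_prod]
      exact Finset.prod_eq_one fun i _ => constantCoeff_geom _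
    rw [Finset.prod_insert ha, Finset.prod_insert ha, mul_assoc, ← ih, ← tau_geom_mul hF]
    simp only [map_mul, mul_assoc]

/-! ## Change of frame -/

/-- Elements of the span of a frame without poles of order `≥ K` are combinations of the first `K`
columns. -/
theorem FrameCondAt.exists_eq_sum {X : ℕ → V} {K : ℕ} (h : FrameCondAt X K) {F : V}
    (hF : F ∈ Submodule.span ℂ (Set.range X)) (hp : ∀ n : ℤ, n ≤ -(K : ℤ) → F.coeff n = 0) :
    ∃ c : Fin K → ℂ, F = ∑ j, c j • X j := by
  obtain ⟨c, rfl⟩ := (Finsupp.mem_span_range_iff_exists_finsupp).1 hF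
  -- A largest index J ≥ K in the combination would leave a coefficient at z^{-J} that no other
  -- column can cancel.
  have hsupp : ∀ j ∈ c.support, j < K := by
    by_contra hcon
    push Not at hcon
    obtain ⟨j₀, hj₀, hKj₀⟩ := hcon
    set J := c.support.max' ⟨j₀, hj₀⟩ with hJ
    have hJK : K ≤ J := hKj₀.trans (Finset.le_max' _ _ hj₀)
    have hJs : J ∈ c.support := Finset.max'_mem _ _
    have hz := hp (-(J : ℤ)) (by omega)
    rw [Finsupp.sum, HahnSeries.coeff_sum, Finset.sum_eq_single_of_mem J hJs] at hz
    · rw [HahnSeries.coeff_smul, h.1 J hJK, smul_eq_mul, mul_one] at hz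
      exact (Finsupp.mem_support_iff.1 hJs) hz
    · intro i hi hiJ
      rw [HahnSeries.coeff_smul, h.coeff_eq_zero hJK
        (lt_of_le_of_ne (Finset.le_max' _ _ hi) hiJ) le_rfl, smul_zero]
  refine ⟨fun j => c j, ?_⟩
  rw [Finsupp.sum, Finset.sum_subset (s₂ := Finset.range K)
    (fun j hj => Finset.mem_range.2 (hsupp j hj))
    (fun j _ hj => by rw [Finsupp.notMem_support_iff.1 hj, zero_smul]), Finset.sum_range]

/-- The first K columns of Y are combinations of the first K columns of X, and d is the determinant
of this K × K matrix. The d obtained in this way may depend on K. -/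
theorem FrameCondAt.exists_plucker_eq {X Y : ℕ → V} {K : ℕ} (hX : FrameCondAt X K)
    (hY : FrameCondAt Y K) (hXY : ∀ j, Y j ∈ Submodule.span ℂ (Set.range X)) :
    ∃ d : ℂ, ∀ μ : Part, μ.length ≤ K → plucker Y μ = d * plucker X μ := by
  have hex : ∀ j : Fin K, ∃ c : Fin K → ℂ, Y j = ∑ i, c i • X i := fun j =>
    hX.exists_eq_sum (hXY j) fun n hn => hY.2.2 j j.2 n hn
  choose c hc using hex
  refine ⟨(Matrix.of fun i j => c j i).det, fun μ hμ => ?_⟩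
  rw [plucker_eq_det hX μ hμ, plucker_eq_det hY μ hμ, mul_comm, ← Matrix.det_mul]
  congr 1
  ext i j
  simp only [Matrix.mul_apply, Matrix.of_apply, entry, hc j, HahnSeries.coeff_sum,
    HahnSeries.coeff_smul, smul_eq_mul, mul_comm]

/-- Tau functions of two frames of the same point are proportional. -/
theorem exists_tau_eq_of_isFrame {U : Submodule ℂ V} {X Y : ℕ → V} (hX : IsFrame U X)
    (hY : IsFrame U Y) : ∃ c : ℂ, c ≠ 0 ∧ tau Y = MvPowerSeries.C c * tau X := by
  obtain ⟨-, -, hXs, hXc⟩ := hX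
  obtain ⟨-, -, hYs, hYc⟩ := hY
  obtain ⟨l, hl⟩ := (frameCond_iff X).1 hXc
  obtain ⟨l', hl'⟩ := (frameCond_iff Y).1 hYc
  have hmX : ∀ j, Y j ∈ Submodule.span ℂ (Set.range X) := fun j => by
    rw [hXs, ← hYs]
    exact Submodule.subset_span ⟨j, rfl⟩
  have hmY : ∀ j, X j ∈ Submodule.span ℂ (Set.range Y) := fun j => by
    rw [hYs, ← hXs]
    exact Submodule.subset_span ⟨j, rfl⟩
  -- Since the factor comes with a choice of K, partitions are compared two at a time at a common K.
  -- The reverse factor e shows that a nonzero Plücker coordinate of X stays nonzero for Y.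
  have key : ∀ μ ν : Part, ∃ d e : ℂ, plucker Y μ = d * plucker X μ ∧ plucker Y ν = d * plucker X ν ∧
      plucker X μ = e * plucker Y μ ∧ plucker X ν = e * plucker Y ν := by
    intro μ ν
    have h1 : FrameCondAt X (max (max l l') (max μ.length ν.length)) :=
      hl.mono ((le_max_left _ _).trans (le_max_left _ _))
    have h2 : FrameCondAt Y (max (max l l') (max μ.length ν.length)) :=
      hl'.mono ((le_max_right _ _).trans (le_max_left _ _))
    have hμ : μ.length ≤ max (max l l') (max μ.length ν.length) :=
      (le_max_left _ _).trans (le_max_right _ _)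
    have hν : ν.length ≤ max (max l l') (max μ.length ν.length) :=
      (le_max_right _ _).trans (le_max_right _ _)
    obtain ⟨d, hd⟩ := h1.exists_plucker_eq h2 hmX
    obtain ⟨e, he⟩ := h2.exists_plucker_eq h1 hmY
    exact ⟨d, e, hd μ hμ, hd ν hν, he μ hμ, he ν hν⟩
  obtain ⟨c, hc0, hc⟩ : ∃ c : ℂ, c ≠ 0 ∧ ∀ μ, plucker Y μ = c * plucker X μ := by
    by_cases hz : ∀ μ, plucker X μ = 0
    · refine ⟨1, one_ne_zero, fun μ => ?_⟩
      obtain ⟨d, e, h1, -⟩ := key μ μ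
      rw [h1, hz μ, mul_zero, mul_zero]
    · push Not at hz
      obtain ⟨ν, hν⟩ := hz
      refine ⟨plucker Y ν / plucker X ν, div_ne_zero (fun h => ?_) hν, fun μ => ?_⟩
      · obtain ⟨d, e, -, -, h3, -⟩ := key ν ν
        rw [h, mul_zero] at h3
        exact hν h3
      · obtain ⟨d, e, h1, h2, -⟩ := key μ ν
        rw [h1, h2, mul_div_cancel_right₀ _ hν]
  refine ⟨c, hc0, ?_⟩
  ext α
  rw [MvPowerSeries.coeff_C_mul, coeff_tau_eq_sum _ le_rfl le_rfl,
    coeff_tau_eq_sum _ le_rfl le_rfl, Finset.mul_sum]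
  refine Finset.sum_congr rfl fun f _ => ?_
  rw [hc, mul_assoc]

/-! ## Points of the Grassmannian from frames -/

theorem mkQ_mkQ_eq_zero_iff (U : Submodule ℂ V) (F : V) :
    (U.map V0.mkQ).mkQ (V0.mkQ F) = 0 ↔ ∃ u ∈ U, F - u ∈ V0 := by
  rw [Submodule.mkQ_apply, Submodule.Quotient.mk_eq_zero, Submodule.mem_map]
  refine exists_congr fun u => and_congr_right fun _ => ?_
  rw [eq_comm, Submodule.mkQ_apply, Submodule.mkQ_apply, Submodule.Quotient.eq]

theorem exists_coeff_eq_zero_of_le (F : V) : ∃ a : ℤ, ∀ n ≤ a, F.coeff n = 0 := by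
  refine ⟨F.order - 1, fun n hn => HahnSeries.coeff_eq_zero_of_lt_order (by omega)⟩

/-- Poles of order at least l are removed from the highest order down, with the columns of leading
term z^{-j}. -/
theorem FrameCondAt.exists_sub_coeff_eq_zero {X : ℕ → V} {l : ℕ} (h : FrameCondAt X l) (F : V) :
    ∃ u ∈ Submodule.span ℂ (Set.range X), ∀ n : ℤ, n ≤ -(l : ℤ) → (F - u).coeff n = 0 := by
  have key : ∀ k : ℕ, ∀ F : V, (∀ n : ℤ, n ≤ -((l + k : ℕ) : ℤ) → F.coeff n = 0) →
      ∃ u ∈ Submodule.span ℂ (Set.range X), ∀ n : ℤ, n ≤ -(l : ℤ) → (F - u).coeff n = 0 := by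
    intro k
    induction k with
    | zero => exact fun F hF => ⟨0, zero_mem _, by simpa using hF⟩
    | succ k ih =>
      intro F hF
      obtain ⟨u, hu, hu'⟩ := ih (F - F.coeff (-((l + k : ℕ) : ℤ)) • X (l + k)) fun n hn => by
        rw [HahnSeries.coeff_sub, HahnSeries.coeff_smul, smul_eq_mul]
        rcases hn.eq_or_lt with rfl | hlt
        · rw [h.1 (l + k) (by omega), mul_one, sub_self]
        · rw [h.2.1 (l + k) (by omega) n hlt, hF n (by push_cast at hlt ⊢; omega), mul_zero,
            sub_zero]
      refine ⟨F.coeff (-((l + k : ℕ) : ℤ)) • X (l + k) + u,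
        add_mem (Submodule.smul_mem _ _ (Submodule.subset_span ⟨_, rfl⟩)) hu, fun n hn => ?_⟩
      rw [← sub_sub]
      exact hu' n hn
  obtain ⟨a, ha⟩ := exists_coeff_eq_zero_of_le F
  exact key (-a).toNat F fun n hn => ha n (by omega)

/-- The span of a linearly independent normalized sequence is a point of the Grassmannian. -/
theorem FrameCondAt.memUGM {X : ℕ → V} {l : ℕ} (h : FrameCondAt X l)
    (hli : LinearIndependent ℂ X) : MemUGM (Submodule.span ℂ (Set.range X)) := by
  set U := Submodule.span ℂ (Set.range X) with hU
  -- T spans the first l columns, S the monomials 1, …, z^{-(l-1)}, and P reads off their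
  -- coefficients. The square matrix P ∘ T has a kernel isomorphic to U ∩ V₀ and a cokernel
  -- isomorphic to that of π|_U, so rank–nullity gives equal dimensions.
  let T : (Fin l → ℂ) →ₗ[ℂ] V := Fintype.linearCombination ℂ fun j : Fin l => X j
  let S : (Fin l → ℂ) →ₗ[ℂ] V := Fintype.linearCombination ℂ fun k : Fin l => zPow (-(k : ℤ))
  let P : V →ₗ[ℂ] (Fin l → ℂ) :=
    LinearMap.pi fun k : Fin l => HahnSeries.coeff.linearMap (-((k : ℕ) : ℤ))
  have hTinj : Function.Injective T := by
    have h1 : LinearIndependent ℂ fun j : Fin l => X j := hli.comp _ Fin.val_injective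
    exact h1.fintypeLinearCombination_injective
  have hTU : ∀ c, T c ∈ U := fun c => by
    rw [Fintype.linearCombination_apply]
    exact Submodule.sum_mem _ fun j _ =>
      Submodule.smul_mem _ _ (Submodule.subset_span ⟨j, rfl⟩)
  have hTp : ∀ c (n : ℤ), n ≤ -(l : ℤ) → (T c).coeff n = 0 := fun c n hn => by
    rw [Fintype.linearCombination_apply, HahnSeries.coeff_sum]
    exact Finset.sum_eq_zero fun j _ => by
      rw [HahnSeries.coeff_smul, h.2.2 j j.2 n hn, smul_zero]
  have hSP : ∀ F : V, (∀ n : ℤ, n ≤ -(l : ℤ) → F.coeff n = 0) → F - S (P F) ∈ V0 := by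
    intro F hF n hn
    rw [HahnSeries.coeff_sub, sub_eq_zero, Fintype.linearCombination_apply, HahnSeries.coeff_sum]
    simp only [HahnSeries.coeff_smul, coeff_zPow, smul_eq_mul, mul_ite, mul_one, mul_zero]
    by_cases hnl : n ≤ -(l : ℤ)
    · rw [hF n hnl, Finset.sum_eq_zero]
      intro k _
      rw [if_neg]
      have := k.2
      omega
    · rw [Finset.sum_eq_single (⟨(-n).toNat, by omega⟩ : Fin l)]
      · have e : (((-n).toNat : ℕ) : ℤ) = -n := by omega
        simp only [e, neg_neg, if_true]
        change _ = F.coeff _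
        simp only [e, neg_neg]
      · intro k _ hk
        rw [if_neg]
        intro hk'
        apply hk
        ext
        simp only
        omega
      · simp
  have hPS : ∀ a, P (S a) = a := by
    intro a
    ext k
    change (S a).coeff _ = a k
    rw [Fintype.linearCombination_apply, HahnSeries.coeff_sum]
    simp only [HahnSeries.coeff_smul, coeff_zPow, smul_eq_mul, mul_ite, mul_one, mul_zero,
      neg_inj, Nat.cast_inj, Fin.val_inj]
    simp
  have hSp : ∀ c (n : ℤ), n ≤ -(l : ℤ) → (S c).coeff n = 0 := fun c n hn => by
    rw [Fintype.linearCombination_apply, HahnSeries.coeff_sum]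
    exact Finset.sum_eq_zero fun j _ => by
      have := j.2
      rw [HahnSeries.coeff_smul, coeff_zPow, if_neg (by omega), smul_zero]
  have hPV0 : ∀ F ∈ V0, P F = 0 := by
    intro F hF
    ext k
    exact hF _ (by simp)
  let ψ : (Fin l → ℂ) →ₗ[ℂ] (Fin l → ℂ) := P ∘ₗ T
  let θ : (Fin l → ℂ) →ₗ[ℂ] ((V ⧸ V0) ⧸ U.map V0.mkQ) := (U.map V0.mkQ).mkQ ∘ₗ V0.mkQ ∘ₗ S
  have hker : (LinearMap.ker ψ).map T = U ⊓ V0 := by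
    ext F
    rw [Submodule.mem_map, Submodule.mem_inf]
    constructor
    · rintro ⟨c, hc, rfl⟩
      refine ⟨hTU c, ?_⟩
      have := hSP (T c) (hTp c)
      rwa [show P (T c) = 0 from hc, map_zero, sub_zero] at this
    · rintro ⟨hFU, hF0⟩
      obtain ⟨c, hc⟩ := h.exists_eq_sum hFU fun n hn => hF0 n (by omega)
      have hc' : F = T c := by rw [hc, Fintype.linearCombination_apply]
      exact ⟨c, by rw [LinearMap.mem_ker, LinearMap.comp_apply, ← hc', hPV0 F hF0], hc'.symm⟩
  have hθker : LinearMap.ker θ = LinearMap.range ψ := by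
    ext a
    rw [LinearMap.mem_ker, LinearMap.comp_apply, LinearMap.comp_apply, mkQ_mkQ_eq_zero_iff,
      LinearMap.mem_range]
    constructor
    · rintro ⟨u, hu, hu'⟩
      obtain ⟨c, hc⟩ := h.exists_eq_sum hu fun n hn => by
        have := hu' n (by omega)
        rwa [HahnSeries.coeff_sub, hSp a n hn, zero_sub, neg_eq_zero] at this
      refine ⟨c, ?_⟩
      have hc' : u = T c := by rw [hc, Fintype.linearCombination_apply]
      have := hPV0 _ hu'
      rw [map_sub, hPS, sub_eq_zero, hc'] at this
      exact this.symm
    · rintro ⟨c, rfl⟩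
      refine ⟨T c, hTU c, ?_⟩
      rw [← neg_sub]
      exact neg_mem (hSP (T c) (hTp c))
  have hθ : Function.Surjective θ := by
    intro q
    obtain ⟨q', rfl⟩ := Submodule.mkQ_surjective _ q
    obtain ⟨F, rfl⟩ := Submodule.mkQ_surjective _ q'
    obtain ⟨u, hu, hu'⟩ := h.exists_sub_coeff_eq_zero F
    refine ⟨P (F - u), ?_⟩
    rw [LinearMap.comp_apply, LinearMap.comp_apply, ← sub_eq_zero, ← map_sub, ← map_sub,
      mkQ_mkQ_eq_zero_iff]
    refine ⟨-u, neg_mem hu, ?_⟩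
    rw [← neg_mem_iff]
    have := hSP (F - u) hu'
    convert this using 1
    abel
  have hfin : FiniteDimensional ℂ ((V ⧸ V0) ⧸ U.map V0.mkQ) := Module.Finite.of_surjective θ hθ
  have hfin' : FiniteDimensional ℂ ↥(U ⊓ V0) := by
    rw [← hker]
    infer_instance
  refine ⟨hfin', hfin, ?_⟩
  have h1 := LinearMap.finrank_range_add_finrank_ker ψ
  have h2 := LinearMap.finrank_range_add_finrank_ker θ
  rw [LinearMap.range_eq_top.2 hθ, finrank_top, hθker] at h2
  rw [← hker, ← (Submodule.equivMapOfInjective T hTinj _).finrank_eq]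
  omega

theorem isFrame_span {X : ℕ → V} (h : FrameCond X) (hli : LinearIndependent ℂ X) :
    IsFrame (Submodule.span ℂ (Set.range X)) X := by
  obtain ⟨l, hl⟩ := (frameCond_iff X).1 h
  exact ⟨hl.memUGM hli, hli, rfl, h⟩

/-- A point of the Grassmannian contains no other one. -/
theorem MemUGM.eq_of_le {U W : Submodule ℂ V} (hU : MemUGM U) (hW : MemUGM W) (hle : U ≤ W) :
    U = W := by
  obtain ⟨hU1, hU2, hU3⟩ := hU
  obtain ⟨hW1, hW2, hW3⟩ := hW
  have hmap : U.map V0.mkQ ≤ W.map V0.mkQ := Submodule.map_mono hle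
  let φ : ((V ⧸ V0) ⧸ U.map V0.mkQ) →ₗ[ℂ] ((V ⧸ V0) ⧸ W.map V0.mkQ) := Submodule.factor hmap
  have hφ : Function.Surjective φ := Submodule.factor_surjective hmap
  have hinf : U ⊓ V0 ≤ W ⊓ V0 := inf_le_inf_right _ hle
  -- The chain dim ker U ≤ dim ker W = dim coker W ≤ dim coker U = dim ker U forces equality
  -- throughout, where ker and coker are those of π on each space.
  have h1 : Module.finrank ℂ ↥(U ⊓ V0) ≤ Module.finrank ℂ ↥(W ⊓ V0) := Submodule.finrank_mono hinf
  have h2 := LinearMap.finrank_le_finrank_of_surjective hφ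
  have hinfeq : U ⊓ V0 = W ⊓ V0 := Submodule.eq_of_le_of_finrank_eq hinf (by omega)
  have hφi : Function.Injective φ :=
    (LinearMap.injective_iff_surjective_of_finrank_eq_finrank (by omega)).2 hφ
  refine le_antisymm hle fun F hF => ?_
  have hz : (U.map V0.mkQ).mkQ (V0.mkQ F) = 0 := by
    apply hφi
    rw [map_zero]
    exact (mkQ_mkQ_eq_zero_iff W F).2 ⟨F, hF, by rw [sub_self]; exact zero_mem _⟩
  obtain ⟨u, hu, hu'⟩ := (mkQ_mkQ_eq_zero_iff U F).1 hz
  have : F - u ∈ U ⊓ V0 := by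
    rw [hinfeq]
    exact ⟨sub_mem hF (hle hu), hu'⟩
  simpa using add_mem this.1 hu

/-- Series with distinct leading exponents are linearly independent. -/
theorem linearIndependent_of_leading {ι : Type*} {X : ι → V} {e : ι → ℤ}
    (he : Function.Injective e) (h1 : ∀ i, (X i).coeff (e i) ≠ 0)
    (h0 : ∀ i, ∀ n < e i, (X i).coeff n = 0) : LinearIndependent ℂ X := by
  classical
  rw [linearIndependent_iff]
  intro c hc
  by_contra hne
  obtain ⟨i, hi, hmin⟩ := c.support.exists_min_image e (Finsupp.support_nonempty_iff.2 hne)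
  have := congrArg (fun F : V => F.coeff (e i)) hc
  simp only [Finsupp.linearCombination_apply, Finsupp.sum, HahnSeries.coeff_sum,
    HahnSeries.coeff_zero] at this
  rw [Finset.sum_eq_single_of_mem i hi] at this
  · rw [HahnSeries.coeff_smul, smul_eq_mul] at this
    exact (mul_ne_zero (Finsupp.mem_support_iff.1 hi) (h1 i)) this
  · intro j hj hji
    rw [HahnSeries.coeff_smul, h0 j _ (lt_of_le_of_ne (hmin j hj) fun h => hji (he h).symm),
      smul_zero]

theorem frameCondAt_of_leading {X : ℕ → V} {e : ℕ → ℤ} {l : ℕ} (h1 : ∀ j, (X j).coeff (e j) = 1)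
    (h0 : ∀ j, ∀ n < e j, (X j).coeff n = 0) (hge : ∀ j, l ≤ j → e j = -(j : ℤ))
    (hlt : ∀ j, j < l → -(l : ℤ) < e j) : FrameCondAt X l :=
  ⟨fun j hj => hge j hj ▸ h1 j, fun j hj n hn => h0 j n (by rwa [hge j hj]),
    fun j hj n hn => h0 j n (hn.trans_lt (hlt j hj))⟩

/-! ### Multiplication of points and frames by a series -/

theorem map_mulBy_span (G : V) (X : ℕ → V) :
    (Submodule.span ℂ (Set.range X)).map (mulBy G) =
      Submodule.span ℂ (Set.range fun j => G * X j) := by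
  rw [Submodule.map_span, ← Set.range_comp]
  rfl

theorem mulBy_injective {G : V} (hG : G ≠ 0) : Function.Injective (mulBy G) :=
  mul_right_injective₀ hG

/-- Multiplication by a power series with constant term `1` maps frames to frames. -/
theorem IsFrame.ofPS_mul {U : Submodule ℂ V} {X : ℕ → V} (h : IsFrame U X) {φ : PowerSeries ℂ}
    (hφ : PowerSeries.constantCoeff φ = 1) :
    IsFrame (U.map (mulBy (ofPS φ))) fun j => ofPS φ * X j := by
  obtain ⟨-, hli, hs, hc⟩ := h
  obtain ⟨l, hl⟩ := (frameCond_iff X).1 hc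
  have hne : ofPS φ ≠ 0 := by
    intro h0
    have h1 := coeff_ofPS_natCast φ 0
    rw [h0, PowerSeries.coeff_zero_eq_constantCoeff_apply, hφ] at h1
    simp at h1
  rw [← hs, map_mulBy_span]
  refine isFrame_span ((frameCond_iff _).2 ⟨l, hl.ofPS_mul hφ⟩) ?_
  exact hli.map' (mulBy (ofPS φ)) (LinearMap.ker_eq_bot.2 (mulBy_injective hne))

theorem map_mulBy_mulBy (U : Submodule ℂ V) (G H : V) :
    (U.map (mulBy G)).map (mulBy H) = U.map (mulBy (H * G)) := by
  rw [← Submodule.map_comp]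
  congr 1
  ext1 F
  exact (mul_assoc H G F).symm

theorem map_mulBy_one (U : Submodule ℂ V) : U.map (mulBy 1) = U := by
  convert Submodule.map_id U
  ext1 F
  exact one_mul F

/-! ## The frames of the curves -/

section Curve

variable {m : ℕ} (ρ : Fin 3 × Fin m → ℂ)

theorem constantCoeff_cbrtFactor (c : ℂ) : PowerSeries.constantCoeff (cbrtFactor c) = 1 := by
  rw [cbrtFactor, PowerSeries.constantCoeff_expand, ← PowerSeries.coeff_zero_eq_constantCoeff_apply,
    PowerSeries.coeff_rescale, pow_zero, one_mul, PowerSeries.coeff_zero_eq_constantCoeff_apply,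
    PowerSeries.binomialSeries_constantCoeff]

/-- The power series `f̂(z)`. -/
def fHatSeries : PowerSeries ℂ := ∏ i, cbrtFactor (ρ i ^ 3)

theorem fHat_eq : fHat ρ = ofPS (fHatSeries ρ) := rfl

theorem constantCoeff_fHatSeries : PowerSeries.constantCoeff (fHatSeries ρ) = 1 := by
  rw [fHatSeries, map_prod]
  exact Finset.prod_eq_one fun i _ => constantCoeff_cbrtFactor _

/-- The leading exponent of the column `c` of the frame of the curve. -/
def curveLead (m c : ℕ) : ℤ :=
  if c < 2 * m then 3 * (m : ℤ) - 3 * (c : ℤ)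
  else if c < 3 * m then -1 - 3 * ((c : ℤ) - 2 * (m : ℤ))
  else -(c : ℤ)

/-- The power of `f̂` in the column `c` of the frame of the curve. -/
def curvePow (m c : ℕ) : ℕ := if c < 2 * m then 0 else if c < 3 * m then 1 else c % 3

theorem curveFrame_eq (c : ℕ) : curveFrame ρ c =
    zPow (curveLead m c) * ofPS (fHatSeries ρ ^ curvePow m c) := by
  unfold curveFrame curveLead curvePow
  split_ifs <;> simp [fHat_eq]

theorem curveLead_injective (m : ℕ) : Function.Injective (curveLead m) := by
  intro a b h
  unfold curveLead at h
  split_ifs at h <;> omega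

theorem coeff_curveFrame_lead (c : ℕ) : (curveFrame ρ c).coeff (curveLead m c) = 1 := by
  rw [curveFrame_eq, coeff_zPow_mul_ofPS_self, map_pow, constantCoeff_fHatSeries, one_pow]

theorem coeff_curveFrame_of_lt (c : ℕ) {n : ℤ} (h : n < curveLead m c) :
    (curveFrame ρ c).coeff n = 0 := by
  rw [curveFrame_eq, coeff_zPow_mul_ofPS_of_lt _ _ h]

/-- The column 3m from which the normalization holds does not depend on ρ; the continuity of τ
relies on this. -/
theorem frameCondAt_curveFrame : FrameCondAt (curveFrame ρ) (3 * m) := by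
  refine frameCondAt_of_leading (coeff_curveFrame_lead ρ)
    (fun j _ h => coeff_curveFrame_of_lt ρ j h) (fun j hj => ?_) fun j hj => ?_
  · unfold curveLead
    split_ifs <;> omega
  · unfold curveLead
    split_ifs <;> omega

theorem linearIndependent_curveFrame : LinearIndependent ℂ (curveFrame ρ) :=
  linearIndependent_of_leading (curveLead_injective m)
    (fun c => by rw [coeff_curveFrame_lead]; exact one_ne_zero)
    fun c _ h => coeff_curveFrame_of_lt ρ c h

/-- The expansion of `x`. -/
theorem expandPoly_X_zero : expandPoly ρ (MvPolynomial.X 0) = zPow (-3) := by simp [expandPoly]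

/-- The expansion of `y`. -/
theorem expandPoly_X_one :
    expandPoly ρ (MvPolynomial.X 1) = zPow (-(3 * (m : ℤ)) - 1) * fHat ρ := by simp [expandPoly]

theorem expandPoly_C (c : ℂ) : expandPoly ρ (MvPolynomial.C c) = const c :=
  MvPolynomial.eval₂Hom_C _ _ c

/-- The expansion of `z^{3m} x^i y^k`. -/
def curveMonomial (i k : ℕ) : V :=
  zPow (3 * (m : ℤ) - 3 * i - (3 * m + 1) * k) * fHat ρ ^ k

theorem curveMonomial_eq (i k : ℕ) : curveMonomial ρ i k =
    zPow (3 * (m : ℤ)) * (zPow (-3) ^ i * (zPow (-(3 * (m : ℤ)) - 1) * fHat ρ) ^ k) := by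
  rw [mul_pow, zPow_pow, zPow_pow, ← mul_assoc (zPow _) (zPow _), ← mul_assoc, zPow_mul_zPow,
    zPow_mul_zPow, curveMonomial]
  congr 2
  ring

theorem curveMonomial_eq_expandPoly (i k : ℕ) : curveMonomial ρ i k = zPow (3 * (m : ℤ)) *
    expandPoly ρ (MvPolynomial.X 0 ^ i * MvPolynomial.X 1 ^ k) := by
  rw [map_mul, map_pow, map_pow, expandPoly_X_zero, expandPoly_X_one, curveMonomial_eq]

theorem mem_iotaRange {F : V} : F ∈ iotaRange ρ ↔ ∃ p, zPow (3 * (m : ℤ)) * expandPoly ρ p = F := by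
  constructor
  · rintro ⟨q, rfl⟩
    obtain ⟨p, rfl⟩ := Ideal.Quotient.mk_surjective q
    exact ⟨p, rfl⟩
  · rintro ⟨p, rfl⟩
    exact ⟨Ideal.Quotient.mk _ p, rfl⟩

theorem curveMonomial_mem_iotaRange (i k : ℕ) : curveMonomial ρ i k ∈ iotaRange ρ :=
  (mem_iotaRange ρ).2 ⟨_, (curveMonomial_eq_expandPoly ρ i k).symm⟩

theorem curveFrame_eq_curveMonomial (c : ℕ) : ∃ i k, curveFrame ρ c = curveMonomial ρ i k := by
  unfold curveFrame curveMonomial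
  split_ifs with h1 h2
  · exact ⟨c, 0, by simp⟩
  · refine ⟨c - 2 * m, 1, ?_⟩
    rw [pow_one]
    congr 2
    push_cast
    omega
  · obtain ⟨k, hk⟩ : ∃ k, c % 3 = k := ⟨_, rfl⟩
    rw [hk]
    have hk3 : k = 0 ∨ k = 1 ∨ k = 2 := by omega
    -- For k = c mod 3 the value of i solves 3m - 3i - (3m + 1)k = -c.
    refine ⟨if k = 0 then c / 3 + m else if k = 1 then c / 3 else c / 3 - m, k, ?_⟩
    congr 2
    rcases hk3 with rfl | rfl | rfl
    · simp
      omega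
    · simp
      omega
    · simp
      omega

theorem curveMonomial_eq_curveFrame (i : ℕ) {k : ℕ} (hk : k < 3) :
    ∃ c, curveMonomial ρ i k = curveFrame ρ c := by
  have hk3 : k = 0 ∨ k = 1 ∨ k = 2 := by omega
  rcases hk3 with rfl | rfl | rfl
  · by_cases h : i < 2 * m
    · refine ⟨i, ?_⟩
      simp [curveFrame, curveMonomial, h]
    · refine ⟨3 * (i - m), ?_⟩
      have h1 : ¬ 3 * (i - m) < 2 * m := by omega
      have h2 : ¬ 3 * (i - m) < 3 * m := by omega
      simp only [curveFrame, curveMonomial, h1, h2, if_false, Nat.mul_mod_right]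
      congr 2
      push_cast
      omega
  · by_cases h : i < m
    · refine ⟨2 * m + i, ?_⟩
      have h1 : ¬ 2 * m + i < 2 * m := by omega
      have h2 : 2 * m + i < 3 * m := by omega
      simp only [curveFrame, curveMonomial, h1, h2, if_false, if_true, pow_one]
      congr 2
      push_cast
      ring
    · refine ⟨3 * i + 1, ?_⟩
      have h1 : ¬ 3 * i + 1 < 2 * m := by omega
      have h2 : ¬ 3 * i + 1 < 3 * m := by omega
      have h3 : (3 * i + 1) % 3 = 1 := by omega
      simp only [curveFrame, curveMonomial, h1, h2, h3, if_false]
      congr 2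
      push_cast
      ring
  · refine ⟨3 * (i + m) + 2, ?_⟩
    have h1 : ¬ 3 * (i + m) + 2 < 2 * m := by omega
    have h2 : ¬ 3 * (i + m) + 2 < 3 * m := by omega
    have h3 : (3 * (i + m) + 2) % 3 = 2 := by omega
    simp only [curveFrame, curveMonomial, h1, h2, h3, if_false]
    congr 2
    push_cast
    ring

theorem expandPoly_X_one_pow_three : expandPoly ρ (MvPolynomial.X 1) ^ 3 =
    (Polynomial.X * ∏ i, (Polynomial.X - Polynomial.C (ρ i ^ 3))).eval₂ HahnSeries.C
      (expandPoly ρ (MvPolynomial.X 0)) := by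
  have h := expandPoly_curvePoly ρ
  rw [curvePoly, map_sub, map_pow, sub_eq_zero] at h
  rw [h, map_mul, map_prod, Polynomial.eval₂_mul, Polynomial.eval₂_X, Polynomial.eval₂_finsetProd]
  simp only [map_sub, Polynomial.eval₂_sub, Polynomial.eval₂_X, Polynomial.eval₂_C, expandPoly_C]
  rfl

/-- The equation of the curve replaces y³ by a polynomial in x, which lowers the power of y by 3. -/
theorem curveMonomial_mem_span (k i : ℕ) :
    curveMonomial ρ i k ∈ Submodule.span ℂ (Set.range (curveFrame ρ)) := by
  induction k using Nat.strong_induction_on generalizing i with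
  | _ k ih =>
    by_cases hk : k < 3
    · obtain ⟨c, hc⟩ := curveMonomial_eq_curveFrame ρ i hk
      rw [hc]
      exact Submodule.subset_span ⟨c, rfl⟩
    · obtain ⟨k, rfl⟩ := Nat.exists_eq_add_of_le' (not_lt.1 hk)
      have : curveMonomial ρ i (k + 3) = ∑ n ∈ (Polynomial.X * ∏ i, (Polynomial.X -
          Polynomial.C (ρ i ^ 3))).support, (Polynomial.X * ∏ i, (Polynomial.X -
          Polynomial.C (ρ i ^ 3))).coeff n • curveMonomial ρ (i + n) k := by
        simp only [curveMonomial_eq_expandPoly, smul_eq_const_mul]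
        rw [pow_add, map_mul, map_mul, map_pow _ _ 3, expandPoly_X_one_pow_three,
          Polynomial.eval₂_eq_sum, Polynomial.sum, Finset.mul_sum, Finset.mul_sum, Finset.mul_sum]
        refine Finset.sum_congr rfl fun n _ => ?_
        rw [pow_add, map_mul, map_mul, map_pow _ _ n, const]
        ring
      rw [this]
      exact Submodule.sum_mem _ fun n _ => Submodule.smul_mem _ _ (ih k (by omega) _)

theorem span_curveFrame : Submodule.span ℂ (Set.range (curveFrame ρ)) = iotaRange ρ := by
  apply le_antisymm
  · rw [Submodule.span_le]
    rintro _ ⟨c, rfl⟩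
    obtain ⟨i, k, h⟩ := curveFrame_eq_curveMonomial ρ c
    rw [h]
    exact curveMonomial_mem_iotaRange ρ i k
  · intro F hF
    obtain ⟨p, rfl⟩ := (mem_iotaRange ρ).1 hF
    rw [expandPoly, MvPolynomial.coe_eval₂Hom, MvPolynomial.eval₂_eq', Finset.mul_sum]
    refine Submodule.sum_mem _ fun d _ => ?_
    have : zPow (3 * (m : ℤ)) * (HahnSeries.C (MvPolynomial.coeff d p) *
        ∏ i, (![zPow (-3), zPow (-(3 * (m : ℤ)) - 1) * fHat ρ] : Fin 2 → V) i ^ d i) =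
        MvPolynomial.coeff d p • curveMonomial ρ (d 0) (d 1) := by
      rw [smul_eq_const_mul, curveMonomial_eq, Fin.prod_univ_two, const]
      simp only [Matrix.cons_val_zero, Matrix.cons_val_one]
      ring
    rw [this]
    exact Submodule.smul_mem _ _ (curveMonomial_mem_span ρ _ _)

theorem isFrame_curveFrame : IsFrame (iotaRange ρ) (curveFrame ρ) := by
  rw [← span_curveFrame]
  exact isFrame_span ((frameCond_iff _).2 ⟨_, frameCondAt_curveFrame ρ⟩)
    (linearIndependent_curveFrame ρ)

end Curve

/-! ## Continuity in the parameters -/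

theorem continuous_coeff_mul {E : Type*} [TopologicalSpace E] {F G : E → PowerSeries ℂ}
    (hF : ∀ n, Continuous fun t => PowerSeries.coeff n (F t))
    (hG : ∀ n, Continuous fun t => PowerSeries.coeff n (G t)) (n : ℕ) :
    Continuous fun t => PowerSeries.coeff n (F t * G t) := by
  simp only [PowerSeries.coeff_mul]
  exact continuous_finsetSum _ fun p _ => (hF _).mul (hG _)

theorem continuous_coeff_prod {E ι : Type*} [TopologicalSpace E] (s : Finset ι)
    {F : ι → E → PowerSeries ℂ} (hF : ∀ i n, Continuous fun t => PowerSeries.coeff n (F i t))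
    (n : ℕ) : Continuous fun t => PowerSeries.coeff n (∏ i ∈ s, F i t) := by
  classical
  induction s using Finset.induction_on generalizing n with
  | empty => simpa using continuous_const
  | insert a s ha ih =>
    simp only [Finset.prod_insert ha]
    exact continuous_coeff_mul (hF a) ih n

theorem continuous_coeff_cbrtFactor (n : ℕ) :
    Continuous fun c => PowerSeries.coeff n (cbrtFactor c) := by
  simp only [cbrtFactor, PowerSeries.coeff_expand, PowerSeries.coeff_rescale]
  split_ifs <;> fun_prop

theorem continuous_coeff_curveFrame {m : ℕ} (c : ℕ) (n : ℤ) :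
    Continuous fun ρ : Fin 3 × Fin m → ℂ => (curveFrame ρ c).coeff n := by
  simp only [curveFrame_eq, coeff_zPow_mul]
  rcases lt_or_ge (n - curveLead m c) 0 with h | h
  · simp only [coeff_ofPS_of_neg _ h]
    exact continuous_const
  · obtain ⟨k, hk⟩ := Int.eq_ofNat_of_zero_le h
    simp only [hk, coeff_ofPS_natCast]
    have h1 : ∀ n, Continuous fun ρ : Fin 3 × Fin m → ℂ => PowerSeries.coeff n (fHatSeries ρ) :=
      continuous_coeff_prod _ fun i n =>
        (continuous_coeff_cbrtFactor n).comp ((continuous_apply i).pow 3)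
    simpa using continuous_coeff_prod (Finset.range (curvePow m c)) (fun _ => h1) k

/-- The size K works for all ρ at once, so the coefficient is a fixed finite combination of K × K
minors with continuous entries. -/
theorem continuous_coeff_tau_curveFrame {m : ℕ} (α : ℕ+ →₀ ℕ) :
    Continuous fun ρ : Fin 3 × Fin m → ℂ => MvPowerSeries.coeff α (tau (curveFrame ρ)) := by
  set K := max (3 * m) (wt α) with hK
  simp only [coeff_tau_eq_sum _ (le_max_right (3 * m) (wt α)) le_rfl,
    plucker_eq_det ((frameCondAt_curveFrame _).mono (le_max_left (3 * m) (wt α))) _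
      (length_partOfRows_le _)]
  refine continuous_finsetSum _ fun f _ => Continuous.mul (Continuous.matrix_det ?_)
    continuous_const
  exact continuous_matrix fun i j => continuous_coeff_curveFrame _ _

/-! ## Partial fractions -/

section PartialFractions

open Polynomial

variable {m : ℕ} (c : Fin m → ℂ)

/-- The product of the factors `1 - c_l X`, `l ≠ i`. -/
def cofactor (i : Fin m) : ℂ[X] := ∏ l ∈ Finset.univ.erase i, (1 - C (c l) * X)

theorem natDegree_one_sub_C_mul_X_le (a : ℂ) : (1 - C a * X : ℂ[X]).natDegree ≤ 1 := by
  compute_degree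

theorem natDegree_cofactor_le (i : Fin m) : (cofactor c i).natDegree ≤ m - 1 := by
  refine (natDegree_prod_le _ _).trans ((Finset.sum_le_card_nsmul _ _ 1 fun l _ =>
    natDegree_one_sub_C_mul_X_le _).trans ?_)
  simp

theorem eval_cofactor (i : Fin m) (t : ℂ) :
    (cofactor c i).eval t = ∏ l ∈ Finset.univ.erase i, (1 - c l * t) := by
  simp [cofactor, eval_prod]

variable {c}

theorem eval_cofactor_of_ne (hc : ∀ i, c i ≠ 0) {i k : Fin m} (hik : k ≠ i) :
    (cofactor c k).eval (c i)⁻¹ = 0 := by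
  rw [eval_cofactor]
  exact Finset.prod_eq_zero (Finset.mem_erase.2 ⟨hik.symm, Finset.mem_univ i⟩)
    (by rw [mul_inv_cancel₀ (hc i), sub_self])

theorem eval_derivative_prod_one_sub (s : Finset (Fin m)) (t : ℂ)
    (h : ∀ l ∈ s, 1 - c l * t ≠ 0) :
    (derivative (∏ l ∈ s, (1 - C (c l) * X))).eval t =
      -((∏ l ∈ s, (1 - c l * t)) * ∑ l ∈ s, c l / (1 - c l * t)) := by
  classical
  induction s using Finset.induction_on with
  | empty => simp
  | insert a s ha ih =>
    rw [Finset.prod_insert ha, derivative_mul, eval_add, eval_mul, eval_mul,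
      ih fun l hl => h l (Finset.mem_insert_of_mem hl), Finset.prod_insert ha, Finset.sum_insert ha]
    have := h a (Finset.mem_insert_self _ _)
    simp only [derivative_sub, derivative_one, derivative_mul, derivative_C, derivative_X,
      eval_sub, eval_mul, eval_add, eval_one, eval_C, eval_X, eval_zero, eval_prod]
    generalize ∏ l ∈ s, (1 - c l * t) = P
    generalize ∑ l ∈ s, c l / (1 - c l * t) = S
    generalize 1 - c a * t = d at *
    field_simp
    ring

/-- Partial fractions of `X ^ p / ∏ (1 - c_i X)`, cleared of denominators. -/
theorem sum_C_mul_cofactor (hc : ∀ i, c i ≠ 0) (hinj : Function.Injective c) {p : ℕ} (hp : p < m)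
    {s : Fin m → ℂ}
    (hs : ∀ i, s i * ∏ l ∈ Finset.univ.erase i, (1 - c l * (c i)⁻¹) = (c i)⁻¹ ^ p) :
    ∑ i, C (s i) * cofactor c i = X ^ p := by
  rw [← sub_eq_zero]
  -- The difference has degree less than m and vanishes at the m distinct nodes 1/c_i, where only
  -- the i-th cofactor survives.
  refine eq_zero_of_natDegree_lt_card_of_eval_eq_zero _ (f := fun i => (c i)⁻¹)
    (inv_injective.comp hinj) (fun i => ?_) ?_
  · rw [eval_sub, eval_finsetSum, Finset.sum_eq_single i]
    · rw [eval_mul, eval_C, eval_cofactor, hs, eval_pow, eval_X, sub_self]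
    · intro k _ hk
      rw [eval_mul, eval_cofactor_of_ne hc hk, mul_zero]
    · simp
  · rw [Fintype.card_fin]
    refine (natDegree_sub_le_of_le (natDegree_sum_le_of_forall_le (n := m - 1) _ _ fun i _ => ?_)
      (natDegree_X_pow_le p)).trans_lt (max_lt (by omega) hp)
    exact (natDegree_C_mul_le _ _).trans (natDegree_cofactor_le c i)

/-- Partial fractions of `X ^ p / ∏ (1 - c_i X) ^ 2`, cleared of denominators. -/
theorem sum_mul_cofactor_sq (hc : ∀ i, c i ≠ 0) (hinj : Function.Injective c) {p : ℕ}
    (hp : p < 2 * m) {α β : Fin m → ℂ}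
    (hβ : ∀ i, β i * (∏ l ∈ Finset.univ.erase i, (1 - c l * (c i)⁻¹)) ^ 2 = (c i)⁻¹ ^ p)
    (hα : ∀ i, α i = -(p + 2 * ∑ l ∈ Finset.univ.erase i, c l / (c i - c l)) * β i) :
    ∑ i, (C (α i) * (1 - C (c i) * X) + C (β i)) * cofactor c i ^ 2 = X ^ p := by
  set E : ℂ[X] := ∑ i, (C (α i) * (1 - C (c i) * X) + C (β i)) * cofactor c i ^ 2 - X ^ p with hE
  suffices E = 0 from sub_eq_zero.1 this
  by_contra hE0
  have hdeg : E.natDegree < 2 * m := by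
    refine (natDegree_sub_le_of_le (natDegree_sum_le_of_forall_le (n := 2 * m - 1) _ _
      fun i _ => ?_) (natDegree_X_pow_le p)).trans_lt (max_lt (by omega) hp)
    have h1 : (C (α i) * (1 - C (c i) * X) + C (β i)).natDegree ≤ 1 := by compute_degree
    have h2 : (cofactor c i ^ 2).natDegree ≤ 2 * (m - 1) :=
      natDegree_pow_le.trans (Nat.mul_le_mul_left _ (natDegree_cofactor_le c i))
    exact (natDegree_mul_le.trans (Nat.add_le_add h1 h2)).trans (by omega)
  -- Hermite interpolation: E, of degree less than 2m, has a double zero at each of the m nodes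
  -- 1/c_i. The value there determines β_i. With S = ∑ c_l/(c_i - c_l), the logarithmic derivative
  -- of the cofactor at the node is -c_i S, and the vanishing of the derivative becomes α_i = -(p +
  -- 2S)β_i.
  have hdvd : ∀ i, (X - C (c i)⁻¹) ^ 2 ∣ E := by
    intro i
    have hne : ∀ l ∈ Finset.univ.erase i, 1 - c l * (c i)⁻¹ ≠ 0 := by
      intro l hl h0
      rw [sub_eq_zero, eq_comm, mul_inv_eq_one₀ (hc i)] at h0
      exact Finset.ne_of_mem_erase hl (hinj h0)
    have hq := eval_cofactor c i (c i)⁻¹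
    set q := ∏ l ∈ Finset.univ.erase i, (1 - c l * (c i)⁻¹) with hqdef
    have hq' : (derivative (cofactor c i)).eval (c i)⁻¹ =
        -(q * (c i * ∑ l ∈ Finset.univ.erase i, c l / (c i - c l))) := by
      rw [cofactor, eval_derivative_prod_one_sub _ _ hne, ← hqdef]
      congr 2
      rw [Finset.mul_sum]
      refine Finset.sum_congr rfl fun l hl => ?_
      have h1 : c i - c l ≠ 0 := fun h0 =>
        Finset.ne_of_mem_erase hl (hinj (sub_eq_zero.1 h0).symm)
      have h2 := hne l hl
      have h3 := hc i
      rw [mul_div_assoc', div_eq_div_iff h2 h1]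
      field_simp
    set S := ∑ l ∈ Finset.univ.erase i, c l / (c i - c l) with hS
    rw [← le_rootMultiplicity_iff hE0, Nat.succ_le_iff, one_lt_rootMultiplicity_iff_isRoot hE0,
      IsRoot.def, IsRoot.def]
    constructor
    · rw [hE, eval_sub, eval_finsetSum, Finset.sum_eq_single i]
      · simp only [eval_mul, eval_add, eval_sub, eval_C, eval_X, eval_one, eval_pow, hq,
          mul_inv_cancel₀ (hc i), sub_self, mul_zero, zero_add]
        exact sub_eq_zero.2 (hβ i)
      · intro k _ hk
        rw [eval_mul, eval_pow, eval_cofactor_of_ne hc hk, zero_pow two_ne_zero, mul_zero]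
      · simp
    · rw [hE, derivative_sub, eval_sub, derivative_sum, eval_finsetSum, Finset.sum_eq_single i]
      -- For p = 0 the exponent p - 1 is truncated to 0, but the factor p makes both sides vanish.
      · have hpow : (p : ℂ) * (c i)⁻¹ ^ (p - 1) = p * (c i * (c i)⁻¹ ^ p) := by
          rcases p with _ | p
          · simp
          · have := hc i
            rw [Nat.add_sub_cancel, pow_succ]
            field_simp
        simp only [derivative_mul, derivative_pow, derivative_add, derivative_sub, derivative_C,
          derivative_X, derivative_one, eval_mul, eval_add, eval_sub, eval_C, eval_X, eval_one,
          eval_pow, eval_zero, hq, hq', mul_inv_cancel₀ (hc i), sub_self, mul_zero, zero_add,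
          map_natCast, eval_natCast]
        rw [hpow, ← hβ i, hα i, Nat.cast_ofNat]
        ring
      · intro k _ hk
        rw [derivative_mul, eval_add, eval_mul, eval_mul, derivative_pow, eval_mul, eval_mul,
          eval_pow, eval_pow, eval_cofactor_of_ne hc hk]
        simp
      · simp
  have hprod : ∏ i, (X - C (c i)⁻¹) ^ 2 ∣ E := by
    refine Finset.prod_dvd_of_coprime (fun i _ j _ hij => ?_) fun i _ => hdvd i
    exact IsCoprime.pow (isCoprime_X_sub_C_of_isUnit_sub (sub_ne_zero.2 fun h =>
      hij (hinj (inv_injective h))).isUnit)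
  have := natDegree_le_of_dvd hprod hE0
  rw [natDegree_prod_of_monic _ _ fun i _ => (monic_X_sub_C _).pow 2] at this
  simp only [natDegree_pow, natDegree_X_sub_C, mul_one, Finset.sum_const, Finset.card_univ,
    Fintype.card_fin, smul_eq_mul] at this
  omega

end PartialFractions

theorem prod_erase_one_sub {m : ℕ} {c : Fin m → ℂ} (hc : ∀ i, c i ≠ 0) (i : Fin m) :
    ∏ l ∈ Finset.univ.erase i, (1 - c l * (c i)⁻¹) =
      (∏ l ∈ Finset.univ.erase i, (c i - c l)) * (c i)⁻¹ ^ (m - 1) := by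
  have : ∀ l, 1 - c l * (c i)⁻¹ = (c i - c l) * (c i)⁻¹ := fun l => by
    rw [sub_mul, mul_inv_cancel₀ (hc i)]
  simp only [this, Finset.prod_mul_distrib, Finset.prod_const]
  simp

theorem const_mul (a b : ℂ) : const (a * b) = const a * const b := map_mul HahnSeries.C a b

theorem const_add (a b : ℂ) : const (a + b) = const a + const b := map_add HahnSeries.C a b

theorem const_pow (a : ℂ) (n : ℕ) : const (a ^ n) = const a ^ n := map_pow HahnSeries.C a n

theorem const_one : const 1 = 1 := map_one HahnSeries.C

theorem const_zero : const 0 = 0 := map_zero HahnSeries.C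

theorem const_sum {ι : Type*} (s : Finset ι) (a : ι → ℂ) :
    const (∑ i ∈ s, a i) = ∑ i ∈ s, const (a i) := map_sum HahnSeries.C a s

theorem const_three : const 3 = 3 := map_ofNat HahnSeries.C 3

theorem const_nine : const 9 = 9 := map_ofNat HahnSeries.C 9

/-- The factor `1 - c z³`. -/
def cubeFactor (c : ℂ) : V := 1 - const c * zPow 3

theorem cubeFactor_eq (c : ℂ) :
    cubeFactor c = ofPS (1 - PowerSeries.C c * PowerSeries.X ^ 3) := by
  have := zPow_natCast 3
  rw [Nat.cast_ofNat] at this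
  rw [cubeFactor, const_eq_ofPS, this, map_sub, map_mul, map_one]

theorem ofPS_ne_zero {φ : PowerSeries ℂ} (h : PowerSeries.constantCoeff φ ≠ 0) : ofPS φ ≠ 0 := by
  intro h0
  apply h
  rw [← PowerSeries.coeff_zero_eq_constantCoeff_apply, ← coeff_ofPS_natCast, h0]
  rfl

theorem cubeFactor_ne_zero (c : ℂ) : cubeFactor c ≠ 0 := by
  rw [cubeFactor_eq]
  exact ofPS_ne_zero (by simp)

theorem eval₂_cofactor_mul {m : ℕ} (c : Fin m → ℂ) (i : Fin m) :
    (cofactor c i).eval₂ HahnSeries.C (zPow 3) * cubeFactor (c i) = ∏ j, cubeFactor (c j) := by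
  rw [← Finset.prod_erase_mul _ _ (Finset.mem_univ i), cofactor, Polynomial.eval₂_finsetProd]
  simp only [Polynomial.eval₂_sub, Polynomial.eval₂_mul, Polynomial.eval₂_C, Polynomial.eval₂_X,
    Polynomial.eval₂_one]
  rfl

theorem sum_const_div_cubeFactor {m : ℕ} {c : Fin m → ℂ} (hc : ∀ i, c i ≠ 0)
    (hinj : Function.Injective c) {p : ℕ} (hp : p < m) {s : Fin m → ℂ}
    (hs : ∀ i, s i * ∏ l ∈ Finset.univ.erase i, (1 - c l * (c i)⁻¹) = (c i)⁻¹ ^ p) :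
    (∏ j, cubeFactor (c j)) * ∑ i, const (s i) / cubeFactor (c i) = zPow 3 ^ p := by
  have := congrArg (Polynomial.eval₂ HahnSeries.C (zPow 3)) (sum_C_mul_cofactor hc hinj hp hs)
  rw [Polynomial.eval₂_X_pow, Polynomial.eval₂_finsetSum] at this
  rw [← this, Finset.mul_sum]
  refine Finset.sum_congr rfl fun i _ => ?_
  have h0 := cubeFactor_ne_zero (c i)
  rw [← eval₂_cofactor_mul c i, Polynomial.eval₂_mul, Polynomial.eval₂_C, const]
  field_simp

theorem sum_const_div_cubeFactor_sq {m : ℕ} {c : Fin m → ℂ} (hc : ∀ i, c i ≠ 0)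
    (hinj : Function.Injective c) {p : ℕ} (hp : p < 2 * m) {α β : Fin m → ℂ}
    (hβ : ∀ i, β i * (∏ l ∈ Finset.univ.erase i, (1 - c l * (c i)⁻¹)) ^ 2 = (c i)⁻¹ ^ p)
    (hα : ∀ i, α i = -(p + 2 * ∑ l ∈ Finset.univ.erase i, c l / (c i - c l)) * β i) :
    (∏ j, cubeFactor (c j)) ^ 2 * ∑ i, (const (α i) / cubeFactor (c i) +
      const (β i) / cubeFactor (c i) ^ 2) = zPow 3 ^ p := by
  have := congrArg (Polynomial.eval₂ HahnSeries.C (zPow 3)) (sum_mul_cofactor_sq hc hinj hp hβ hα)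
  rw [Polynomial.eval₂_X_pow, Polynomial.eval₂_finsetSum] at this
  rw [← this, Finset.mul_sum]
  refine Finset.sum_congr rfl fun i _ => ?_
  have h0 := cubeFactor_ne_zero (c i)
  have h1 : (1 - const (c i) * zPow 3 : V) = cubeFactor (c i) := rfl
  rw [← eval₂_cofactor_mul c i]
  simp only [Polynomial.eval₂_mul, Polynomial.eval₂_C, Polynomial.eval₂_pow, Polynomial.eval₂_add,
    Polynomial.eval₂_sub, Polynomial.eval₂_one, Polynomial.eval₂_X]
  rw [← const, ← const, ← const, h1]
  field_simp

/-! ## Sums over the cube roots of unity -/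

theorem isPrimitiveRoot_omega : IsPrimitiveRoot omega 3 := by
  simpa [omega] using Complex.isPrimitiveRoot_exp 3 (by norm_num)

theorem omega_pow_three : omega ^ 3 = 1 := isPrimitiveRoot_omega.pow_eq_one

theorem omega_ne_zero : omega ≠ 0 := isPrimitiveRoot_omega.ne_zero (by norm_num)

theorem omega_sq_add : omega ^ 2 + omega + 1 = 0 := by
  have := isPrimitiveRoot_omega.geom_sum_eq_zero (by norm_num)
  simp only [Finset.sum_range_succ, Finset.sum_range_zero, pow_zero, pow_one, zero_add] at this
  linear_combination this

section CubeRoots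

variable {F : Type*} [Field F] {w a : F}

theorem prod_one_sub_cubeRoot (hw : w ^ 2 + w + 1 = 0) :
    (1 - a) * (1 - w * a) * (1 - w ^ 2 * a) = 1 - a ^ 3 := by
  grind

/-- In the expansion in powers of a, the weights w^{-k} keep the exponents congruent to 1 mod 3,
each with the factor 3. -/
theorem sum_cubeRoot_inv_one (hw : w ^ 2 + w + 1 = 0) (h0 : 1 - a ≠ 0) (h1 : 1 - w * a ≠ 0)
    (h2 : 1 - w ^ 2 * a ≠ 0) :
    (1 - a)⁻¹ + w ^ 2 * (1 - w * a)⁻¹ + w * (1 - w ^ 2 * a)⁻¹ = 3 * a / (1 - a ^ 3) := by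
  rw [← prod_one_sub_cubeRoot hw, eq_div_iff (mul_ne_zero (mul_ne_zero h0 h1) h2)]
  generalize e0 : 1 - a = u0 at *
  generalize e1 : 1 - w * a = u1 at *
  generalize e2 : 1 - w ^ 2 * a = u2 at *
  field_simp
  subst e0 e1 e2
  clear h0 h1 h2
  grind

/-- The weights w^k keep the exponents congruent to 2 mod 3. -/
theorem sum_cubeRoot_inv_two (hw : w ^ 2 + w + 1 = 0) (h0 : 1 - a ≠ 0) (h1 : 1 - w * a ≠ 0)
    (h2 : 1 - w ^ 2 * a ≠ 0) :
    (1 - a)⁻¹ + w * (1 - w * a)⁻¹ + w ^ 2 * (1 - w ^ 2 * a)⁻¹ = 3 * a ^ 2 / (1 - a ^ 3) := by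
  rw [← prod_one_sub_cubeRoot hw, eq_div_iff (mul_ne_zero (mul_ne_zero h0 h1) h2)]
  generalize e0 : 1 - a = u0 at *
  generalize e1 : 1 - w * a = u1 at *
  generalize e2 : 1 - w ^ 2 * a = u2 at *
  field_simp
  subst e0 e1 e2
  clear h0 h1 h2
  grind

/-- From 1/(1 - a)² = ∑ (n + 1)a^n the weights w^k keep n = 3q + 2, with coefficient 3(3q + 3) = 9(q
+ 1). -/
theorem sum_cubeRoot_inv_sq (hw : w ^ 2 + w + 1 = 0) (h0 : 1 - a ≠ 0) (h1 : 1 - w * a ≠ 0)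
    (h2 : 1 - w ^ 2 * a ≠ 0) :
    ((1 - a) ^ 2)⁻¹ + w * ((1 - w * a) ^ 2)⁻¹ + w ^ 2 * ((1 - w ^ 2 * a) ^ 2)⁻¹ =
      9 * a ^ 2 / (1 - a ^ 3) ^ 2 := by
  rw [← prod_one_sub_cubeRoot hw, eq_div_iff (pow_ne_zero 2 (mul_ne_zero (mul_ne_zero h0 h1) h2))]
  generalize e0 : 1 - a = u0 at *
  generalize e1 : 1 - w * a = u1 at *
  generalize e2 : 1 - w ^ 2 * a = u2 at *
  field_simp
  subst e0 e1 e2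
  clear h0 h1 h2
  grind

end CubeRoots

/-! ## The explicit frame -/

section SolFrame

variable {m : ℕ} (lam : Fin m → ℂ)

theorem fSing_eq : fSing lam = ∏ j, cubeFactor (lam j ^ 3) := rfl

theorem const_omega_sq_add : const omega ^ 2 + const omega + 1 = 0 := by
  rw [← const_pow, ← const_one, ← const_add, ← const_add, omega_sq_add, const_zero]

theorem omega_zpow_neg_one : omega ^ (-1 : ℤ) = omega ^ 2 := by
  rw [zpow_neg_one]
  exact inv_eq_of_mul_eq_one_right (by rw [← omega_pow_three]; ring)

theorem omega_zpow_neg_two : omega ^ (-2 : ℤ) = omega := by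
  rw [show (-2 : ℤ) = -1 + -1 by norm_num, zpow_add₀ omega_ne_zero, omega_zpow_neg_one]
  linear_combination omega * omega_pow_three

theorem omega_zpow_neg_four : omega ^ (-4 : ℤ) = omega ^ 2 := by
  rw [show (-4 : ℤ) = -2 + -2 by norm_num, zpow_add₀ omega_ne_zero, omega_zpow_neg_two]
  ring

theorem one_sub_lamExt (k : Fin 3) (i : Fin m) : 1 - const (lamExt lam (k, i)) * zPow 1 =
    1 - const omega ^ (k : ℕ) * (const (lam i) * zPow 1) := by
  simp only [lamExt, const_mul, const_pow, mul_assoc]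

theorem cubeFactor_lam_pow (i : Fin m) :
    cubeFactor (lam i ^ 3) = 1 - (const (lam i) * zPow 1) ^ 3 := by
  rw [cubeFactor, mul_pow, zPow_pow, const_pow]
  norm_num

theorem one_sub_cubeRoot_ne_zero (k : ℕ) (hk : k < 3) (i : Fin m) :
    1 - const omega ^ k * (const (lam i) * zPow 1) ≠ 0 := by
  rw [← one_sub_lamExt lam ⟨k, hk⟩]
  exact one_sub_const_mul_zPow_ne_zero _

theorem one_sub_ne_zero_zero (i : Fin m) : 1 - const (lam i) * zPow 1 ≠ 0 := by
  simpa using one_sub_cubeRoot_ne_zero lam 0 (by norm_num) i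

theorem one_sub_ne_zero_one (i : Fin m) : 1 - const omega * (const (lam i) * zPow 1) ≠ 0 := by
  simpa using one_sub_cubeRoot_ne_zero lam 1 (by norm_num) i

theorem solFun_zero_eq (j : Fin m) : solFun lam 0 j = zPow (-(3 * (m : ℤ)) + 3) *
    ∑ i, (const (3 * aCoeff lam 0 (0, i) j * lam i ^ 2) / cubeFactor (lam i ^ 3) +
      const (9 * bCoeff lam 0 (0, i) j * lam i ^ 2) / cubeFactor (lam i ^ 3) ^ 2) := by
  have hz : zPow (-(3 * (m : ℤ)) + 3) = zPow (-(3 * (m : ℤ)) + 1) * zPow 1 ^ 2 := by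
    rw [zPow_pow, zPow_mul_zPow]
    congr 1
    norm_num
    ring
  rw [solFun, Fintype.sum_prod_type_right, hz, mul_assoc]
  congr 1
  rw [Finset.mul_sum]
  refine Finset.sum_congr rfl fun i _ => ?_
  have ha : ∀ k : Fin 3, aCoeff lam 0 (k, i) j = omega ^ (k : ℕ) * aCoeff lam 0 (0, i) j := by
    intro k
    simp [aCoeff]
  have hb : ∀ k : Fin 3, bCoeff lam 0 (k, i) j = omega ^ (k : ℕ) * bCoeff lam 0 (0, i) j := by
    intro k
    simp [bCoeff]
  simp only [Fin.sum_univ_three, one_sub_lamExt]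
  rw [ha 1, ha 2, hb 1, hb 2]
  generalize aCoeff lam 0 (0, i) j = A
  generalize bCoeff lam 0 (0, i) j = B
  simp only [const_mul, const_pow, const_three, const_nine, Fin.val_zero, Fin.val_one,
    Fin.val_two, pow_zero, pow_one, one_mul, cubeFactor_lam_pow]
  have h1 := sum_cubeRoot_inv_two const_omega_sq_add (one_sub_ne_zero_zero lam i)
    (one_sub_ne_zero_one lam i) (one_sub_cubeRoot_ne_zero lam 2 (by norm_num) i)
  have h2 := sum_cubeRoot_inv_sq const_omega_sq_add (one_sub_ne_zero_zero lam i)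
    (one_sub_ne_zero_one lam i) (one_sub_cubeRoot_ne_zero lam 2 (by norm_num) i)
  linear_combination const A * h1 + const B * h2

theorem solFun_one_eq (j : Fin m) : solFun lam 1 j = zPow (-(3 * (m : ℤ)) + 2) *
    ∑ i, const (3 * aCoeff lam 1 (0, i) j * lam i) / cubeFactor (lam i ^ 3) := by
  have hz : zPow (-(3 * (m : ℤ)) + 2) = zPow (-(3 * (m : ℤ)) + 1) * zPow 1 := by
    rw [zPow_mul_zPow]
    congr 1
    ring
  rw [solFun, Fintype.sum_prod_type_right, hz, mul_assoc]
  congr 1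
  rw [Finset.mul_sum]
  refine Finset.sum_congr rfl fun i _ => ?_
  have ha : ∀ k : Fin 3, aCoeff lam 1 (k, i) j =
      omega ^ (-(k : ℤ)) * aCoeff lam 1 (0, i) j := by
    intro k
    simp [aCoeff]
  have hb : ∀ k : Fin 3, bCoeff lam 1 (k, i) j = 0 := by
    intro k
    simp [bCoeff]
  simp only [Fin.sum_univ_three, one_sub_lamExt, hb]
  rw [ha 1, ha 2]
  generalize aCoeff lam 1 (0, i) j = A
  have e1 : -(((1 : Fin 3) : ℕ) : ℤ) = -1 := rfl
  have e2 : -(((2 : Fin 3) : ℕ) : ℤ) = -2 := rfl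
  simp only [e1, e2, omega_zpow_neg_one, omega_zpow_neg_two]
  simp only [const_mul, const_pow, const_three, const_zero, Fin.val_zero, Fin.val_one,
    Fin.val_two, pow_zero, pow_one, one_mul, zero_mul, add_zero, cubeFactor_lam_pow]
  have h1 := sum_cubeRoot_inv_one const_omega_sq_add (one_sub_ne_zero_zero lam i)
    (one_sub_ne_zero_one lam i) (one_sub_cubeRoot_ne_zero lam 2 (by norm_num) i)
  linear_combination const A * h1

theorem solFun_two_eq (j : Fin m) : solFun lam 2 j = zPow (-(3 * (m : ℤ)) + 3) *
    ∑ i, const (3 * aCoeff lam 2 (0, i) j * lam i ^ 2) / cubeFactor (lam i ^ 3) := by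
  have hz : zPow (-(3 * (m : ℤ)) + 3) = zPow (-(3 * (m : ℤ)) + 1) * zPow 1 ^ 2 := by
    rw [zPow_pow, zPow_mul_zPow]
    congr 1
    norm_num
    ring
  rw [solFun, Fintype.sum_prod_type_right, hz, mul_assoc]
  congr 1
  rw [Finset.mul_sum]
  refine Finset.sum_congr rfl fun i _ => ?_
  have ha : ∀ k : Fin 3, aCoeff lam 2 (k, i) j =
      omega ^ (-(2 * (k : ℤ))) * aCoeff lam 2 (0, i) j := by
    intro k
    simp [aCoeff]
  have hb : ∀ k : Fin 3, bCoeff lam 2 (k, i) j = 0 := by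
    intro k
    simp [bCoeff]
  simp only [Fin.sum_univ_three, one_sub_lamExt, hb]
  rw [ha 1, ha 2]
  generalize aCoeff lam 2 (0, i) j = A
  have e1 : -(2 * (((1 : Fin 3) : ℕ) : ℤ)) = -2 := rfl
  have e2 : -(2 * (((2 : Fin 3) : ℕ) : ℤ)) = -4 := rfl
  simp only [e1, e2, omega_zpow_neg_four, omega_zpow_neg_two]
  simp only [const_mul, const_pow, const_three, const_zero, Fin.val_zero, Fin.val_one,
    Fin.val_two, pow_zero, pow_one, one_mul, zero_mul, add_zero, cubeFactor_lam_pow]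
  have h1 := sum_cubeRoot_inv_two const_omega_sq_add (one_sub_ne_zero_zero lam i)
    (one_sub_ne_zero_one lam i) (one_sub_cubeRoot_ne_zero lam 2 (by norm_num) i)
  linear_combination const A * h1

variable {lam}

theorem diffProd_ne_zero (hinj : Function.Injective fun j => lam j ^ 3) (i : Fin m) :
    diffProd lam i ≠ 0 :=
  Finset.prod_ne_zero_iff.2 fun _ hl => sub_ne_zero.2 fun h =>
    Finset.ne_of_mem_erase hl (hinj h).symm

/-- With c_i = λ_i³ the product over l equals `diffProd` times c_i^{-(m-1)}. A residue c_i^j /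
`diffProd` therefore belongs to the monomial X^{m-1-j}. -/
theorem residue_mul_prod (hlam : ∀ j, lam j ≠ 0) (hinj : Function.Injective fun j => lam j ^ 3)
    (i j : Fin m) {s : ℂ} (hs : s = lam i ^ (3 * (j : ℕ)) / diffProd lam i) :
    s * ∏ l ∈ Finset.univ.erase i, (1 - lam l ^ 3 * (lam i ^ 3)⁻¹) =
      (lam i ^ 3)⁻¹ ^ (m - 1 - j : ℕ) := by
  rw [prod_erase_one_sub (c := fun j => lam j ^ 3) (fun i => pow_ne_zero 3 (hlam i)), ← diffProd,
    hs]
  have hD := diffProd_ne_zero hinj i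
  have hl := hlam i
  obtain ⟨k, hk⟩ : ∃ k, m - 1 - (j : ℕ) = k := ⟨_, rfl⟩
  have hm : m - 1 = j + k := by have := j.2; omega
  have hu : lam i ^ 3 ≠ 0 := pow_ne_zero 3 hl
  rw [hk, hm, pow_mul]
  generalize lam i ^ 3 = u at *
  simp only [inv_pow, pow_add]
  field_simp

theorem fSing_mul_solFun_one (hlam : ∀ j, lam j ≠ 0)
    (hinj : Function.Injective fun j => lam j ^ 3) (j : Fin m) :
    fSing lam * solFun lam 1 j = zPow (-1 - 3 * (j : ℕ)) := by
  rw [solFun_one_eq, mul_left_comm, fSing_eq, sum_const_div_cubeFactor (p := m - 1 - j)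
    (fun i => pow_ne_zero 3 (hlam i)) hinj (by have := j.2; omega), zPow_pow, zPow_mul_zPow]
  · congr 1
    have := j.2
    omega
  · intro i
    refine residue_mul_prod hlam hinj i j ?_
    have hD := diffProd_ne_zero hinj i
    have hl := hlam i
    have e : lam i ^ (3 * ((j : ℤ) + 1) - 3 - 1) * lam i = lam i ^ (3 * (j : ℕ)) := by
      rw [← zpow_add_one₀ hl, ← zpow_natCast]
      congr 1
      push_cast
      ring
    simp only [aCoeff, one_ne_zero, if_false, Fin.val_zero, Fin.val_one, Nat.cast_zero, mul_zero,
      neg_zero, zpow_zero, one_mul, Nat.cast_one]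
    rw [← e]
    field_simp

theorem fSing_mul_solFun_two (hlam : ∀ j, lam j ≠ 0)
    (hinj : Function.Injective fun j => lam j ^ 3) (j : Fin m) :
    fSing lam * solFun lam 2 j = zPow (-(3 * (j : ℕ))) := by
  rw [solFun_two_eq, mul_left_comm, fSing_eq, sum_const_div_cubeFactor (p := m - 1 - j)
    (fun i => pow_ne_zero 3 (hlam i)) hinj (by have := j.2; omega), zPow_pow, zPow_mul_zPow]
  · congr 1
    have := j.2
    omega
  · intro i
    refine residue_mul_prod hlam hinj i j ?_
    have hD := diffProd_ne_zero hinj i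
    have hl := hlam i
    have e : lam i ^ (3 * ((j : ℤ) + 1) - 3 - 2) * lam i ^ 2 = lam i ^ (3 * (j : ℕ)) := by
      rw [← zpow_natCast (lam i) 2, ← zpow_add₀ hl, ← zpow_natCast]
      congr 1
      push_cast
      ring
    have h2 : (2 : Fin 3) ≠ 0 := by decide
    simp only [aCoeff, h2, if_false, Fin.val_zero, Fin.val_two, Nat.cast_zero, mul_zero,
      neg_zero, zpow_zero, one_mul, Nat.cast_ofNat]
    rw [← e]
    field_simp

/-- The coefficients a^{(0)}, b^{(0)} are the double-pole partial fraction coefficients of X^p/∏(1 -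
c_i X)² with p = 2m - 1 - j and X = z³, up to the factors 3λ_i² and 9λ_i² from the cube root sums.
-/
theorem fSing_sq_mul_solFun_zero (hlam : ∀ j, lam j ≠ 0)
    (hinj : Function.Injective fun j => lam j ^ 3) (j : Fin m) :
    fSing lam ^ 2 * solFun lam 0 j = zPow (3 * (m : ℤ) - 3 * (j : ℕ)) := by
  have hj := j.2
  rw [solFun_zero_eq, mul_left_comm, fSing_eq, sum_const_div_cubeFactor_sq (p := 2 * m - 1 - j)
    (fun i => pow_ne_zero 3 (hlam i)) hinj (by omega), zPow_pow, zPow_mul_zPow]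
  · congr 1
    omega
  · intro i
    rw [prod_erase_one_sub (c := fun j => lam j ^ 3) (fun i => pow_ne_zero 3 (hlam i)),
      ← diffProd]
    have hD := diffProd_ne_zero hinj i
    have hl := hlam i
    have e : lam i ^ (3 * ((j : ℤ) + 1) - 8) * lam i ^ 2 = lam i ^ (3 * (j : ℕ)) * (lam i ^ 3)⁻¹ := by
      rw [← zpow_natCast (lam i) 2, ← zpow_add₀ hl, ← zpow_natCast, ← zpow_natCast, ← zpow_neg,
        ← zpow_add₀ hl]
      congr 1
      push_cast
      ring
    simp only [bCoeff, if_true, Fin.val_zero, pow_zero, one_mul]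
    obtain ⟨k, hk⟩ : ∃ k, m - 1 - (j : ℕ) = k := ⟨_, rfl⟩
    have hm : m - 1 = j + k := by omega
    have hm' : 2 * m - 1 - (j : ℕ) = j + 2 * k + 1 := by omega
    rw [hm, hm']
    have e' : 9 * (lam i ^ (3 * ((j : ℤ) + 1) - 8) / (9 * diffProd lam i ^ 2)) * lam i ^ 2 =
        lam i ^ (3 * (j : ℕ)) * (lam i ^ 3)⁻¹ / diffProd lam i ^ 2 := by
      rw [← e]
      field_simp
    have hu : lam i ^ 3 ≠ 0 := pow_ne_zero 3 hl
    rw [e', pow_mul]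
    generalize lam i ^ 3 = u at *
    simp only [inv_pow, pow_add, pow_mul, pow_one, mul_pow]
    field_simp
    ring_nf
  · intro i
    -- As j counts from 0, this p is the term 2m - j of a^{(0)} written with labels from 1.
    have hc : ((2 * m - 1 - (j : ℕ) : ℕ) : ℂ) = 2 * m - (j + 1) := by
      rw [Nat.cast_sub (by omega), Nat.cast_sub (by omega)]
      push_cast
      ring
    simp only [aCoeff, bCoeff, if_true, Fin.val_zero, pow_zero, one_mul, hc]
    ring

/-! ### Leading terms and span of the explicit functions -/

variable (lam)

/-- The power series `f(z)`. -/
def fSeries : PowerSeries ℂ := ∏ j, (1 - PowerSeries.C (lam j ^ 3) * PowerSeries.X ^ 3)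

theorem fSing_eq_ofPS : fSing lam = ofPS (fSeries lam) := by
  rw [fSing_eq, fSeries, map_prod]
  simp only [cubeFactor_eq]

theorem constantCoeff_fSeries : PowerSeries.constantCoeff (fSeries lam) = 1 := by
  rw [fSeries, map_prod]
  exact Finset.prod_eq_one fun i _ => by simp

theorem fSeries_mul_inv : fSeries lam * (fSeries lam)⁻¹ = 1 :=
  PowerSeries.mul_inv_cancel _ (by rw [constantCoeff_fSeries]; exact one_ne_zero)

theorem constantCoeff_fSeries_inv : PowerSeries.constantCoeff (fSeries lam)⁻¹ = 1 := by
  rw [PowerSeries.constantCoeff_inv, constantCoeff_fSeries, inv_one]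

theorem fSing_inv : (fSing lam)⁻¹ = ofPS (fSeries lam)⁻¹ := by
  refine inv_eq_of_mul_eq_one_right ?_
  rw [fSing_eq_ofPS, ← map_mul, fSeries_mul_inv, map_one]

theorem fSing_ne_zero : fSing lam ≠ 0 := by
  rw [fSing_eq_ofPS]
  exact ofPS_ne_zero (by rw [constantCoeff_fSeries]; exact one_ne_zero)

/-- Each λ_j occurs three times among the parameters, and the cube of the cube root is 1 - λ_j³z³.
-/
theorem fHat_degenerate : fHat (degenerate lam) = fSing lam := by
  rw [fSing_eq_ofPS, fHat_eq, fHatSeries, fSeries, Fintype.prod_prod_type_right]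
  congr 1
  refine Finset.prod_congr rfl fun j _ => ?_
  simp [degenerate, cbrtFactor_pow]

/-- The leading exponents of the functions `solFun lam r j`. -/
def solFunLead (t : Fin 3 × Fin m) : ℤ :=
  if t.1 = 0 then 3 * (m : ℤ) - 3 * (t.2 : ℕ)
  else if t.1 = 1 then -1 - 3 * (t.2 : ℕ) else -(3 * (t.2 : ℕ))

variable {lam}

theorem exists_solFun_eq (hlam : ∀ j, lam j ≠ 0) (hinj : Function.Injective fun j => lam j ^ 3)
    (t : Fin 3 × Fin m) : ∃ φ : PowerSeries ℂ, PowerSeries.constantCoeff φ = 1 ∧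
      solFun lam t.1 t.2 = zPow (solFunLead t) * ofPS φ := by
  obtain ⟨r, j⟩ := t
  have h0 := fSing_ne_zero lam
  have h1 : PowerSeries.constantCoeff (fSeries lam)⁻¹ = 1 := constantCoeff_fSeries_inv lam
  fin_cases r
  · refine ⟨(fSeries lam)⁻¹ ^ 2, by rw [map_pow, h1, one_pow], ?_⟩
    change solFun lam 0 j = zPow (3 * (m : ℤ) - 3 * (j : ℕ)) * _
    rw [map_pow, ← fSing_inv, ← fSing_sq_mul_solFun_zero hlam hinj j]
    field_simp
  · refine ⟨(fSeries lam)⁻¹, h1, ?_⟩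
    change solFun lam 1 j = zPow (-1 - 3 * (j : ℕ)) * _
    rw [← fSing_inv, ← fSing_mul_solFun_one hlam hinj j]
    field_simp
  · refine ⟨(fSeries lam)⁻¹, h1, ?_⟩
    change solFun lam 2 j = zPow (-(3 * (j : ℕ))) * _
    rw [← fSing_inv, ← fSing_mul_solFun_two hlam hinj j]
    field_simp

/-- The leading exponents of the columns of the explicit frame. -/
def solLead (m c : ℕ) : ℤ :=
  if h : c < 3 * m then solFunLead (finProdFinEquiv.symm (Fin.rev ⟨c, h⟩) : Fin 3 × Fin m)
  else -(c : ℤ)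

/-- The exponents for r = 0 are positive multiples of 3, those for r = 2 are nonpositive ones, and
those for r = 1 are congruent to -1 mod 3. -/
theorem solFunLead_injective : Function.Injective (solFunLead : Fin 3 × Fin m → ℤ) := by
  rintro ⟨r, j⟩ ⟨r', j'⟩ h
  have hj := j.2
  have hj' := j'.2
  fin_cases r <;> fin_cases r' <;> simp [solFunLead] at h <;> first
    | omega
    | (refine Prod.ext rfl (Fin.ext ?_); simp only; omega)

theorem lt_solFunLead (t : Fin 3 × Fin m) : -(3 * (m : ℤ)) < solFunLead t := by
  have := t.2.2
  unfold solFunLead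
  split_ifs <;> omega

theorem solLead_injective : Function.Injective (solLead m) := by
  intro a b h
  unfold solLead at h
  split_ifs at h with ha hb hb
  · have := Fin.rev_injective (finProdFinEquiv.symm.injective (solFunLead_injective h))
    simpa using this
  · have := lt_solFunLead (finProdFinEquiv.symm (Fin.rev ⟨a, ha⟩) : Fin 3 × Fin m)
    omega
  · have := lt_solFunLead (finProdFinEquiv.symm (Fin.rev ⟨b, hb⟩) : Fin 3 × Fin m)
    omega
  · omega

theorem exists_solFrame_eq (hlam : ∀ j, lam j ≠ 0) (hinj : Function.Injective fun j => lam j ^ 3)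
    (c : ℕ) : ∃ φ : PowerSeries ℂ, PowerSeries.constantCoeff φ = 1 ∧
      solFrame lam c = zPow (solLead m c) * ofPS φ := by
  unfold solFrame solLead
  split_ifs with h
  · exact exists_solFun_eq hlam hinj _
  · exact ⟨1, map_one _, by rw [map_one, mul_one]⟩

theorem coeff_solFrame_lead (hlam : ∀ j, lam j ≠ 0)
    (hinj : Function.Injective fun j => lam j ^ 3) (c : ℕ) :
    (solFrame lam c).coeff (solLead m c) = 1 := by
  obtain ⟨φ, h1, h2⟩ := exists_solFrame_eq hlam hinj c
  rw [h2, coeff_zPow_mul_ofPS_self, h1]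

theorem coeff_solFrame_of_lt (hlam : ∀ j, lam j ≠ 0)
    (hinj : Function.Injective fun j => lam j ^ 3) (c : ℕ) (n : ℤ) (hn : n < solLead m c) :
    (solFrame lam c).coeff n = 0 := by
  obtain ⟨φ, h1, h2⟩ := exists_solFrame_eq hlam hinj c
  rw [h2, coeff_zPow_mul_ofPS_of_lt _ _ hn]

theorem frameCondAt_solFrame (hlam : ∀ j, lam j ≠ 0)
    (hinj : Function.Injective fun j => lam j ^ 3) : FrameCondAt (solFrame lam) (3 * m) := by
  refine frameCondAt_of_leading (coeff_solFrame_lead hlam hinj) (coeff_solFrame_of_lt hlam hinj)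
    (fun j hj => dif_neg (not_lt.2 hj)) fun j hj => ?_
  rw [solLead, dif_pos hj]
  exact_mod_cast lt_solFunLead _

theorem linearIndependent_solFrame (hlam : ∀ j, lam j ≠ 0)
    (hinj : Function.Injective fun j => lam j ^ 3) : LinearIndependent ℂ (solFrame lam) :=
  linearIndependent_of_leading solLead_injective
    (fun c => by rw [coeff_solFrame_lead hlam hinj]; exact one_ne_zero)
    (coeff_solFrame_of_lt hlam hinj)

/-- So f is the image under ι of Q = ∏(x - λ_j³), which makes multiples of f into images of
polynomials. -/
theorem expandPoly_prod (ρ : Fin 3 × Fin m → ℂ) : fSing lam = zPow (3 * (m : ℤ)) * expandPoly ρ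
    (∏ j, (MvPolynomial.X 0 - MvPolynomial.C (lam j ^ 3))) := by
  have h : zPow (3 * (m : ℤ)) = ∏ _j : Fin m, zPow 3 := by
    rw [Finset.prod_const, zPow_pow, Finset.card_univ, Fintype.card_fin, mul_comm]
  rw [map_prod, h, ← Finset.prod_mul_distrib, fSing_eq]
  refine Finset.prod_congr rfl fun j _ => ?_
  rw [map_sub, expandPoly_X_zero, expandPoly_C, mul_sub, zPow_mul_zPow, cubeFactor, mul_comm]
  rfl

theorem zPow_mul_expandPoly_mem (ρ : Fin 3 × Fin m → ℂ) (p : MvPolynomial (Fin 2) ℂ) :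
    zPow (3 * (m : ℤ)) * expandPoly ρ p ∈ iotaRange ρ := (mem_iotaRange ρ).2 ⟨p, rfl⟩

/-- For r = 0, 1, 2 the products are the images of x^j, x^j y and x^j Q. -/
theorem fSing_sq_mul_solFun_mem (hlam : ∀ j, lam j ≠ 0)
    (hinj : Function.Injective fun j => lam j ^ 3) (t : Fin 3 × Fin m) :
    fSing lam ^ 2 * solFun lam t.1 t.2 ∈ iotaRange (degenerate lam) := by
  obtain ⟨r, j⟩ := t
  fin_cases r
  · change fSing lam ^ 2 * solFun lam 0 j ∈ _
    rw [fSing_sq_mul_solFun_zero hlam hinj]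
    convert curveMonomial_mem_iotaRange (degenerate lam) j 0 using 1
    simp [curveMonomial]
  · change fSing lam ^ 2 * solFun lam 1 j ∈ _
    rw [pow_two, mul_assoc, fSing_mul_solFun_one hlam hinj, ← fHat_degenerate]
    convert curveMonomial_mem_iotaRange (degenerate lam) j 1 using 1
    rw [curveMonomial, pow_one, mul_comm]
    congr 2
    push_cast
    ring
  · change fSing lam ^ 2 * solFun lam 2 j ∈ _
    rw [pow_two, mul_assoc, fSing_mul_solFun_two hlam hinj, expandPoly_prod (degenerate lam)]
    convert zPow_mul_expandPoly_mem (degenerate lam) (MvPolynomial.X 0 ^ (j : ℕ) *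
      ∏ j, (MvPolynomial.X 0 - MvPolynomial.C (lam j ^ 3))) using 1
    rw [map_mul, map_pow, expandPoly_X_zero, zPow_pow, mul_neg, mul_comm 3]
    ring_nf

/-- With c = 3m + 3i + k the product is the image of x^i Q², x^i Q y or x^i y², for k = 0, 1, 2. -/
theorem fSing_sq_mul_zPow_mem {c : ℕ} (hc : 3 * m ≤ c) :
    fSing lam ^ 2 * zPow (-(c : ℤ)) ∈ iotaRange (degenerate lam) := by
  obtain ⟨i, k, hk, rfl⟩ : ∃ i k, k < 3 ∧ c = 3 * m + 3 * i + k :=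
    ⟨(c - 3 * m) / 3, (c - 3 * m) % 3, Nat.mod_lt _ (by norm_num), by omega⟩
  set Q : MvPolynomial (Fin 2) ℂ := ∏ j, (MvPolynomial.X 0 - MvPolynomial.C (lam j ^ 3)) with hQ
  have hF : fSing lam = zPow (3 * (m : ℤ)) * expandPoly (degenerate lam) Q :=
    expandPoly_prod (degenerate lam)
  have hy : expandPoly (degenerate lam) (MvPolynomial.X 1) =
      zPow (-(3 * (m : ℤ)) - 1) * fSing lam := by rw [expandPoly_X_one, fHat_degenerate]
  have hx : expandPoly (degenerate lam) (MvPolynomial.X 0 ^ i) = zPow (-(3 * (i : ℤ))) := by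
    rw [map_pow, expandPoly_X_zero, zPow_pow]
    congr 1
    ring
  have hk3 : k = 0 ∨ k = 1 ∨ k = 2 := by omega
  rcases hk3 with rfl | rfl | rfl
  · convert zPow_mul_expandPoly_mem (degenerate lam) (MvPolynomial.X 0 ^ i * Q ^ 2) using 1
    rw [map_mul, map_pow _ Q, hx, hF]
    have e : zPow (-((3 * m + 3 * i + 0 : ℕ) : ℤ)) * zPow (3 * (m : ℤ)) = zPow (-(3 * (i : ℤ))) := by
      rw [zPow_mul_zPow]
      congr 1
      push_cast
      ring
    rw [← e]
    ring
  · convert zPow_mul_expandPoly_mem (degenerate lam) (MvPolynomial.X 0 ^ i * Q * MvPolynomial.X 1)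
      using 1
    rw [map_mul, map_mul, hx, hy, mul_mul_mul_comm, mul_left_comm, pow_two]
    nth_rewrite 1 [hF]
    have e : zPow (-((3 * m + 3 * i + 1 : ℕ) : ℤ)) =
        zPow (-(3 * (i : ℤ))) * zPow (-(3 * (m : ℤ)) - 1) := by
      rw [zPow_mul_zPow]
      congr 1
      push_cast
      ring
    rw [e]
    ring
  · convert curveMonomial_mem_iotaRange (degenerate lam) i 2 using 1
    rw [curveMonomial, fHat_degenerate, mul_comm]
    congr 2
    push_cast
    ring

theorem fSing_sq_mul_solFrame_mem (hlam : ∀ j, lam j ≠ 0)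
    (hinj : Function.Injective fun j => lam j ^ 3) (c : ℕ) :
    fSing lam ^ 2 * solFrame lam c ∈ iotaRange (degenerate lam) := by
  unfold solFrame
  split_ifs with h
  · exact fSing_sq_mul_solFun_mem hlam hinj _
  · exact fSing_sq_mul_zPow_mem (not_lt.1 h)

/-- Only one inclusion of the span is checked by hand; the other follows because both spaces are
points of the Grassmannian. -/
theorem isFrame_solFrame (hlam : ∀ j, lam j ≠ 0) (hinj : Function.Injective fun j => lam j ^ 3) :
    IsFrame ((iotaRange (degenerate lam)).map (mulBy (fSing lam ^ 2)⁻¹)) (solFrame lam) := by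
  have h1 := isFrame_span ((frameCond_iff _).2 ⟨_, frameCondAt_solFrame hlam hinj⟩)
    (linearIndependent_solFrame hlam hinj)
  have h2 := (isFrame_curveFrame (degenerate lam)).ofPS_mul (φ := (fSeries lam)⁻¹ ^ 2)
    (by rw [map_pow, constantCoeff_fSeries_inv, one_pow])
  rw [map_pow, ← fSing_inv, inv_pow] at h2
  have hle : Submodule.span ℂ (Set.range (solFrame lam)) ≤
      (iotaRange (degenerate lam)).map (mulBy (fSing lam ^ 2)⁻¹) := by
    rw [Submodule.span_le]
    rintro _ ⟨c, rfl⟩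
    refine ⟨_, fSing_sq_mul_solFrame_mem hlam hinj c, ?_⟩
    exact inv_mul_cancel_left₀ (pow_ne_zero 2 (fSing_ne_zero lam)) _
  rw [← h1.1.eq_of_le h2.1 hle]
  exact h1

end SolFrame

/-! ## The tau function of the explicit frame -/

theorem coeff_expLinear (c : ℕ+ → ℂ) (α : ℕ+ →₀ ℕ) : MvPowerSeries.coeff α (expLinear c) =
    α.prod (fun j a => c j ^ a / (Nat.factorial a : ℂ)) := rfl

theorem constantCoeff_expLinear (c : ℕ+ → ℂ) :
    MvPowerSeries.constantCoeff (expLinear c) = 1 := by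
  rw [← MvPowerSeries.coeff_zero_eq_constantCoeff_apply, coeff_expLinear, Finsupp.prod_zero_index]

theorem pderiv_expLinear (c : ℕ+ → ℂ) (j : ℕ+) :
    MvPowerSeries.pderiv ℂ j (expLinear c) = MvPowerSeries.C (c j) * expLinear c := by
  classical
  ext α
  have h1 : ∀ β : ℕ+ →₀ ℕ, MvPowerSeries.coeff β (expLinear c) =
      c j ^ β j / (Nat.factorial (β j) : ℂ) *
        (β.erase j).prod fun j a => c j ^ a / (Nat.factorial a : ℂ) := fun β => by
    rw [coeff_expLinear]
    exact (Finsupp.mul_prod_erase' β j (fun j a => c j ^ a / (Nat.factorial a : ℂ))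
      fun _ => by simp).symm
  have h2 : (α + Finsupp.single j 1).erase j = α.erase j := by
    rw [Finsupp.erase_add, Finsupp.erase_single, add_zero]
  rw [MvPowerSeries.coeff_pderiv, MvPowerSeries.coeff_C_mul, h1, h1 α, h2, Finsupp.add_apply,
    Finsupp.single_eq_same, Nat.factorial_succ]
  have : (Nat.factorial (α j) : ℂ) ≠ 0 := Nat.cast_ne_zero.2 (Nat.factorial_ne_zero _)
  have : ((α j : ℕ) : ℂ) + 1 ≠ 0 := Nat.cast_add_one_ne_zero _
  push_cast
  field_simp
  ring

theorem coeff_expLinear_one (α : ℕ+ →₀ ℕ) :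
    MvPowerSeries.coeff α (expLinear 1) = invFactorial α := by
  simp [coeff_expLinear, invFactorial]

theorem invFactorial_add_single (α : ℕ+ →₀ ℕ) (j : ℕ+) :
    invFactorial (α + Finsupp.single j 1) * (α j + 1) = invFactorial α := by
  have := congrArg (MvPowerSeries.coeff α) (pderiv_expLinear 1 j)
  rwa [MvPowerSeries.coeff_pderiv, coeff_expLinear_one, Pi.one_apply, map_one, one_mul,
    coeff_expLinear_one] at this

/-- This is ∂p_l/∂x_1 = p_{l-1}, applied term by term. -/
theorem pderiv_dress (F : V) (j : ℤ) :
    MvPowerSeries.pderiv ℂ (1 : ℕ+) (dress F j) = dress F (j - 1) := by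
  ext α
  have hw : wt (α + Finsupp.single 1 1) = wt α + 1 := by simp [wt_add]
  rw [MvPowerSeries.coeff_pderiv, coeff_dress, coeff_dress, hw, mul_assoc,
    invFactorial_add_single]
  congr 2
  push_cast
  ring

theorem iterate_pderiv_dress (F : V) (j : ℤ) (n : ℕ) :
    (MvPowerSeries.pderiv ℂ (1 : ℕ+))^[n] (dress F j) = dress F (j - n) := by
  induction n with
  | zero => simp
  | succ n ih =>
    rw [Function.iterate_succ_apply', ih, pderiv_dress]
    congr 1
    push_cast
    ring

theorem dressDet_succ_of_zPow {X : ℕ → V} {K : ℕ} (h : X K = zPow (-(K : ℤ))) :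
    dressDet (K + 1) X = dressDet K X := by
  rw [dressDet, det_of_last_col_eq]
  · simp only [Matrix.of_apply, Fin.val_last, h, dress_zPow, neg_add_cancel, pPoly_zero, one_mul]
    rfl
  · intro i
    simp only [Matrix.of_apply, Fin.val_last, h, dress_zPow, Fin.val_castSucc]
    exact pPoly_of_neg (by have := i.2; omega)

/-- The tau function of a frame of finite type is a finite determinant. -/
theorem tau_eq_dressDet {X : ℕ → V} {K : ℕ} (h : FrameCondAt X K)
    (hX : ∀ j, K ≤ j → X j = zPow (-(j : ℤ))) : tau X = dressDet K X := by
  have hstab : ∀ L, K ≤ L → dressDet L X = dressDet K X := by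
    intro L hL
    induction L, hL using Nat.le_induction with
    | base => rfl
    | succ L hL ih => rw [dressDet_succ_of_zPow (hX L hL), ih]
  ext α
  rw [coeff_tau_eq_coeff_dressDet (h.mono (le_max_left K (wt α))) (le_max_right _ _),
    hstab _ (le_max_left _ _)]

theorem coeff_geom_sq (μ : ℂ) (n : ℕ) :
    PowerSeries.coeff n (geom μ ^ 2) = (n + 1) * μ ^ n := by
  rw [pow_two, PowerSeries.coeff_mul]
  have : ∀ p ∈ Finset.HasAntidiagonal.antidiagonal n,
      PowerSeries.coeff p.1 (geom μ) * PowerSeries.coeff p.2 (geom μ) = μ ^ n := by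
    intro p hp
    rw [geom, PowerSeries.coeff_mk, PowerSeries.coeff_mk, ← pow_add,
      Finset.HasAntidiagonal.mem_antidiagonal.1 hp]
  rw [Finset.sum_congr rfl this]
  simp

theorem coeff_expXiDeriv_zero (μ : ℂ) (α : ℕ+ →₀ ℕ) :
    MvPowerSeries.coeff α (expXiDeriv 0 μ) = μ ^ wt α * invFactorial α := by
  change iteratedDeriv 0 _ μ = _
  rw [iteratedDeriv_zero]
  exact coeff_expXi_eq μ α

/-- The factor μ restores the exponent lost by differentiation; it is supplied by the λ_i in the
lower block of the matrix. -/
theorem mul_coeff_expXiDeriv_one (μ : ℂ) (α : ℕ+ →₀ ℕ) :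
    μ * MvPowerSeries.coeff α (expXiDeriv 1 μ) = wt α * μ ^ wt α * invFactorial α := by
  change μ * iteratedDeriv 1 _ μ = _
  simp only [iteratedDeriv_one, coeff_expXi_eq]
  rw [deriv_mul_const (differentiableAt_pow _), deriv_pow_field]
  rcases wt α with _ | n
  · simp
  · rw [Nat.add_sub_cancel, pow_succ]
    ring

section Soliton

variable {m : ℕ} (lam : Fin m → ℂ)

theorem solFun_eq_ofPS (r : Fin 3) (j : Fin m) : solFun lam r j = zPow (-(3 * (m : ℤ)) + 1) *
    ofPS (∑ i, (PowerSeries.C (aCoeff lam r i j) * geom (lamExt lam i) +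
      PowerSeries.C (bCoeff lam r i j) * geom (lamExt lam i) ^ 2)) := by
  rw [solFun, map_sum]
  congr 1
  refine Finset.sum_congr rfl fun i _ => ?_
  rw [map_add, map_mul, map_mul, map_pow, ← inv_one_sub_const_mul_zPow, ← const_eq_ofPS,
    ← const_eq_ofPS, inv_pow]

theorem coeff_solFun (r : Fin 3) (j : Fin m) (n : ℕ) :
    (solFun lam r j).coeff ((n : ℤ) - (3 * m - 1)) = ∑ i, (aCoeff lam r i j * lamExt lam i ^ n +
      bCoeff lam r i j * ((n + 1) * lamExt lam i ^ n)) := by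
  rw [solFun_eq_ofPS, coeff_zPow_mul,
    show (n : ℤ) - (3 * m - 1) - (-(3 * m) + 1) = n by ring, coeff_ofPS_natCast, map_sum]
  simp only [map_add, PowerSeries.coeff_C_mul, coeff_geom_sq]
  simp only [geom, PowerSeries.coeff_mk]

/-- The `3m` functions as a family over `Fin (3 * m)`. -/
def solCol (c : Fin (3 * m)) : V :=
  solFun lam (finProdFinEquiv.symm c : Fin 3 × Fin m).1 (finProdFinEquiv.symm c : Fin 3 × Fin m).2

theorem solFrame_rev (c : Fin (3 * m)) : solFrame lam (Fin.rev c : Fin (3 * m)) = solCol lam c := by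
  rw [solFrame, dif_pos (Fin.rev c).2]
  simp only [Fin.eta, Fin.rev_rev]
  rfl

/-- The n-th coefficient aμ^n + b(n + 1)μ^n of a/(1 - μz) + b/(1 - μz)² splits as (a + b)μ^n +
(μb)·nμ^{n-1}. The two parts come from e^ξ and its derivative in μ. -/
theorem gsFun_eq_dress (c : Fin (3 * m)) :
    gsFun (solR m) (solLam lam) (solMat lam) c = dress (solCol lam c) (3 * m - 1) := by
  ext α
  have hsum : MvPowerSeries.coeff α (gsFun (solR m) (solLam lam) (solMat lam) c) =
      ∑ i : Fin (3 * m),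
        (MvPowerSeries.coeff α (MvPowerSeries.C (solMat lam ⟨0, i⟩ c) *
          expXiDeriv ((0 : Fin 2) : ℕ) (solLam lam 0 i)) +
        MvPowerSeries.coeff α (MvPowerSeries.C (solMat lam ⟨1, i⟩ c) *
          expXiDeriv ((1 : Fin 2) : ℕ) (solLam lam 1 i))) := by
    rw [gsFun, Fin.sum_univ_two, map_add, map_sum, map_sum]
    exact Finset.sum_add_distrib.symm
  rw [hsum, coeff_dress, solCol, coeff_solFun, Finset.sum_mul, ← Equiv.sum_comp (finProdFinEquiv (m := 3) (n := m)).symm]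
  refine Finset.sum_congr rfl fun i _ => ?_
  rw [MvPowerSeries.coeff_C_mul, MvPowerSeries.coeff_C_mul]
  have h0 := coeff_expXiDeriv_zero (solLam lam 0 i) α
  have h1 := mul_coeff_expXiDeriv_one (solLam lam 1 i) α
  have e0 : solMat lam ⟨0, i⟩ c = aCoeff lam (finProdFinEquiv.symm c : Fin 3 × Fin m).1
      (finProdFinEquiv.symm i) (finProdFinEquiv.symm c : Fin 3 × Fin m).2 +
      bCoeff lam (finProdFinEquiv.symm c : Fin 3 × Fin m).1
      (finProdFinEquiv.symm i) (finProdFinEquiv.symm c : Fin 3 × Fin m).2 := rfl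
  have e1 : solMat lam ⟨1, i⟩ c = solLam lam 1 i *
      bCoeff lam (finProdFinEquiv.symm c : Fin 3 × Fin m).1
      (finProdFinEquiv.symm i) (finProdFinEquiv.symm c : Fin 3 × Fin m).2 := rfl
  have e2 : solLam lam 0 i = lamExt lam (finProdFinEquiv.symm i) := rfl
  have e3 : solLam lam 1 i = lamExt lam (finProdFinEquiv.symm i) := rfl
  rw [e0, e1]
  rw [e2] at h0 ⊢
  rw [e3] at h1 ⊢
  rw [Fin.val_zero, Fin.val_one, h0]
  linear_combination bCoeff lam (finProdFinEquiv.symm c : Fin 3 × Fin m).1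
      (finProdFinEquiv.symm i) (finProdFinEquiv.symm c : Fin 3 × Fin m).2 * h1

/-- The i-th derivative lowers the index 3m - 1 to 3m - 1 - i, so the Wronskian matrix is the
dressed matrix with rows and columns both reversed, and no sign appears. -/
theorem tau_solFrame {lam : Fin m → ℂ} (hlam : ∀ j, lam j ≠ 0)
    (hinj : Function.Injective fun j => lam j ^ 3) :
    tau (solFrame lam) = gsTau (solR m) (solLam lam) (solMat lam) := by
  rw [tau_eq_dressDet (frameCondAt_solFrame hlam hinj) fun j hj => dif_neg (not_lt.2 hj), gsTau,
    wronskian, dressDet, ← Matrix.det_submatrix_equiv_self Fin.revPerm]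
  congr 1
  ext1 i c
  simp only [Matrix.submatrix_apply, Matrix.of_apply, Fin.revPerm_apply, gsFun_eq_dress,
    iterate_pderiv_dress, solFrame_rev]
  congr 1
  rw [Fin.val_rev]
  have := i.2
  omega

theorem lamExt_injective {lam : Fin m → ℂ} (hlam : ∀ j, lam j ≠ 0)
    (hinj : Function.Injective fun j => lam j ^ 3) : Function.Injective (lamExt lam) := by
  rintro ⟨k, j⟩ ⟨k', j'⟩ h
  simp only [lamExt] at h
  have hcube : ∀ (k : Fin 3) (j : Fin m), (omega ^ (k : ℕ) * lam j) ^ 3 = lam j ^ 3 := by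
    intro k j
    rw [mul_pow, ← pow_mul, mul_comm (k : ℕ), pow_mul, omega_pow_three, one_pow, one_mul]
  have hj : j = j' := hinj (by
    have := congrArg (· ^ 3) h
    simpa only [hcube] using this)
  subst hj
  exact Prod.ext (Fin.ext (isPrimitiveRoot_omega.pow_inj k.2 k'.2
    (mul_right_cancel₀ (hlam j) h))) rfl

theorem linearIndependent_solCol {lam : Fin m → ℂ} (hlam : ∀ j, lam j ≠ 0)
    (hinj : Function.Injective fun j => lam j ^ 3) : LinearIndependent ℂ (solCol lam) := by
  have := (linearIndependent_solFrame hlam hinj).comp (fun c : Fin (3 * m) => ((Fin.rev c : Fin _) : ℕ))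
    (Fin.val_injective.comp Fin.rev_injective)
  convert this using 1
  ext1 c
  exact (solFrame_rev lam c).symm

/-- A relation between the columns of the matrix gives the same relation between the 3m functions,
which are independent because their leading exponents differ. The lower block yields the relation
for b, as λ_i ≠ 0, and the upper block then yields the one for a. -/
theorem rank_solMat {lam : Fin m → ℂ} (hlam : ∀ j, lam j ≠ 0)
    (hinj : Function.Injective fun j => lam j ^ 3) : (solMat lam).rank = 3 * m := by
  have hli : LinearIndependent ℂ (solMat lam).transpose.row := by
    rw [Fintype.linearIndependent_iff]
    intro v hv
    refine Fintype.linearIndependent_iff.1 (linearIndependent_solCol hlam hinj) v ?_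
    have hrow : ∀ p, ∑ c, v c * solMat lam p c = 0 := by
      intro p
      have := congrFun hv p
      simpa using this
    have hb : ∀ i : Fin 3 × Fin m, ∑ c : Fin (3 * m), v c *
        bCoeff lam (finProdFinEquiv.symm c : Fin 3 × Fin m).1 i
          (finProdFinEquiv.symm c : Fin 3 × Fin m).2 = 0 := by
      intro i
      have h : ∑ c : Fin (3 * m), v c * (lamExt lam i *
          bCoeff lam (finProdFinEquiv.symm c : Fin 3 × Fin m).1 i
          (finProdFinEquiv.symm c : Fin 3 × Fin m).2) = 0 := by
        have := hrow ⟨1, finProdFinEquiv i⟩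
        simpa [solMat] using this
      simp only [mul_left_comm _ (lamExt lam i)] at h
      rw [← Finset.mul_sum] at h
      exact (mul_eq_zero.1 h).resolve_left
        (mul_ne_zero (pow_ne_zero _ omega_ne_zero) (hlam _))
    have ha : ∀ i : Fin 3 × Fin m, ∑ c : Fin (3 * m), v c *
        aCoeff lam (finProdFinEquiv.symm c : Fin 3 × Fin m).1 i
          (finProdFinEquiv.symm c : Fin 3 × Fin m).2 = 0 := by
      intro i
      have h : ∑ c : Fin (3 * m), v c * (aCoeff lam (finProdFinEquiv.symm c : Fin 3 × Fin m).1 i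
          (finProdFinEquiv.symm c : Fin 3 × Fin m).2 +
          bCoeff lam (finProdFinEquiv.symm c : Fin 3 × Fin m).1 i
          (finProdFinEquiv.symm c : Fin 3 × Fin m).2) = 0 := by
        have := hrow ⟨0, finProdFinEquiv i⟩
        simpa [solMat] using this
      simp only [mul_add, Finset.sum_add_distrib, hb, add_zero] at h
      exact h
    have hcol : ∀ c, v c • solCol lam c = zPow (-(3 * (m : ℤ)) + 1) * ∑ i,
        (const (v c * aCoeff lam (finProdFinEquiv.symm c : Fin 3 × Fin m).1 i
          (finProdFinEquiv.symm c : Fin 3 × Fin m).2) *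
            (1 - const (lamExt lam i) * zPow 1)⁻¹ +
        const (v c * bCoeff lam (finProdFinEquiv.symm c : Fin 3 × Fin m).1 i
          (finProdFinEquiv.symm c : Fin 3 × Fin m).2) *
            ((1 - const (lamExt lam i) * zPow 1) ^ 2)⁻¹) := by
      intro c
      rw [solCol, solFun, smul_eq_const_mul, mul_left_comm]
      congr 1
      rw [Finset.mul_sum]
      refine Finset.sum_congr rfl fun i _ => ?_
      rw [const_mul, const_mul]
      ring
    rw [Finset.sum_congr rfl fun c _ => hcol c, ← Finset.mul_sum, Finset.sum_comm]
    refine mul_eq_zero_of_right _ (Finset.sum_eq_zero fun i _ => ?_)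
    simp only [Finset.sum_add_distrib, ← Finset.sum_mul, ← const_sum, ha, hb, const_zero, zero_mul, add_zero]
  rw [← Matrix.rank_transpose, hli.rank_matrix, Fintype.card_fin]

theorem isGSParam_sol (hm : 0 < m) {lam : Fin m → ℂ} (hlam : ∀ j, lam j ≠ 0)
    (hinj : Function.Injective fun j => lam j ^ 3) :
    IsGSParam (6 * m) (3 * m) (solR m) (solLam lam) (solMat lam) where
  k_pos := by omega
  k_lt := by omega
  sum_r := by
    rw [Fin.sum_univ_two]
    change 3 * m + 3 * m = 6 * m
    ring
  lam_ne _ _ := mul_ne_zero (pow_ne_zero _ omega_ne_zero) (hlam _)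
  lam_inj _ := (lamExt_injective hlam hinj).comp finProdFinEquiv.symm.injective
  rank_eq := rank_solMat hlam hinj

end Soliton

/-! ## The gauge factor -/

/-- The equation in x_j expresses the coefficient at α, whenever α_j > 0, through one of smaller
weight. A solution is thus determined by its constant term. -/
theorem eq_zero_of_pderiv_eq {F : TimeSeries} {c : ℕ+ → ℂ}
    (h : ∀ j, MvPowerSeries.pderiv ℂ j F = MvPowerSeries.C (c j) * F)
    (h0 : MvPowerSeries.constantCoeff F = 0) : F = 0 := by
  classical
  ext α
  rw [map_zero]
  induction hn : wt α using Nat.strong_induction_on generalizing α with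
  | _ n ih =>
    by_cases hα : α = 0
    · rw [hα]
      exact h0
    · obtain ⟨j, hj⟩ := Finsupp.ne_iff.1 hα
      have hβ : α - Finsupp.single j 1 + Finsupp.single j 1 = α :=
        tsub_add_cancel_of_le (Finsupp.single_le_iff.2 (Nat.one_le_iff_ne_zero.2 hj))
      have hw := wt_add (α - Finsupp.single j 1) (Finsupp.single j 1)
      rw [hβ, wt_single, one_mul] at hw
      have hz := ih _ (by have := j.pos; omega) (α - Finsupp.single j 1) rfl
      have := congrArg (MvPowerSeries.coeff (α - Finsupp.single j 1)) (h j)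
      rw [MvPowerSeries.coeff_pderiv, hβ, MvPowerSeries.coeff_C_mul, hz, mul_zero] at this
      exact (mul_eq_zero.1 this).resolve_right (Nat.cast_add_one_ne_zero _)

theorem expLinear_mul (c d : ℕ+ → ℂ) : expLinear c * expLinear d = expLinear (c + d) := by
  rw [← sub_eq_zero]
  refine eq_zero_of_pderiv_eq (c := c + d) (fun j => ?_) ?_
  · rw [map_sub, Derivation.leibniz, pderiv_expLinear, pderiv_expLinear, pderiv_expLinear,
      Pi.add_apply, map_add, smul_eq_mul, smul_eq_mul]
    ring
  · rw [map_sub, map_mul, constantCoeff_expLinear, constantCoeff_expLinear,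
      constantCoeff_expLinear, mul_one, sub_self]

theorem expLinear_zero : expLinear 0 = 1 := by
  refine MvPowerSeries.pderiv.ext (fun j => ?_) ?_
  · rw [pderiv_expLinear, MvPowerSeries.pderiv_one, Pi.zero_apply, map_zero, zero_mul]
  · rw [constantCoeff_expLinear, map_one]

theorem prod_expLinear {ι : Type*} (s : Finset ι) (c : ι → ℕ+ → ℂ) :
    ∏ i ∈ s, expLinear (c i) = expLinear (∑ i ∈ s, c i) := by
  classical
  induction s using Finset.induction_on with
  | empty => rw [Finset.prod_empty, Finset.sum_empty, expLinear_zero]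
  | insert a s ha ih => rw [Finset.prod_insert ha, Finset.sum_insert ha, ih, expLinear_mul]

theorem derivative_geom (μ : ℂ) : PowerSeries.derivative ℂ (geom μ) =
    PowerSeries.C μ * geom μ ^ 2 := by
  ext n
  rw [PowerSeries.coeff_derivative, PowerSeries.coeff_C_mul, coeff_geom_sq, geom,
    PowerSeries.coeff_mk, pow_succ]
  ring

theorem derivative_prod_geom_sq {ι : Type*} (s : Finset ι) (μ : ι → ℂ) :
    PowerSeries.derivative ℂ (∏ i ∈ s, geom (μ i) ^ 2) =
      (∏ i ∈ s, geom (μ i) ^ 2) * ∑ i ∈ s, PowerSeries.C (2 * μ i) * geom (μ i) := by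
  classical
  induction s using Finset.induction_on with
  | empty => simp
  | insert a s ha ih =>
    rw [Finset.prod_insert ha, Finset.sum_insert ha, Derivation.leibniz, ih, smul_eq_mul,
      smul_eq_mul, PowerSeries.derivative_pow, derivative_geom, map_mul, map_ofNat]
    push_cast
    ring

section Gauge

variable {m : ℕ} (lam : Fin m → ℂ)

theorem coeff_succ_gaugeLog (n : ℕ) : PowerSeries.coeff (n + 1) (gaugeLog lam) =
    -2 * (∑ i, lamExt lam i ^ (n + 1)) / (n + 1 : ℕ) := by
  rw [gaugeLog, PowerSeries.coeff_mk, dif_pos n.succ_pos]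
  rfl

theorem constantCoeff_gaugeLog : PowerSeries.constantCoeff (gaugeLog lam) = 0 := by
  simp [gaugeLog, ← PowerSeries.coeff_zero_eq_constantCoeff_apply]

theorem derivative_gaugeLog : PowerSeries.derivative ℂ (gaugeLog lam) =
    -∑ i, PowerSeries.C (2 * lamExt lam i) * geom (lamExt lam i) := by
  ext n
  have : (n : ℂ) + 1 ≠ 0 := Nat.cast_add_one_ne_zero n
  rw [PowerSeries.coeff_derivative, map_neg, map_sum, coeff_succ_gaugeLog]
  simp only [PowerSeries.coeff_C_mul, geom, PowerSeries.coeff_mk]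
  push_cast
  rw [div_mul_cancel₀ _ this, neg_mul, Finset.mul_sum]
  congr 1
  refine Finset.sum_congr rfl fun i _ => ?_
  rw [pow_succ]
  ring

theorem fSeries_eq_prod :
    fSeries lam = ∏ i, (1 - PowerSeries.C (lamExt lam i) * PowerSeries.X) := by
  rw [fSeries, Fintype.prod_prod_type_right]
  refine Finset.prod_congr rfl fun j _ => ?_
  have hw : (PowerSeries.C omega : PowerSeries ℂ) ^ 2 + PowerSeries.C omega + 1 = 0 := by
    rw [← map_pow, ← map_one PowerSeries.C, ← map_add, ← map_add, omega_sq_add, map_zero]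
  simp only [lamExt, Fin.prod_univ_three, Fin.val_zero, Fin.val_one, Fin.val_two, map_mul, map_pow,
    pow_zero, pow_one, one_mul]
  generalize (PowerSeries.C omega : PowerSeries ℂ) = w at hw
  generalize (PowerSeries.C (lam j) : PowerSeries ℂ) = a
  generalize (PowerSeries.X : PowerSeries ℂ) = x
  grind

theorem fSeries_mul_prod_geom : fSeries lam * ∏ i, geom (lamExt lam i) = 1 := by
  rw [fSeries_eq_prod, ← Finset.prod_mul_distrib]
  exact Finset.prod_eq_one fun i _ => one_sub_mul_geom _

/-- The logarithmic derivatives of the exponential and of ∏ 1/(1 - λ_i z)² are opposite, so the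
product of the two series has derivative 0 and constant term 1. -/
theorem exp_subst_gaugeLog :
    (PowerSeries.exp ℂ).subst (gaugeLog lam) = fSeries lam ^ 2 := by
  have hs : PowerSeries.HasSubst (gaugeLog lam) :=
    PowerSeries.HasSubst.of_constantCoeff_zero' (constantCoeff_gaugeLog lam)
  set E : PowerSeries ℂ := (PowerSeries.exp ℂ).subst (gaugeLog lam) with hE
  have hEd : PowerSeries.derivative ℂ E = E * PowerSeries.derivative ℂ (gaugeLog lam) := by
    rw [hE, PowerSeries.derivative_subst hs, PowerSeries.derivative_exp]
  have hE0 : PowerSeries.constantCoeff E = 1 := by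
    have h0 : MvPowerSeries.constantCoeff (gaugeLog lam) = 0 := constantCoeff_gaugeLog lam
    refine (PowerSeries.constantCoeff_subst hs _).trans ?_
    rw [finsum_eq_single _ 0]
    · simp
    · intro n hn
      simp [h0, hn]
  have h1 : E * ∏ i, geom (lamExt lam i) ^ 2 = 1 := by
    refine PowerSeries.derivative.ext ?_ ?_
    · rw [Derivation.leibniz, hEd, derivative_prod_geom_sq, derivative_gaugeLog,
        PowerSeries.derivative_one, smul_eq_mul, smul_eq_mul]
      ring
    · rw [map_mul, hE0, map_prod, map_one, one_mul]
      exact Finset.prod_eq_one fun i _ => by rw [map_pow, constantCoeff_geom, one_pow]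
  have h2 := fSeries_mul_prod_geom lam
  rw [Finset.prod_pow] at h1
  calc E = E * (fSeries lam * ∏ i, geom (lamExt lam i)) ^ 2 := by rw [h2, one_pow, mul_one]
    _ = (E * (∏ i, geom (lamExt lam i)) ^ 2) * fSeries lam ^ 2 := by ring
    _ = fSeries lam ^ 2 := by rw [h1, one_mul]

/-- The exponents cancel, because g_n + 2∑ λ_i^n = 0. -/
theorem expLinear_gaugeCoeff_mul :
    expLinear (gaugeCoeff lam) * (∏ i, expXi (lamExt lam i)) ^ 2 = 1 := by
  simp only [expXi, prod_expLinear]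
  rw [pow_two, expLinear_mul, expLinear_mul, ← expLinear_zero]
  congr 1
  funext n
  simp only [Pi.add_apply, Finset.sum_apply, gaugeCoeff, Pi.zero_apply]
  ring

theorem exists_tau_eq_of_isFrame_degenerate {lam : Fin m → ℂ} (hlam : ∀ j, lam j ≠ 0)
    (hinj : Function.Injective fun j => lam j ^ 3) {Y : ℕ → V}
    (hY : IsFrame (iotaRange (degenerate lam)) Y) : ∃ c : ℂ, c ≠ 0 ∧
      tau Y = MvPowerSeries.C c * expLinear (gaugeCoeff lam) *
        gsTau (solR m) (solLam lam) (solMat lam) := by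
  -- Multiplying the explicit frame back by f² gives a frame of the untwisted point; any other frame
  -- Y changes τ only by a nonzero constant.
  have hX := (isFrame_solFrame hlam hinj).ofPS_mul (φ := fSeries lam ^ 2)
    (by rw [map_pow, constantCoeff_fSeries, one_pow])
  rw [map_mulBy_mulBy, map_pow, ← fSing_eq_ofPS,
    mul_inv_cancel₀ (pow_ne_zero 2 (fSing_ne_zero lam)), map_mulBy_one] at hX
  obtain ⟨c, hc, hcY⟩ := exists_tau_eq_of_isFrame hX hY
  refine ⟨c, hc, ?_⟩
  set X : ℕ → V := fun j => fSing lam ^ 2 * solFrame lam j with hXdef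
  set G : PowerSeries ℂ := ∏ i, geom (lamExt lam i) with hG
  have hG1 : PowerSeries.constantCoeff G = 1 := by
    rw [hG, map_prod]
    exact Finset.prod_eq_one fun i _ => constantCoeff_geom _
  have hXc : FrameCond X := hX.2.2.2
  have hGX : FrameCond fun j => ofPS G * X j := (hX.ofPS_mul hG1).2.2.2
  -- G = 1/f is a product of geometric series, so the passage from X to the explicit frame is two
  -- divisions by all factors 1 - λ_i z.
  have h1 : (fun j => ofPS G * (ofPS G * X j)) = solFrame lam := by
    funext j
    have : ofPS G * fSing lam = 1 := by
      rw [fSing_eq_ofPS, ← map_mul, mul_comm, hG, fSeries_mul_prod_geom, map_one]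
    calc ofPS G * (ofPS G * X j) = (ofPS G * fSing lam) ^ 2 * solFrame lam j := by
          rw [hXdef]
          ring
      _ = solFrame lam j := by rw [this, one_pow, one_mul]
  have h2 : tau (solFrame lam) = (∏ i, expXi (lamExt lam i)) ^ 2 * tau X := by
    rw [← h1, tau_prod_geom_mul hGX, tau_prod_geom_mul hXc, pow_two, mul_assoc]
  rw [hcY, ← tau_solFrame hlam hinj, h2, ← mul_assoc, mul_assoc (MvPowerSeries.C c),
    expLinear_gaugeCoeff_mul, mul_one]

end Gauge

/-! ## Singular points of the degenerate curve -/

theorem homogeneousComponent_aeval_X (d : ℕ) (i : Fin 2) (q : Polynomial ℂ) :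
    MvPolynomial.homogeneousComponent d
      (Polynomial.aeval (MvPolynomial.X i : MvPolynomial (Fin 2) ℂ) q) =
      MvPolynomial.C (q.coeff d) * MvPolynomial.X i ^ d := by
  rw [Polynomial.aeval_eq_sum_range, map_sum]
  have h : ∀ n, MvPolynomial.homogeneousComponent d
      (q.coeff n • (MvPolynomial.X i : MvPolynomial (Fin 2) ℂ) ^ n) =
      if d = n then MvPolynomial.C (q.coeff n) * MvPolynomial.X i ^ n else 0 := by
    intro n
    rw [map_smul, MvPolynomial.homogeneousComponent_of_mem (n := n)
      (MvPolynomial.isHomogeneous_X_pow i n), smul_ite, smul_zero, MvPolynomial.smul_eq_C_mul]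
  simp only [h, Finset.sum_ite_eq, Finset.mem_range]
  split_ifs with hd
  · rfl
  · rw [Polynomial.coeff_eq_zero_of_natDegree_lt (by omega), map_zero, zero_mul]

section Singular

open Polynomial

variable {m : ℕ} (lam : Fin m → ℂ)

/-- The right-hand side `x ∏ (x - λ_j³)³` of the equation of the degenerate curve. -/
def curveRhs : ℂ[X] := X * ∏ j, (X - C (lam j ^ 3)) ^ 3

/-- The variables are separated, so each homogeneous component is a pure power of y minus a pure
power of x with Taylor coefficients in front. -/
theorem translate_curvePoly_degenerate (a b : ℂ) : translate (curvePoly (degenerate lam)) a b =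
    aeval (MvPolynomial.X 1) (taylor b (X ^ 3)) -
      aeval (MvPolynomial.X 0) (taylor a (curveRhs lam)) := by
  rw [curvePoly_degenerate, translate, curveRhs]
  simp [taylor_apply, MvPolynomial.algebraMap_eq, Polynomial.prod_comp]

theorem homogeneousComponent_translate (a b : ℂ) (d : ℕ) :
    MvPolynomial.homogeneousComponent d (translate (curvePoly (degenerate lam)) a b) =
      MvPolynomial.C ((taylor b (X ^ 3)).coeff d) * MvPolynomial.X 1 ^ d -
        MvPolynomial.C ((taylor a (curveRhs lam)).coeff d) * MvPolynomial.X 0 ^ d := by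
  rw [translate_curvePoly_degenerate, map_sub, homogeneousComponent_aeval_X,
    homogeneousComponent_aeval_X]

theorem exists_taylor_curveRhs {lam : Fin m → ℂ} (hlam : ∀ j, lam j ≠ 0)
    (hinj : Function.Injective fun j => lam j ^ 3) (j : Fin m) :
    ∃ h : ℂ[X], taylor (lam j ^ 3) (curveRhs lam) = X ^ 3 * h ∧ h.coeff 0 ≠ 0 := by
  refine ⟨taylor (lam j ^ 3) (X * ∏ l ∈ Finset.univ.erase j, (X - C (lam l ^ 3)) ^ 3), ?_, ?_⟩
  · have h1 : taylor (lam j ^ 3) ((X - C (lam j ^ 3)) ^ 3) = X ^ 3 := by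
      simp [taylor_apply]
    rw [← h1, ← taylor_mul, mul_left_comm, curveRhs,
      Finset.mul_prod_erase _ (fun j => (X - C (lam j ^ 3)) ^ 3) (Finset.mem_univ j)]
  · rw [taylor_coeff_zero, eval_mul, eval_X, eval_prod]
    refine mul_ne_zero (pow_ne_zero 3 (hlam j)) (Finset.prod_ne_zero_iff.2 fun l hl => ?_)
    rw [eval_pow, eval_sub, eval_X, eval_C]
    exact pow_ne_zero 3 (sub_ne_zero.2 fun h => Finset.ne_of_mem_erase hl (hinj h).symm)

theorem coeff_taylor_zero_X_pow_three (d : ℕ) :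
    (taylor 0 (X ^ 3 : ℂ[X])).coeff d = if d = 3 then 1 else 0 := by
  rw [taylor_zero, coeff_X_pow]

theorem isOrdinaryTriplePoint_curvePoly {lam : Fin m → ℂ} (hlam : ∀ j, lam j ≠ 0)
    (hinj : Function.Injective fun j => lam j ^ 3) (j : Fin m) :
    IsOrdinaryTriplePoint (curvePoly (degenerate lam)) (lam j ^ 3) 0 := by
  obtain ⟨h, hh, h0⟩ := exists_taylor_curveRhs hlam hinj j
  refine ⟨fun d hd => ?_, ?_⟩
  · rw [homogeneousComponent_translate, coeff_taylor_zero_X_pow_three, hh, coeff_X_pow_mul',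
      if_neg hd.ne, if_neg (by omega), map_zero, zero_mul, zero_mul, sub_self]
  -- The tangent cone is y³ - κ³x³, with κ³ = h(0) ≠ 0; it splits into the three distinct lines y =
  -- ω^t κ x.
  · obtain ⟨κ, hκ⟩ := IsAlgClosed.exists_pow_nat_eq (h.coeff 0) (n := 3) (by norm_num)
    have hκ0 : κ ≠ 0 := by
      rintro rfl
      exact h0 (by rw [← hκ]; norm_num)
    refine ⟨fun t => -(omega ^ (t : ℕ) * κ), fun _ => 1, fun s t hst heq => hst ?_, ?_⟩
    · simp only [mul_one, neg_inj] at heq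
      exact Fin.ext (isPrimitiveRoot_omega.pow_inj s.2 t.2 (mul_right_cancel₀ hκ0 heq))
    · rw [homogeneousComponent_translate, coeff_taylor_zero_X_pow_three, hh, coeff_X_pow_mul',
        if_pos rfl, if_pos le_rfl, Nat.sub_self, ← hκ]
      have hw : (MvPolynomial.C omega : MvPolynomial (Fin 2) ℂ) ^ 2 + MvPolynomial.C omega + 1 = 0 := by
        rw [← map_pow, ← map_one MvPolynomial.C, ← map_add, ← map_add, omega_sq_add, map_zero]
      simp only [Fin.prod_univ_three, Fin.val_zero, Fin.val_one, Fin.val_two, map_mul, map_pow,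
        map_neg, pow_zero, pow_one, one_mul, map_one]
      generalize (MvPolynomial.C omega : MvPolynomial (Fin 2) ℂ) = w at hw
      generalize (MvPolynomial.C κ : MvPolynomial (Fin 2) ℂ) = k
      generalize (MvPolynomial.X 0 : MvPolynomial (Fin 2) ℂ) = x
      generalize (MvPolynomial.X 1 : MvPolynomial (Fin 2) ℂ) = y
      grind

theorem isSingularPoint_curvePoly_iff {lam : Fin m → ℂ} (hlam : ∀ j, lam j ≠ 0)
    (hinj : Function.Injective fun j => lam j ^ 3) (a b : ℂ) :
    IsSingularPoint (curvePoly (degenerate lam)) a b ↔ ∃ j, a = lam j ^ 3 ∧ b = 0 := by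
  constructor
  · intro h
    have h0 := h 0 (by norm_num)
    have h1 := h 1 (by norm_num)
    rw [homogeneousComponent_translate] at h0 h1
    -- With R the right-hand side of the curve equation, the three evaluations give b³ = R(a), 3b² =
    -- 0 and R'(a) = 0.
    have e0 := congrArg (MvPolynomial.eval ![0, 0]) h0
    have e1 := congrArg (MvPolynomial.eval ![0, 1]) h1
    have e2 := congrArg (MvPolynomial.eval ![1, 0]) h1
    simp only [taylor_coeff_zero, taylor_coeff_one, map_sub, map_mul, MvPolynomial.eval_C,
      map_pow, MvPolynomial.eval_X, pow_zero, pow_one, mul_one, map_zero, Matrix.cons_val_zero,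
      Matrix.cons_val_one, mul_zero, sub_zero, zero_sub, neg_eq_zero, eval_pow, eval_X,
      derivative_X_pow, eval_mul, eval_C] at e0 e1 e2
    have hb : b = 0 := by simpa using e1
    rw [hb, zero_pow (by norm_num), zero_sub, neg_eq_zero, curveRhs, eval_mul, eval_X, eval_prod,
      mul_eq_zero, Finset.prod_eq_zero_iff] at e0
    rcases e0 with rfl | ⟨j, -, hj⟩
    -- At a = 0 the zero of R is simple, since R'(0) = ∏(-λ_j³)³ ≠ 0.
    · exfalso
      rw [curveRhs, derivative_mul, derivative_X, eval_add, eval_mul, eval_mul, eval_X, zero_mul,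
        add_zero, eval_one, one_mul, eval_prod, Finset.prod_eq_zero_iff] at e2
      obtain ⟨j, -, hj⟩ := e2
      simp [hlam j] at hj
    · refine ⟨j, ?_, hb⟩
      rw [eval_pow, eval_sub, eval_X, eval_C] at hj
      exact sub_eq_zero.1 (pow_eq_zero_iff (by norm_num) |>.1 hj)
  · rintro ⟨j, rfl, rfl⟩ d hd
    exact (isOrdinaryTriplePoint_curvePoly hlam hinj j).1 d (by omega)

end Singular

end TrigonalKP

end

/-! ### Assembly of the theorem -/

theorem mainTheorem1 (m : ℕ) (hm : 0 < m) (lam : Fin m → ℂ) (hlam : ∀ j, lam j ≠ 0)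
    (hinj : Function.Injective fun j => lam j ^ 3) :
    -- the degenerate curve is singular exactly at the points `(λ_j³, 0)`,
    -- which are ordinary triple points
    (∀ a b : ℂ, IsSingularPoint (curvePoly (degenerate lam)) a b ↔ ∃ j, a = lam j ^ 3 ∧ b = 0) ∧
    (∀ j, IsOrdinaryTriplePoint (curvePoly (degenerate lam)) (lam j ^ 3) 0) ∧
    -- the frames of the curves, and their tau functions, degenerate to those of the singular curve
    (∀ ρ : Fin 3 × Fin m → ℂ, IsFrame (iotaRange ρ) (curveFrame ρ)) ∧
    (∀ (c : ℕ) (n : ℤ), Filter.Tendsto (fun ρ : Fin 3 × Fin m → ℂ => (curveFrame ρ c).coeff n)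
      (𝓝 (degenerate lam)) (𝓝 ((curveFrame (degenerate lam) c).coeff n))) ∧
    (∀ α : ℕ+ →₀ ℕ, Filter.Tendsto
      (fun ρ : Fin 3 × Fin m → ℂ => MvPowerSeries.coeff α (tau (curveFrame ρ)))
      (𝓝 (degenerate lam)) (𝓝 (MvPowerSeries.coeff α (tau (curveFrame (degenerate lam)))))) ∧
    -- the explicit frame of the gauge-transformed point
    IsFrame ((iotaRange (degenerate lam)).map (mulBy (fSing lam ^ 2)⁻¹))
      (solFrame lam) ∧
    -- it is the frame of an explicit `(6m, 3m)` generalized soliton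
    IsGSParam (6 * m) (3 * m) (solR m) (solLam lam) (solMat lam) ∧
    tau (solFrame lam) = gsTau (solR m) (solLam lam) (solMat lam) ∧
    -- the tau function of the degenerate curve is this generalized soliton up to the gauge factor
    -- `exp (∑ g_n x_n)`, where `f(z)² = exp (∑ g_n z^n / n)`
    HahnSeries.ofPowerSeries ℤ ℂ ((PowerSeries.exp ℂ).subst (gaugeLog lam)) = fSing lam ^ 2 ∧
    (∀ Y : ℕ → V, IsFrame (iotaRange (degenerate lam)) Y → ∃ c : ℂ, c ≠ 0 ∧
      tau Y = MvPowerSeries.C c * expLinear (gaugeCoeff lam) *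
        gsTau (solR m) (solLam lam) (solMat lam)) := by
  exact ⟨isSingularPoint_curvePoly_iff hlam hinj, isOrdinaryTriplePoint_curvePoly hlam hinj,
    isFrame_curveFrame, fun c n => (continuous_coeff_curveFrame c n).tendsto _,
    fun α => (continuous_coeff_tau_curveFrame α).tendsto _, isFrame_solFrame hlam hinj,
    isGSParam_sol hm hlam hinj, tau_solFrame hlam hinj,
    by rw [exp_subst_gaugeLog, map_pow, fSing_eq_ofPS],
    fun Y hY => exists_tau_eq_of_isFrame_degenerate hlam hinj hY⟩
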